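/- **Conventions.** $\mathcal G \rightrightarrows M$ is a Lie groupoid with source $s$, target $t$ (both submersions) and multiplication $m$ (written $gh$, defined when $s(g)=t(h)$); $\mathcal G$ and $M$ are finite-dimensional, Hausdorff, second countable smooth manifolds. A connection in $TN\to N$ is a linear connection. For a smooth map $F\colon N\to P$, connections $\nabla$ in $TN$ and $\nabla'$ in $TP$ are $F$-related if $\nabla_{X_1}X_2$ and $\nabla'_{Y_1}Y_2$ are $F$-related whenever $X_1,Y_1$ and $X_2,Y_2$ are $F$-related vector fields. A connection $\nabla$ in $T\mathcal G$ is *$s$-projectable* if it is $s$-related to some connection in $TM$. It is *multiplicative* if it is both $s$- and $t$-related to one and the same connection in $TM$ and, moreover, the restriction of the product connection $\nabla\times\nabla$ to $\mathcal G^{(2)}=\{(g,h): s(g)=t(h)\}$ is $m$-related to $\nabla$ (a connection on $N\subseteq \mathcal G\times\mathcal G$ is the restriction of $\nabla\times\nabla$ if it is related to $\nabla\times\nabla$ by the inclusion). Let $\mathcal G^{[k]}$ be the manifold of $k$-tuples of arrows with the same source, let $\bar m\colon\mathcal G^{[2]}\to\mathcal G$, $\bar m(g,h)=gh^{-1}$,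 and $T^{0,2}N=TN\otimes TN$. Tangent vectors to $\mathcal G^{[k]}$ are $k$-tuples of tangent vectors to $\mathcal G$ with the same $ds$-projection, and $(v_1^\otimes,\dots,v_k^\otimes)$ denotes $(v_1^1,\dots,v_k^1)\otimes(v_1^2,\dots,v_k^2)\in T^{0,2}\mathcal G^{[k]}$. **The complex $\bar C^\bullet_{\mathrm{def}}(\mathcal G,T^{2,0})$ in degrees $\ge 0$.** A $0$-cochain is a $(2,1)$-tensor $U\colon T^{0,2}\mathcal G\to T\mathcal G$ such that $ds\circ U=U^M\circ ds^{\otimes 2}$ for some $(2,1)$-tensor $U^M$ on $M$. For $k\ge1$, a $k$-cochain is a smooth vector bundle map $U\colon T^{0,2}\mathcal G^{[k+1]}\to T\mathcal G$ covering $(g_1,\dots,g_{k+1})\mapsto g_1g_2^{-1}$ such that $ds\,U(v_1^\otimes,\dots,v_{k+1}^\otimes)=U^M(v_2^\otimes,\dots,v_{k+1}^\otimes)$ for some smooth vector bundle map $U^M\colon T^{0,2}\mathcal G^{[k]}\to TM$ covering $(g_1,\dots,g_k)\mapsto t(g_1)$. For $k\ge 0$ the differential is $$\begin{aligned}\bar\delta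 U(v_1^\otimes,\dots,v_{k+2}^\otimes)={}&-d\bar m\big(U(v_1^\otimes,v_3^\otimes,\dots,v_{k+2}^\otimes),\,U(v_2^\otimes,\dots,v_{k+2}^\otimes)\big)\\&+\sum_{i=3}^{k+2}(-1)^{i+1}U(v_1^\otimes,\dots,\widehat{v_i^\otimes},\dots,v_{k+2}^\otimes)\\&+(-1)^kU\big(d\bar m^{\otimes2}(v_1^\otimes,v_{k+2}^\otimes),\dots,d\bar m^{\otimes 2}(v_{k+1}^\otimes,v_{k+2}^\otimes)\big),\end{aligned}$$ and $H^1$ is the space of $1$-cocycles (the $1$-cochains $U$ with $\bar\delta U=0$) modulo coboundaries $\bar\delta W$ of $0$-cochains $W$. **The Atiyah cochain.** If $\nabla$ is $s$-projectable, let $\nabla^{[2]}$ be the restriction of $\nabla\times\nabla$ to $\mathcal G^{[2]}$. The Atiyah cochain $\mathsf{At}_\nabla$ is the bundle map $T^{0,2}\mathcal G^{[2]}\to\bar m^*T\mathcal G$ with $$\langle\theta,\mathsf{At}_\nabla(v\otimes w)\rangle=\big(\bar m^*(\nabla\theta)-\nabla^{[2]}(\bar m^*\theta)\big)(v,w)\qquad\text{for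 all }\theta\in\Omega^1(\mathcal G),$$ where $(\nabla\theta)(X,Y)=X(\theta(Y))-\theta(\nabla_XY)$. **Theorem.** For every $s$-projectable connection $\nabla$ in $T\mathcal G$, the Atiyah cochain $\mathsf{At}_\nabla$ is well defined (it exists and is unique) and is a $1$-cochain in $\bar C^\bullet_{\mathrm{def}}(\mathcal G,T^{2,0})$. Moreover: 1. $\mathsf{At}_\nabla$ is a $1$-cocycle: $\bar\delta\,\mathsf{At}_\nabla=0$; 2. the class $[\mathsf{At}_\nabla]\in H^1(\bar C^\bullet_{\mathrm{def}}(\mathcal G,T^{2,0}),\bar\delta)$ is the same for all $s$-projectable connections $\nabla$ in $T\mathcal G$; 3. $[\mathsf{At}_\nabla]=0$ if and only if there exists a multiplicative connection in $T\mathcal G$. -/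

import Mathlib

open Manifold Bundle
open scoped ContDiff

namespace LieGpd

/-! ### Fibre products of submersions -/

section FibreProduct

variable {E : Type*} [NormedAddCommGroup E] [NormedSpace ℝ E]
  {E' : Type*} [NormedAddCommGroup E'] [NormedSpace ℝ E']
  {G : Type*} [TopologicalSpace G] [ChartedSpace E G]
  {M : Type*} [TopologicalSpace M] [ChartedSpace E' M]

/-- The fibre product `G ×_M ⋯ ×_M G` of submersions `f 0, …, f n : G → M`: the tuples
`(g₀, …, gₙ)` with `f i (gᵢ) = f 0 (g₀)` for all `i`. -/
@[ext]
structure FibProd {n : ℕ} (f : Fin (n + 1) → G → M)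
    (hf : ∀ i, IsSubmersion 𝓘(ℝ, E) 𝓘(ℝ, E') ∞ (f i)) where
  coord : Fin (n + 1) → G
  compat : ∀ i, f i (coord i) = f 0 (coord 0)

variable {n : ℕ} {f : Fin (n + 1) → G → M} (hf : ∀ i, IsSubmersion 𝓘(ℝ, E) 𝓘(ℝ, E') ∞ (f i))

/-- The subspace topology. -/
instance : TopologicalSpace (FibProd f hf) := TopologicalSpace.induced FibProd.coord inferInstance

/-- The model vector space of a fibre product: `E × F₁ × ⋯ × Fₙ`, where `Fᵢ` is the complement in
the normal form `E' × Fᵢ → E'` of the submersion `f i`. -/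
abbrev FibModel : Type _ := E × (∀ i : Fin n, (hf i.succ).complement)

namespace FibProd

/-- Near each component of `p` the corresponding submersion is a linear projection in suitable charts. -/
lemma normalForm (p : FibProd f hf) (i : Fin (n + 1)) :
    IsSubmersionAtOfComplement (hf i).complement 𝓘(ℝ, E) 𝓘(ℝ, E') ∞ (f i) (p.coord i) :=
  (hf i).isSubmersionOfComplement_complement (p.coord i)

/-- The chart of `G` around `pᵢ` in the normal form of `f i`. -/
noncomputable def domChart (p : FibProd f hf) (i : Fin (n + 1)) : OpenPartialHomeomorph G E :=
  (normalForm hf p i).domChart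

/-- The chart of `M` around `f i (pᵢ)` in the normal form of `f i`. -/
noncomputable def codChart (p : FibProd f hf) (i : Fin (n + 1)) : OpenPartialHomeomorph M E' :=
  (normalForm hf p i).codChart

/-- The linear splitting `E ≃ E' × Fᵢ` in the normal form of `f i`. -/
noncomputable def splitting (p : FibProd f hf) (i : Fin (n + 1)) :
    E ≃L[ℝ] E' × (hf i).complement :=
  (normalForm hf p i).equiv

lemma mem_domChart (p : FibProd f hf) (i : Fin (n + 1)) : p.coord i ∈ (domChart hf p i).source :=
  (normalForm hf p i).mem_domChart_source

lemma mem_codChart (p : FibProd f hf) (i : Fin (n + 1)) {g : G}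
    (hg : g ∈ (domChart hf p i).source) : f i g ∈ (codChart hf p i).source :=
  (normalForm hf p i).source_subset_preimage_source hg

lemma codChart_apply (p : FibProd f hf) (i : Fin (n + 1)) {g : G}
    (hg : g ∈ (domChart hf p i).source) :
    codChart hf p i (f i g) = (splitting hf p i (domChart hf p i g)).1 := by
  have hg' : domChart hf p i g ∈ ((normalForm hf p i).domChart.extend 𝓘(ℝ, E)).target := by
    simpa using! (domChart hf p i).map_source hg
  have h := (normalForm hf p i).writtenInCharts hg'
  simpa [domChart, codChart, splitting, (normalForm hf p i).domChart.left_inv hg] using h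

/-- The chart of the fibre product around `p`: all coordinates of `g₀` (in the chart around `p₀`) and,
for `i ≥ 1`, the coordinates of `gᵢ` along the fibres of `f i`. -/
noncomputable def chartFun (p q : FibProd f hf) : FibModel hf :=
  (domChart hf p 0 (q.coord 0), fun i => (splitting hf p i.succ (domChart hf p i.succ (q.coord i.succ))).2)

/-- The common base point in `M` of the tuple with coordinates `x`. -/
noncomputable def chartBase (p : FibProd f hf) (x : FibModel hf) : M :=
  f 0 ((domChart hf p 0).symm x.1)

/-- The coordinates of the `i + 1`-st component of the tuple with coordinates `x`. -/
noncomputable def chartVec (p : FibProd f hf) (i : Fin n) (x : FibModel hf) : E :=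
  (splitting hf p i.succ).symm (codChart hf p i.succ (chartBase hf p x), x.2 i)

/-- The tuple with coordinates `x`. -/
noncomputable def chartInv (p : FibProd f hf) (x : FibModel hf) : Fin (n + 1) → G :=
  Fin.cons (α := fun _ => G) ((domChart hf p 0).symm x.1)
    (fun i => (domChart hf p i.succ).symm (chartVec hf p i x))

/-- The target of the chart around `p`. -/
def chartTarget (p : FibProd f hf) : Set (FibModel hf) :=
  {x | x.1 ∈ (domChart hf p 0).target ∧ ∀ i : Fin n,
    chartBase hf p x ∈ (codChart hf p i.succ).source ∧
    chartVec hf p i x ∈ (domChart hf p i.succ).target}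

/-- The source of the chart around `p`. -/
def chartSource (p : FibProd f hf) : Set (FibProd f hf) :=
  {q | ∀ i, q.coord i ∈ (domChart hf p i).source}

lemma chartInv_mem (p : FibProd f hf) {x : FibModel hf} (hx : x ∈ chartTarget hf p) (i : Fin (n + 1)) :
    chartInv hf p x i ∈ (domChart hf p i).source := by
  refine Fin.cases ?_ (fun i => ?_) i
  · exact (domChart hf p 0).map_target hx.1
  · exact (domChart hf p i.succ).map_target (hx.2 i).2

lemma chartInv_prop (p : FibProd f hf) {x : FibModel hf} (hx : x ∈ chartTarget hf p) (i : Fin (n + 1)) :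
    f i (chartInv hf p x i) = f 0 (chartInv hf p x 0) := by
  refine Fin.cases rfl (fun i => ?_) i
  have h := chartInv_mem hf p hx i.succ
  refine (codChart hf p i.succ).injOn (mem_codChart hf p _ h) (hx.2 i).1 ?_
  rw [codChart_apply hf p _ h]
  have : domChart hf p i.succ (chartInv hf p x i.succ) = chartVec hf p i x :=
    (domChart hf p i.succ).right_inv (hx.2 i).2
  rw [this, chartVec, ContinuousLinearEquiv.apply_symm_apply]
  rfl

open Classical in
/-- The inverse of the chart around `p`. -/
noncomputable def chartSymm (p : FibProd f hf) (x : FibModel hf) : FibProd f hf :=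
  if hx : x ∈ chartTarget hf p then ⟨chartInv hf p x, chartInv_prop hf p hx⟩ else p

lemma chartBase_chartFun (p : FibProd f hf) {q : FibProd f hf} (hq : q ∈ chartSource hf p) :
    chartBase hf p (chartFun hf p q) = f 0 (q.coord 0) := by
  simp only [chartBase, chartFun]
  rw [(domChart hf p 0).left_inv (hq 0)]

lemma chartVec_chartFun (p : FibProd f hf) {q : FibProd f hf} (hq : q ∈ chartSource hf p)
    (i : Fin n) : chartVec hf p i (chartFun hf p q) = domChart hf p i.succ (q.coord i.succ) := by
  rw [chartVec, chartBase_chartFun hf p hq, ← q.compat i.succ, codChart_apply hf p _ (hq _),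
    ContinuousLinearEquiv.symm_apply_eq]
  rfl

lemma chartFun_mem (p : FibProd f hf) {q : FibProd f hf} (hq : q ∈ chartSource hf p) :
    chartFun hf p q ∈ chartTarget hf p := by
  refine ⟨(domChart hf p 0).map_source (hq 0), fun i => ⟨?_, ?_⟩⟩
  · rw [chartBase_chartFun hf p hq, ← q.compat i.succ]
    exact mem_codChart hf p _ (hq _)
  · rw [chartVec_chartFun hf p hq]
    exact (domChart hf p i.succ).map_source (hq _)

lemma chartInv_chartFun (p : FibProd f hf) {q : FibProd f hf} (hq : q ∈ chartSource hf p) :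
    chartInv hf p (chartFun hf p q) = q.coord := by
  funext i
  refine Fin.cases ?_ (fun i => ?_) i
  · exact (domChart hf p 0).left_inv (hq 0)
  · have : chartInv hf p (chartFun hf p q) i.succ
        = (domChart hf p i.succ).symm (chartVec hf p i (chartFun hf p q)) := rfl
    rw [this, chartVec_chartFun hf p hq, (domChart hf p i.succ).left_inv (hq _)]

lemma contMDiff_map (hf : ∀ i, IsSubmersion 𝓘(ℝ, E) 𝓘(ℝ, E') ∞ (f i)) (i : Fin (n + 1)) :
    ContMDiff 𝓘(ℝ, E) 𝓘(ℝ, E') ∞ (f i) := (hf i).contMDiff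

lemma continuousOn_chartBase (p : FibProd f hf) :
    ContinuousOn (chartBase hf p) (Prod.fst ⁻¹' (domChart hf p 0).target) :=
  (contMDiff_map hf 0).continuous.comp_continuousOn
    ((domChart hf p 0).continuousOn_symm.comp continuousOn_fst (fun _ hx => hx))

lemma continuousOn_chartVec (p : FibProd f hf) (i : Fin n) :
    ContinuousOn (chartVec hf p i) ((Prod.fst ⁻¹' (domChart hf p 0).target) ∩
      chartBase hf p ⁻¹' (codChart hf p i.succ).source) := by
  refine (splitting hf p i.succ).symm.continuous.comp_continuousOn (ContinuousOn.prodMk ?_ ?_)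
  · exact (codChart hf p i.succ).continuousOn.comp
      ((continuousOn_chartBase hf p).mono Set.inter_subset_left) (fun _ hx => hx.2)
  · exact ((continuous_apply i).comp continuous_snd).continuousOn

lemma isOpen_chartTarget (p : FibProd f hf) : IsOpen (chartTarget hf p) := by
  have h0 : IsOpen ((Prod.fst ⁻¹' (domChart hf p 0).target : Set (FibModel hf))) :=
    (domChart hf p 0).open_target.preimage continuous_fst
  have h1 (i : Fin n) := (continuousOn_chartBase hf p).isOpen_inter_preimage h0
    (codChart hf p i.succ).open_source
  have h2 (i : Fin n) := (continuousOn_chartVec hf p i).isOpen_inter_preimage (h1 i)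
    (domChart hf p i.succ).open_target
  have : chartTarget hf p = (Prod.fst ⁻¹' (domChart hf p 0).target) ∩
      ⋂ i : Fin n, (((Prod.fst ⁻¹' (domChart hf p 0).target) ∩
      chartBase hf p ⁻¹' (codChart hf p i.succ).source) ∩
      chartVec hf p i ⁻¹' (domChart hf p i.succ).target) := by
    ext x
    simp only [chartTarget, Set.mem_ofPred_eq, Set.mem_inter_iff, Set.mem_preimage, Set.mem_iInter]
    grind
  rw [this]
  exact h0.inter (isOpen_iInter_of_finite h2)

lemma continuousOn_chartInv (p : FibProd f hf) :
    ContinuousOn (chartInv hf p) (chartTarget hf p) := by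
  refine continuousOn_pi.2 (fun i => ?_)
  refine Fin.cases ?_ (fun i => ?_) i
  · exact (domChart hf p 0).continuousOn_symm.comp continuousOn_fst (fun _ hx => hx.1)
  · exact (domChart hf p i.succ).continuousOn_symm.comp
      ((continuousOn_chartVec hf p i).mono (fun x hx => ⟨hx.1, (hx.2 i).1⟩))
      (fun _ hx => (hx.2 i).2)

lemma continuous_coord (i : Fin (n + 1)) : Continuous (fun q : FibProd f hf => q.coord i) :=
  (continuous_apply i).comp continuous_induced_dom

/-- The chart of the fibre product around `p`. -/
noncomputable def chart (p : FibProd f hf) : OpenPartialHomeomorph (FibProd f hf) (FibModel hf) where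
  toFun := chartFun hf p
  invFun := chartSymm hf p
  source := chartSource hf p
  target := chartTarget hf p
  map_source' _ hq := chartFun_mem hf p hq
  map_target' x hx := by
    rw [chartSymm, dif_pos hx]
    exact chartInv_mem hf p hx
  left_inv' q hq := by
    rw [chartSymm, dif_pos (chartFun_mem hf p hq)]
    exact FibProd.ext (chartInv_chartFun hf p hq)
  right_inv' x hx := by
    rw [chartSymm, dif_pos hx]
    refine Prod.ext ((domChart hf p 0).right_inv hx.1) (funext fun i => ?_)
    change (splitting hf p i.succ (domChart hf p i.succ
      ((domChart hf p i.succ).symm (chartVec hf p i x)))).2 = _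
    rw [(domChart hf p i.succ).right_inv (hx.2 i).2, chartVec,
      ContinuousLinearEquiv.apply_symm_apply]
  open_source := by
    have : chartSource hf p = ⋂ i, (fun q : FibProd f hf => q.coord i) ⁻¹' (domChart hf p i).source := by
      ext q; simp [chartSource]
    rw [this]
    exact isOpen_iInter_of_finite
      (fun i => (domChart hf p i).open_source.preimage (continuous_coord hf i))
  open_target := isOpen_chartTarget hf p
  continuousOn_toFun := by
    refine ContinuousOn.prodMk ?_ (continuousOn_pi.2 fun i => ?_)
    · exact (domChart hf p 0).continuousOn.comp (continuous_coord hf 0).continuousOn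
        (fun _ hq => hq 0)
    · exact (continuous_snd.comp (splitting hf p i.succ).continuous).comp_continuousOn
        ((domChart hf p i.succ).continuousOn.comp (continuous_coord hf i.succ).continuousOn
        (fun _ hq => hq _))
  continuousOn_invFun := by
    refine (Topology.IsInducing.mk (f := FibProd.coord (hf := hf)) rfl).continuousOn_iff.2 ?_
    refine (continuousOn_chartInv hf p).congr (fun x hx => ?_)
    simp only [Function.comp, chartSymm, dif_pos hx]

/-- The smooth structure of the fibre product, as an embedded submanifold of `G × ⋯ × G`. -/
noncomputable instance : ChartedSpace (FibModel hf) (FibProd f hf) where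
  atlas := Set.range (chart hf)
  chartAt := chart hf
  mem_chart_source p := mem_domChart hf p
  chart_mem_atlas p := ⟨p, rfl⟩

lemma contMDiffOn_chartBase (p : FibProd f hf) :
    ContMDiffOn 𝓘(ℝ, FibModel hf) 𝓘(ℝ, E') ∞ (chartBase hf p) (chartTarget hf p) :=
  (contMDiff_map hf 0).comp_contMDiffOn
    ((contMDiffOn_symm_of_mem_maximalAtlas (normalForm hf p 0).domChart_mem_maximalAtlas).comp
      contDiff_fst.contMDiff.contMDiffOn (fun _ hx => hx.1))

lemma contMDiffOn_chartInv (p : FibProd f hf) (i : Fin (n + 1)) :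
    ContMDiffOn 𝓘(ℝ, FibModel hf) 𝓘(ℝ, E) ∞ (fun x => chartInv hf p x i) (chartTarget hf p) := by
  refine Fin.cases ?_ (fun i => ?_) i
  · exact (contMDiffOn_symm_of_mem_maximalAtlas (normalForm hf p 0).domChart_mem_maximalAtlas).comp
      contDiff_fst.contMDiff.contMDiffOn (fun _ hx => hx.1)
  · have h1 : ContMDiffOn 𝓘(ℝ, FibModel hf) 𝓘(ℝ, E') ∞
        (fun x => codChart hf p i.succ (chartBase hf p x)) (chartTarget hf p) :=
      (contMDiffOn_of_mem_maximalAtlas (normalForm hf p i.succ).codChart_mem_maximalAtlas).comp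
        (contMDiffOn_chartBase hf p) (fun _ hx => (hx.2 i).1)
    have h2 : ContMDiff 𝓘(ℝ, FibModel hf) 𝓘(ℝ, (hf i.succ).complement) ∞
        (fun x : FibModel hf => x.2 i) :=
      ((ContinuousLinearMap.proj (R := ℝ) (φ := fun i : Fin n => (hf i.succ).complement)
        i).contDiff.comp contDiff_snd).contMDiff
    exact (contMDiffOn_symm_of_mem_maximalAtlas
      (normalForm hf p i.succ).domChart_mem_maximalAtlas).comp
      ((splitting hf p i.succ).symm.contDiff.contMDiff.comp_contMDiffOn
        (h1.prodMk_space h2.contMDiffOn)) (fun _ hx => (hx.2 i).2)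

instance [IsManifold 𝓘(ℝ, E) ∞ G] : IsManifold 𝓘(ℝ, FibModel hf) ∞ (FibProd f hf) := by
  refine isManifold_of_contDiffOn _ _ _ ?_
  rintro _ _ ⟨p, rfl⟩ ⟨q, rfl⟩
  rw [← contMDiffOn_iff_contDiffOn]
  have key (i : Fin (n + 1)) : ContMDiffOn 𝓘(ℝ, FibModel hf) 𝓘(ℝ, E) ∞
      (fun x => domChart hf q i (chartInv hf p x i))
      {x | x ∈ chartTarget hf p ∧ chartSymm hf p x ∈ chartSource hf q} := by
    refine (contMDiffOn_of_mem_maximalAtlas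
      (normalForm hf q i).domChart_mem_maximalAtlas).comp
      ((contMDiffOn_chartInv hf p i).mono (fun _ hx => hx.1)) (fun x hx => ?_)
    have := hx.2 i
    rwa [chartSymm, dif_pos hx.1] at this
  have : ContMDiffOn 𝓘(ℝ, FibModel hf) 𝓘(ℝ, FibModel hf) ∞ (fun x => chartFun hf q (chartSymm hf p x))
      {x | x ∈ chartTarget hf p ∧ chartSymm hf p x ∈ chartSource hf q} := by
    refine ContMDiffOn.congr (f := fun x : FibModel hf => ((domChart hf q 0 (chartInv hf p x 0),
      fun i => (splitting hf q i.succ (domChart hf q i.succ (chartInv hf p x i.succ))).2) :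
        FibModel hf)) ?_ ?_
    · refine (key 0).prodMk_space (contMDiffOn_pi_space.2 fun i => ?_)
      exact (contDiff_snd.comp (splitting hf q i.succ).contDiff).contMDiff.comp_contMDiffOn
        (key i.succ)
    · intro x hx
      rw [chartSymm, dif_pos hx.1]
      rfl
  refine this.mono ?_
  rintro x ⟨hx, -⟩
  exact hx

end FibProd

end FibreProduct

/-! ### Connections and tensors on manifolds -/

noncomputable section Connections

variable {V : Type*} [NormedAddCommGroup V] [NormedSpace ℝ V]
  {H : Type*} [TopologicalSpace H] (I : ModelWithCorners ℝ V H)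
  (N : Type*) [TopologicalSpace N] [ChartedSpace H N]
  {V' : Type*} [NormedAddCommGroup V'] [NormedSpace ℝ V']
  {H' : Type*} [TopologicalSpace H'] (I' : ModelWithCorners ℝ V' H')
  {P : Type*} [TopologicalSpace P] [ChartedSpace H' P]

/-- A smooth linear connection in the tangent bundle `TN`. In Mathlib's argument order `∇_X Y` at `x`
is `cov Y x (X x)`. -/
structure TangentConnection [IsManifold I ∞ N] where
  /-- the covariant derivative -/
  cov : CovariantDerivative I V (TangentSpace I : N → Type _)
  smooth : CovariantDerivative.ContMDiffCovariantDerivative cov ∞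

/-- Families of bilinear maps `T_x N × T_x N → T_{τ x} P` depending on `x` (no smoothness yet), i.e.
set-theoretic bundle maps `TN ⊗ TN → τ^* TP`. -/
def TensorAlong (τ : N → P) : Type _ :=
  Π x : N, TangentSpace I x →L[ℝ] TangentSpace I x →L[ℝ] TangentSpace I' (τ x)

instance (τ : N → P) : AddCommGroup (TensorAlong I N I' τ) :=
  inferInstanceAs (AddCommGroup
    (Π x : N, TangentSpace I x →L[ℝ] TangentSpace I x →L[ℝ] TangentSpace I' (τ x)))

instance (τ : N → P) : Module ℝ (TensorAlong I N I' τ) :=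
  inferInstanceAs (Module ℝ
    (Π x : N, TangentSpace I x →L[ℝ] TangentSpace I x →L[ℝ] TangentSpace I' (τ x)))

variable {I N I'}

lemma TensorAlong.zero_apply {τ : N → P} (x : N) (v w : TangentSpace I x) :
    (0 : TensorAlong I N I' τ) x v w = 0 := rfl

lemma TensorAlong.add_apply {τ : N → P} (U W : TensorAlong I N I' τ) (x : N)
    (v w : TangentSpace I x) : (U + W) x v w = U x v w + W x v w := rfl

lemma TensorAlong.smul_apply {τ : N → P} (c : ℝ) (U : TensorAlong I N I' τ) (x : N)
    (v w : TangentSpace I x) : (c • U) x v w = c • U x v w := rfl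

/-- The identification of `T_x N` with `T_y N` when `x = y`; it is the identity map, and is only
needed where the two base points are equal but not syntactically so. -/
def tangentCast {x y : N} (h : x = y) : TangentSpace I x →L[ℝ] TangentSpace I y :=
  h ▸ ContinuousLinearMap.id ℝ (TangentSpace I x)

/-- Smooth vector fields, `X ∈ 𝔛(N)`. -/
def IsSmoothField [IsManifold I ∞ N] (X : Π x : N, TangentSpace I x) : Prop :=
  ContMDiff I I.tangent ∞ (fun x => (⟨x, X x⟩ : TangentBundle I N))

/-- Smooth `1`-forms, `θ ∈ Ω¹(N)`. -/
def IsSmoothForm [IsManifold I ∞ N] (θ : Π x : N, TangentSpace I x →L[ℝ] ℝ) : Prop :=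
  ContMDiff I (I.prod 𝓘(ℝ, V →L[ℝ] ℝ)) ∞ (fun x => TotalSpace.mk' (V →L[ℝ] ℝ) x (θ x))

/-- The pull-back `F^* θ` of a `1`-form. -/
def pullbackForm (F : N → P) (θ : Π y : P, TangentSpace I' y →L[ℝ] ℝ) :
    Π x : N, TangentSpace I x →L[ℝ] ℝ :=
  fun x => (θ (F x)).comp (mfderiv I I' F x)

/-- Vector fields `X` on `N` and `Y` on `P` are `F`-related: `dF ∘ X = Y ∘ F`. -/
def FieldsRelated (F : N → P) (X : Π x : N, TangentSpace I x) (Y : Π y : P, TangentSpace I' y) :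
    Prop :=
  ∀ x, mfderiv I I' F x (X x) = Y (F x)

/-- Connections `D` in `TN` and `D'` in `TP` are `F`-related: if `X₁, Y₁` and `X₂, Y₂` are `F`-related
smooth vector fields, then so are `D_{X₁} X₂` and `D'_{Y₁} Y₂`. -/
def ConnectionsRelated [IsManifold I ∞ N] [IsManifold I' ∞ P] (F : N → P)
    (D : TangentConnection I N) (D' : TangentConnection I' P) : Prop :=
  ∀ (X₁ X₂ : Π x : N, TangentSpace I x) (Y₁ Y₂ : Π y : P, TangentSpace I' y),
    IsSmoothField X₁ → IsSmoothField X₂ → IsSmoothField Y₁ → IsSmoothField Y₂ →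
    FieldsRelated F X₁ Y₁ → FieldsRelated F X₂ Y₂ →
    FieldsRelated F (fun x => D.cov X₂ x (X₁ x)) (fun y => D'.cov Y₂ y (Y₁ y))

/-- The covariant derivative `∇θ` of a `1`-form, as a `(2,0)`-tensor:
`(∇θ)(v, w) = v(θ(W)) - θ(∇_v W)` for any local vector field `W`, smooth around the base point, which
extends `w`. -/
def TangentConnection.onForm [IsManifold I ∞ N] (D : TangentConnection I N)
    (θ : Π x : N, TangentSpace I x →L[ℝ] ℝ) (x : N) (v w : TangentSpace I x) : ℝ :=
  mvfderiv I (fun y => θ y (FiberBundle.extend V w y)) x v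
    - θ x (D.cov (FiberBundle.extend V w) x v)

/-- A family of bilinear maps `T_x N × T_x N → T_{τ x} P` is smooth, i.e. a smooth vector bundle map
`TN ⊗ TN → τ^* TP`: as a `C^∞`-module homomorphism `Ω¹(P) → Γ(T^*N ⊗ T^*N)` covering `τ^*`, it maps
smooth `1`-forms to smooth `(2,0)`-tensors, the latter being the ones which are smooth on smooth
vector fields. -/
def IsSmoothTensorAlong [IsManifold I ∞ N] [IsManifold I' ∞ P] {τ : N → P}
    (U : TensorAlong I N I' τ) : Prop :=
  ∀ (X Y : Π x : N, TangentSpace I x) (θ : Π y : P, TangentSpace I' y →L[ℝ] ℝ),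
    IsSmoothField X → IsSmoothField Y → IsSmoothForm θ →
    ContMDiff I 𝓘(ℝ, ℝ) ∞ (fun x => θ (τ x) (U x (X x) (Y x)))

section

variable [IsManifold I ∞ N] [IsManifold I' ∞ P]

lemma IsSmoothTensorAlong.zero (τ : N → P) :
    IsSmoothTensorAlong (0 : TensorAlong I N I' τ) := by
  intro X Y θ _ _ _
  simpa only [TensorAlong.zero_apply, map_zero] using contMDiff_const

lemma IsSmoothTensorAlong.add {τ : N → P} {U W : TensorAlong I N I' τ}
    (hU : IsSmoothTensorAlong U) (hW : IsSmoothTensorAlong W) : IsSmoothTensorAlong (U + W) := by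
  intro X Y θ hX hY hθ
  simp only [TensorAlong.add_apply, map_add]
  exact (hU X Y θ hX hY hθ).add (hW X Y θ hX hY hθ)

lemma IsSmoothTensorAlong.smul {τ : N → P} (c : ℝ) {U : TensorAlong I N I' τ}
    (hU : IsSmoothTensorAlong U) : IsSmoothTensorAlong (c • U) := by
  intro X Y θ hX hY hθ
  simp only [TensorAlong.smul_apply, map_smul]
  exact contMDiff_const.mul (hU X Y θ hX hY hθ)

end

end Connections

/-! ### Lie groupoids -/

lemma isSubmersion_pair {E E' G M : Type*}
    [NormedAddCommGroup E] [NormedSpace ℝ E] [NormedAddCommGroup E'] [NormedSpace ℝ E']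
    [TopologicalSpace G] [ChartedSpace E G] [TopologicalSpace M] [ChartedSpace E' M]
    {s t : G → M} (hs : IsSubmersion 𝓘(ℝ, E) 𝓘(ℝ, E') ∞ s)
    (ht : IsSubmersion 𝓘(ℝ, E) 𝓘(ℝ, E') ∞ t) (i : Fin 2) :
    IsSubmersion 𝓘(ℝ, E) 𝓘(ℝ, E') ∞ (![s, t] i) := by
  fin_cases i
  · exact hs
  · exact ht

/-- A Lie groupoid `G ⇉ M`: source and target are submersions, and all structure maps are smooth, the
multiplication `m(g, h) = gh` on the manifold of composable arrows, `s(g) = t(h)`. -/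
structure LieGroupoid (E E' G M : Type*)
    [NormedAddCommGroup E] [NormedSpace ℝ E] [NormedAddCommGroup E'] [NormedSpace ℝ E']
    [TopologicalSpace G] [ChartedSpace E G] [TopologicalSpace M] [ChartedSpace E' M] where
  /-- source -/
  src : G → M
  /-- target -/
  tgt : G → M
  /-- unit -/
  one : M → G
  /-- inversion -/
  inv : G → G
  /-- multiplication of composable arrows -/
  mul : ∀ g h : G, src g = tgt h → G
  src_one : ∀ x, src (one x) = x
  tgt_one : ∀ x, tgt (one x) = x
  src_inv : ∀ g, src (inv g) = tgt g
  tgt_inv : ∀ g, tgt (inv g) = src g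
  src_mul : ∀ g h (a : src g = tgt h), src (mul g h a) = src h
  tgt_mul : ∀ g h (a : src g = tgt h), tgt (mul g h a) = tgt g
  mul_assoc : ∀ g h k (a : src g = tgt h) (b : src h = tgt k),
    mul (mul g h a) k ((src_mul g h a).trans b) = mul g (mul h k b) (a.trans (tgt_mul h k b).symm)
  one_mul : ∀ g, mul (one (tgt g)) g (src_one (tgt g)) = g
  mul_one : ∀ g, mul g (one (src g)) (tgt_one (src g)).symm = g
  mul_inv : ∀ g, mul g (inv g) (tgt_inv g).symm = one (tgt g)
  inv_mul : ∀ g, mul (inv g) g (src_inv g) = one (src g)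
  src_submersion : IsSubmersion 𝓘(ℝ, E) 𝓘(ℝ, E') ∞ src
  tgt_submersion : IsSubmersion 𝓘(ℝ, E) 𝓘(ℝ, E') ∞ tgt
  smooth_one : ContMDiff 𝓘(ℝ, E') 𝓘(ℝ, E) ∞ one
  smooth_inv : ContMDiff 𝓘(ℝ, E) 𝓘(ℝ, E) ∞ inv
  smooth_mul : ContMDiff 𝓘(ℝ, FibModel (isSubmersion_pair src_submersion tgt_submersion)) 𝓘(ℝ, E) ∞
    (fun p : FibProd ![src, tgt] (isSubmersion_pair src_submersion tgt_submersion) =>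
      mul (p.coord 0) (p.coord 1) (p.compat 1).symm)

namespace LieGroupoid

noncomputable section

variable {E E' G M : Type*}
  [NormedAddCommGroup E] [NormedSpace ℝ E] [NormedAddCommGroup E'] [NormedSpace ℝ E']
  [TopologicalSpace G] [ChartedSpace E G] [TopologicalSpace M] [ChartedSpace E' M]
  (𝒢 : LieGroupoid E E' G M)

/-- The manifold `G⁽²⁾` of composable arrows `(g, h)`, `s(g) = t(h)`. -/
abbrev Composable : Type _ := FibProd ![𝒢.src, 𝒢.tgt] (isSubmersion_pair 𝒢.src_submersion 𝒢.tgt_submersion)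

/-- The model vector space of `G⁽²⁾`. -/
abbrev ComposableModel : Type _ := FibModel (isSubmersion_pair 𝒢.src_submersion 𝒢.tgt_submersion)

/-- The multiplication `m : G⁽²⁾ → G`. -/
def mulMap (p : 𝒢.Composable) : G := 𝒢.mul (p.coord 0) (p.coord 1) (p.compat 1).symm

/-- The manifold `G^[n+1]` of `(n+1)`-tuples of arrows with the same source. -/
abbrev SrcPow (n : ℕ) : Type _ :=
  FibProd (fun _ : Fin (n + 1) => 𝒢.src) (fun _ => 𝒢.src_submersion)

/-- The model vector space of `G^[n+1]`. -/
abbrev SrcPowModel (n : ℕ) : Type _ := FibModel (fun _ : Fin (n + 1) => 𝒢.src_submersion)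

variable {𝒢} in
lemma SrcPow.src_eq {n : ℕ} (p : 𝒢.SrcPow n) (i j : Fin (n + 1)) :
    𝒢.src (p.coord i) = 𝒢.src (p.coord j) := (p.compat i).trans (p.compat j).symm

/-- The quotient `g h⁻¹` of two arrows with the same source. -/
def div (g h : G) (a : 𝒢.src g = 𝒢.src h) : G := 𝒢.mul g (𝒢.inv h) (a.trans (𝒢.tgt_inv h).symm)

lemma src_div (g h : G) (a : 𝒢.src g = 𝒢.src h) : 𝒢.src (𝒢.div g h a) = 𝒢.tgt h :=
  (𝒢.src_mul _ _ _).trans (𝒢.src_inv h)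

lemma mul_congr {g g' h h' : G} (a : 𝒢.src g = 𝒢.tgt h) (e : g = g') (e' : h = h') :
    𝒢.mul g h a = 𝒢.mul g' h' (e ▸ e' ▸ a) := by
  subst e e'; rfl

lemma div_mul_div (g h k : G) (a : 𝒢.src g = 𝒢.src h) (b : 𝒢.src h = 𝒢.src k)
    (c : 𝒢.src (𝒢.div g h a) = 𝒢.tgt (𝒢.div h k b)) :
    𝒢.mul (𝒢.div g h a) (𝒢.div h k b) c = 𝒢.div g k (a.trans b) := by
  have h1 : 𝒢.mul (𝒢.inv h) (𝒢.div h k b) ((𝒢.src_inv h).trans (𝒢.tgt_mul _ _ _).symm) =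
      𝒢.inv k := by
    change 𝒢.mul (𝒢.inv h) (𝒢.mul h (𝒢.inv k) (b.trans (𝒢.tgt_inv k).symm)) _ = _
    rw [← 𝒢.mul_assoc _ _ _ (𝒢.src_inv h), 𝒢.mul_congr _ (𝒢.inv_mul h) rfl,
      𝒢.mul_congr _ (congrArg 𝒢.one (b.trans (𝒢.tgt_inv k).symm)) rfl, 𝒢.one_mul]
  exact (𝒢.mul_assoc g (𝒢.inv h) (𝒢.div h k b) _
    ((𝒢.src_inv h).trans (𝒢.tgt_mul _ _ _).symm)).trans (𝒢.mul_congr _ rfl h1)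

lemma div_div_div (g h k : G) (a : 𝒢.src g = 𝒢.src h) (b : 𝒢.src h = 𝒢.src k)
    (c : 𝒢.src (𝒢.div g k (a.trans b)) = 𝒢.src (𝒢.div h k b)) :
    𝒢.div (𝒢.div g k (a.trans b)) (𝒢.div h k b) c = 𝒢.div g h a := by
  have e : 𝒢.src (𝒢.div g h a) = 𝒢.tgt (𝒢.div h k b) :=
    (𝒢.src_div g h a).trans (𝒢.tgt_mul _ _ _).symm
  change 𝒢.mul (𝒢.div g k (a.trans b)) (𝒢.inv (𝒢.div h k b)) _ = _
  rw [𝒢.mul_congr _ (𝒢.div_mul_div g h k a b e).symm rfl,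
    𝒢.mul_assoc _ _ _ e (𝒢.tgt_inv _).symm, 𝒢.mul_congr _ rfl (𝒢.mul_inv _),
    𝒢.mul_congr _ rfl (congrArg 𝒢.one e.symm), 𝒢.mul_one]

/-- The map `(g₁, g₂, …) ↦ g₁ g₂⁻¹`; on `G^[2]` this is the division map. -/
def divMap {n : ℕ} (p : 𝒢.SrcPow (n + 1)) : G := 𝒢.div (p.coord 0) (p.coord 1) (p.src_eq 0 1)

/-- Omission of the `i`-th entry (counted from `0`), `G^[n+2] → G^[n+1]`. -/
def face {n : ℕ} (i : Fin (n + 2)) (p : 𝒢.SrcPow (n + 1)) : 𝒢.SrcPow n where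
  coord j := p.coord (i.succAbove j)
  compat _ := p.src_eq _ _

/-- The map `G^[n+2] → G^[n+1]`, `(g₁, …, g_{n+2}) ↦ (g₁ g_{n+2}⁻¹, …, g_{n+1} g_{n+2}⁻¹)`. -/
def divLast {n : ℕ} (p : 𝒢.SrcPow (n + 1)) : 𝒢.SrcPow n where
  coord j := 𝒢.div (p.coord j.castSucc) (p.coord (Fin.last (n + 1))) (p.src_eq _ _)
  compat _ := (𝒢.src_div _ _ _).trans (𝒢.src_div _ _ _).symm

/-- The map `(g₁, g₂, g₃, …) ↦ (g₁ g₃⁻¹, g₂ g₃⁻¹)`, with values in `G^[2]`. -/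
def divPair {n : ℕ} (p : 𝒢.SrcPow (n + 2)) : 𝒢.SrcPow 1 where
  coord i := 𝒢.divMap (𝒢.face (![1, 0] i) p)
  compat i := by
    have h (j : Fin 2) : 𝒢.src (𝒢.divMap (𝒢.face ((![1, 0] : Fin 2 → Fin (n + 3)) j) p)) =
        𝒢.tgt (p.coord 2) := by
      fin_cases j
      · exact 𝒢.src_div _ _ _
      · exact 𝒢.src_div _ _ _
    rw [h i, h 0]

lemma src_divMap {n : ℕ} (p : 𝒢.SrcPow (n + 1)) :
    𝒢.src (𝒢.divMap p) = 𝒢.tgt ((𝒢.face 0 p).coord 0) := 𝒢.src_div _ _ _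

lemma divMap_face {n : ℕ} (j : Fin (n + 1)) (p : 𝒢.SrcPow (n + 2)) :
    𝒢.divMap (𝒢.face j.succ.succ p) = 𝒢.divMap p := rfl

lemma divMap_divLast {n : ℕ} (p : 𝒢.SrcPow (n + 2)) : 𝒢.divMap (𝒢.divLast p) = 𝒢.divMap p :=
  𝒢.div_div_div _ _ _ _ (p.src_eq _ _) _

lemma divMap_divPair {n : ℕ} (p : 𝒢.SrcPow (n + 2)) : 𝒢.divMap (𝒢.divPair p) = 𝒢.divMap p :=
  𝒢.div_div_div _ _ _ _ (p.src_eq _ _) _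

/-- The `(n+1)`-tuple of tangent vectors to `G` given by a tangent vector to `G^[n+1]`. -/
def tupleOfTangent {n : ℕ} (p : 𝒢.SrcPow n) :
    TangentSpace 𝓘(ℝ, 𝒢.SrcPowModel n) p →ₗ[ℝ] (∀ i, TangentSpace 𝓘(ℝ, E) (p.coord i)) :=
  LinearMap.pi fun i =>
    (mfderiv 𝓘(ℝ, 𝒢.SrcPowModel n) 𝓘(ℝ, E) (fun q : 𝒢.SrcPow n => q.coord i) p).toLinearMap

/-- The tangent vector to `G^[n+1]` given by an `(n+1)`-tuple of tangent vectors to `G` with the same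
`ds`-projection. Such tuples form the range of the injective linear map `tupleOfTangent`, so that the
values of a linear left inverse on them do not depend on its choice. -/
def tangentOfTuple {n : ℕ} (p : 𝒢.SrcPow n) :
    (∀ i, TangentSpace 𝓘(ℝ, E) (p.coord i)) →ₗ[ℝ] TangentSpace 𝓘(ℝ, 𝒢.SrcPowModel n) p :=
  (𝒢.tupleOfTangent p).leftInverse

/-- The differential of `divMap`. -/
def dDivMap {n : ℕ} (p : 𝒢.SrcPow (n + 1)) :
    TangentSpace 𝓘(ℝ, 𝒢.SrcPowModel (n + 1)) p →L[ℝ] TangentSpace 𝓘(ℝ, E) (𝒢.divMap p) :=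
  mfderiv 𝓘(ℝ, 𝒢.SrcPowModel (n + 1)) 𝓘(ℝ, E) 𝒢.divMap p

/-- The differential of `face i`: omission of the `i`-th entry of a tuple of tangent vectors. -/
def dFace {n : ℕ} (i : Fin (n + 2)) (p : 𝒢.SrcPow (n + 1)) :
    TangentSpace 𝓘(ℝ, 𝒢.SrcPowModel (n + 1)) p →L[ℝ]
      TangentSpace 𝓘(ℝ, 𝒢.SrcPowModel n) (𝒢.face i p) :=
  mfderiv 𝓘(ℝ, 𝒢.SrcPowModel (n + 1)) 𝓘(ℝ, 𝒢.SrcPowModel n) (𝒢.face i) p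

/-- The differential of `divLast`. -/
def dDivLast {n : ℕ} (p : 𝒢.SrcPow (n + 1)) :
    TangentSpace 𝓘(ℝ, 𝒢.SrcPowModel (n + 1)) p →L[ℝ]
      TangentSpace 𝓘(ℝ, 𝒢.SrcPowModel n) (𝒢.divLast p) :=
  mfderiv 𝓘(ℝ, 𝒢.SrcPowModel (n + 1)) 𝓘(ℝ, 𝒢.SrcPowModel n) 𝒢.divLast p

/-! ### The complex `C̄_def(G, T^{2,0})` in degrees `≥ 0` -/

/-- Families of bilinear maps `T_g G × T_g G → T_g G`; degree `0` cochains are of this form. -/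
abbrev Tensor₀ (_𝒢 : LieGroupoid E E' G M) : Type _ :=
  TensorAlong 𝓘(ℝ, E) G 𝓘(ℝ, E) (fun g : G => g)

/-- Families of bilinear maps `T_p G^[n+2] × T_p G^[n+2] → T_{g₁ g₂⁻¹} G`, `p = (g₁, …, g_{n+2})`;
cochains of degree `n + 1` are of this form. -/
abbrev TensorSucc (n : ℕ) : Type _ :=
  TensorAlong 𝓘(ℝ, 𝒢.SrcPowModel (n + 1)) (𝒢.SrcPow (n + 1)) 𝓘(ℝ, E) 𝒢.divMap

/-- The pair `(U(v₁, v₁'), U(v₂, v₂'))`. -/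
def deltaHead₀ (U : 𝒢.Tensor₀) (p : 𝒢.SrcPow 1) (v w : TangentSpace 𝓘(ℝ, 𝒢.SrcPowModel 1) p) :
    ∀ i, TangentSpace 𝓘(ℝ, E) (p.coord i) :=
  fun i => U (p.coord i) (𝒢.tupleOfTangent p v i) (𝒢.tupleOfTangent p w i)

/-- The differential in degree `0`: with `m̄(g, h) = g h⁻¹`,
`δU(v₁^⊗, v₂^⊗) = - dm̄(U(v₁^⊗), U(v₂^⊗)) + U(dm̄^{⊗2}(v₁^⊗, v₂^⊗))`. -/
def delta₀ (U : 𝒢.Tensor₀) (p : 𝒢.SrcPow 1) (v w : TangentSpace 𝓘(ℝ, 𝒢.SrcPowModel 1) p) :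
    TangentSpace 𝓘(ℝ, E) (𝒢.divMap p) :=
  - 𝒢.dDivMap p (𝒢.tangentOfTuple p (𝒢.deltaHead₀ U p v w))
  + U (𝒢.divMap p) (𝒢.dDivMap p v) (𝒢.dDivMap p w)

/-- The pair `(U(v₁^⊗, v₃^⊗, …, v_{k+2}^⊗), U(v₂^⊗, …, v_{k+2}^⊗))`, `k = n + 1`. -/
def deltaHead (n : ℕ) (U : 𝒢.TensorSucc n) (p : 𝒢.SrcPow (n + 2))
    (v w : TangentSpace 𝓘(ℝ, 𝒢.SrcPowModel (n + 2)) p) :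
    ∀ i, TangentSpace 𝓘(ℝ, E) ((𝒢.divPair p).coord i) :=
  fun i => U (𝒢.face (![1, 0] i) p) (𝒢.dFace (![1, 0] i) p v) (𝒢.dFace (![1, 0] i) p w)

/-- The differential in degree `k = n + 1`:
`δU(v₁^⊗, …, v_{k+2}^⊗) = - dm̄(U(v₁^⊗, v₃^⊗, …, v_{k+2}^⊗), U(v₂^⊗, …, v_{k+2}^⊗))
  + ∑_{i = 3}^{k+2} (-1)^{i+1} U(v₁^⊗, …, v̂ᵢ^⊗, …, v_{k+2}^⊗)
  + (-1)^k U(dm̄^{⊗2}(v₁^⊗, v_{k+2}^⊗), …, dm̄^{⊗2}(v_{k+1}^⊗, v_{k+2}^⊗))`;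
below `i = j + 3`. -/
def delta (n : ℕ) (U : 𝒢.TensorSucc n) (p : 𝒢.SrcPow (n + 2))
    (v w : TangentSpace 𝓘(ℝ, 𝒢.SrcPowModel (n + 2)) p) : TangentSpace 𝓘(ℝ, E) (𝒢.divMap p) :=
  - tangentCast (𝒢.divMap_divPair p) (𝒢.dDivMap (𝒢.divPair p)
      (𝒢.tangentOfTuple (𝒢.divPair p) (𝒢.deltaHead n U p v w)))
  + ∑ j : Fin (n + 1), (-1 : ℝ) ^ (j : ℕ) • tangentCast (𝒢.divMap_face j p)
      (U (𝒢.face j.succ.succ p) (𝒢.dFace j.succ.succ p v) (𝒢.dFace j.succ.succ p w))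
  + (-1 : ℝ) ^ (n + 1) • tangentCast (𝒢.divMap_divLast p)
      (U (𝒢.divLast p) (𝒢.dDivLast p v) (𝒢.dDivLast p w))

lemma delta₀_add (U W : 𝒢.Tensor₀) : 𝒢.delta₀ (U + W) = 𝒢.delta₀ U + 𝒢.delta₀ W := by
  funext p v w
  have h : 𝒢.deltaHead₀ (U + W) p v w = 𝒢.deltaHead₀ U p v w + 𝒢.deltaHead₀ W p v w := rfl
  simp only [delta₀, Pi.add_apply, h, map_add, TensorAlong.add_apply]
  abel

lemma delta₀_smul (c : ℝ) (U : 𝒢.Tensor₀) : 𝒢.delta₀ (c • U) = c • 𝒢.delta₀ U := by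
  funext p v w
  have h : 𝒢.deltaHead₀ (c • U) p v w = c • 𝒢.deltaHead₀ U p v w := rfl
  simp only [delta₀, Pi.smul_apply, h, map_smul, TensorAlong.smul_apply]
  module

lemma delta_add (n : ℕ) (U W : 𝒢.TensorSucc n) :
    𝒢.delta n (U + W) = 𝒢.delta n U + 𝒢.delta n W := by
  funext p v w
  have h : 𝒢.deltaHead n (U + W) p v w = 𝒢.deltaHead n U p v w + 𝒢.deltaHead n W p v w := rfl
  simp only [delta, Pi.add_apply, h, map_add, TensorAlong.add_apply, smul_add,
    Finset.sum_add_distrib]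
  abel

lemma delta_smul (n : ℕ) (c : ℝ) (U : 𝒢.TensorSucc n) :
    𝒢.delta n (c • U) = c • 𝒢.delta n U := by
  funext p v w
  have h : 𝒢.deltaHead n (c • U) p v w = c • 𝒢.deltaHead n U p v w := rfl
  simp only [delta, Pi.smul_apply, h, map_smul, TensorAlong.smul_apply, smul_add,
    Finset.smul_sum, smul_comm c, smul_neg]

lemma delta₀_zero : 𝒢.delta₀ 0 = 0 := by
  have h := 𝒢.delta₀_smul 0 0
  rwa [zero_smul, zero_smul] at h

lemma delta_zero (n : ℕ) : 𝒢.delta n 0 = 0 := by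
  have h := 𝒢.delta_smul n 0 0
  rwa [zero_smul, zero_smul] at h

section Smooth

variable [IsManifold 𝓘(ℝ, E) ∞ G] [IsManifold 𝓘(ℝ, E') ∞ M]

/-- `U^M` is the `M`-projection of `U` (in degree `0`): `ds ∘ U = U^M ∘ ds^{⊗2}`. -/
def IsProjection₀ (U : 𝒢.Tensor₀) (UM : TensorAlong 𝓘(ℝ, E') M 𝓘(ℝ, E') (fun x : M => x)) : Prop :=
  ∀ (g : G) (v w : TangentSpace 𝓘(ℝ, E) g),
    mfderiv 𝓘(ℝ, E) 𝓘(ℝ, E') 𝒢.src g (U g v w) =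
      UM (𝒢.src g) (mfderiv 𝓘(ℝ, E) 𝓘(ℝ, E') 𝒢.src g v) (mfderiv 𝓘(ℝ, E) 𝓘(ℝ, E') 𝒢.src g w)

/-- `U^M` is the `M`-projection of `U` (in degree `n + 1`):
`ds (U(v₁^⊗, …, v_{n+2}^⊗)) = U^M(v₂^⊗, …, v_{n+2}^⊗)`, where `U^M` takes values in `t(g₂)^* TM`. -/
def IsProjection {n : ℕ} (U : 𝒢.TensorSucc n) (UM : TensorAlong 𝓘(ℝ, 𝒢.SrcPowModel n) (𝒢.SrcPow n)
    𝓘(ℝ, E') (fun q => 𝒢.tgt (q.coord 0))) : Prop :=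
  ∀ (p : 𝒢.SrcPow (n + 1)) (v w : TangentSpace 𝓘(ℝ, 𝒢.SrcPowModel (n + 1)) p),
    tangentCast (𝒢.src_divMap p) (mfderiv 𝓘(ℝ, E) 𝓘(ℝ, E') 𝒢.src (𝒢.divMap p) (U p v w)) =
      UM (𝒢.face 0 p) (𝒢.dFace 0 p v) (𝒢.dFace 0 p w)

/-- Degree `0` cochains: the smooth `s`-projectable `(2,1)`-tensors on `G`. -/
def cochains₀ : Submodule ℝ 𝒢.Tensor₀ where
  carrier := {U | IsSmoothTensorAlong U ∧ ∃ UM, IsSmoothTensorAlong UM ∧ 𝒢.IsProjection₀ U UM}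
  zero_mem' := ⟨.zero _, 0, .zero _, fun g v w => by simp only [TensorAlong.zero_apply, map_zero]⟩
  add_mem' := by
    rintro U W ⟨hU, UM, hUM, hU'⟩ ⟨hW, WM, hWM, hW'⟩
    refine ⟨hU.add hW, UM + WM, hUM.add hWM, fun g v w => ?_⟩
    simp only [TensorAlong.add_apply, map_add, hU' g, hW' g]
  smul_mem' := by
    rintro c U ⟨hU, UM, hUM, hU'⟩
    refine ⟨hU.smul c, c • UM, hUM.smul c, fun g v w => ?_⟩
    simp only [TensorAlong.smul_apply, map_smul, hU' g]

/-- Cochains of degree `n + 1`: the smooth bundle maps `U : T^{0,2} G^[n+2] → (g₁ g₂⁻¹)^* TG` for which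
there is a smooth bundle map `U^M : T^{0,2} G^[n+1] → t(g₁)^* TM` such that `U^M` is the
`M`-projection of `U`. -/
def cochains (n : ℕ) : Submodule ℝ (𝒢.TensorSucc n) where
  carrier := {U | IsSmoothTensorAlong U ∧ ∃ UM, IsSmoothTensorAlong UM ∧ 𝒢.IsProjection U UM}
  zero_mem' := ⟨.zero _, 0, .zero _, fun g v w => by simp only [TensorAlong.zero_apply, map_zero]⟩
  add_mem' := by
    rintro U W ⟨hU, UM, hUM, hU'⟩ ⟨hW, WM, hWM, hW'⟩
    refine ⟨hU.add hW, UM + WM, hUM.add hWM, fun g v w => ?_⟩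
    simp only [TensorAlong.add_apply, map_add, hU' g, hW' g]
  smul_mem' := by
    rintro c U ⟨hU, UM, hUM, hU'⟩
    refine ⟨hU.smul c, c • UM, hUM.smul c, fun g v w => ?_⟩
    simp only [TensorAlong.smul_apply, map_smul, hU' g]

/-- Cocycles of degree `n + 1`. -/
def cocycles (n : ℕ) : Submodule ℝ (𝒢.TensorSucc n) where
  carrier := {U | U ∈ 𝒢.cochains n ∧ 𝒢.delta n U = 0}
  zero_mem' := ⟨zero_mem _, 𝒢.delta_zero n⟩
  add_mem' := fun hU hW => ⟨add_mem hU.1 hW.1, by rw [delta_add, hU.2, hW.2, add_zero]⟩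
  smul_mem' := fun c _ hU => ⟨Submodule.smul_mem _ c hU.1, by rw [delta_smul, hU.2, smul_zero]⟩

/-- Coboundaries of degree `1`: the differentials of degree `0` cochains. -/
def coboundaries₁ : Submodule ℝ (𝒢.TensorSucc 0) where
  carrier := {U | ∃ W ∈ 𝒢.cochains₀, ∀ p v w, 𝒢.delta₀ W p v w = U p v w}
  zero_mem' := ⟨0, zero_mem _, fun p v w => by rw [delta₀_zero]; rfl⟩
  add_mem' := by
    rintro U U' ⟨W, hW, h⟩ ⟨W', hW', h'⟩
    refine ⟨W + W', add_mem hW hW', fun p v w => ?_⟩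
    simp only [delta₀_add, Pi.add_apply, TensorAlong.add_apply, h, h']
  smul_mem' := by
    rintro c U ⟨W, hW, h⟩
    refine ⟨c • W, Submodule.smul_mem _ c hW, fun p v w => ?_⟩
    simp only [delta₀_smul, Pi.smul_apply, TensorAlong.smul_apply, h]

/-- The first cohomology `H¹(C̄_def(G, T^{2,0}), δ)`. -/
abbrev H1 : Type _ := 𝒢.cocycles 0 ⧸ 𝒢.coboundaries₁.submoduleOf (𝒢.cocycles 0)

/-- The cohomology class of a `1`-cocycle. -/
def cohomologyClass (U : 𝒢.cocycles 0) : 𝒢.H1 := Submodule.Quotient.mk U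

/-! ### Multiplicative connections and the Atiyah cochain -/

/-- `D` is `s`-projectable: it is `s`-related to a connection in `TM`. -/
def IsSProjectable (D : TangentConnection 𝓘(ℝ, E) G) : Prop :=
  ∃ DM : TangentConnection 𝓘(ℝ, E') M, ConnectionsRelated 𝒢.src D DM

/-- `D` is `(s,t)`-projectable: it is both `s`- and `t`-related to one connection in `TM`. -/
def IsSTProjectable (D : TangentConnection 𝓘(ℝ, E) G) : Prop :=
  ∃ DM : TangentConnection 𝓘(ℝ, E') M,
    ConnectionsRelated 𝒢.src D DM ∧ ConnectionsRelated 𝒢.tgt D DM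

/-- `Dprod` is the product connection `D × D` in `T(G × G)`: the one which is related to `D` by both
projections. -/
def IsProductConnection (D : TangentConnection 𝓘(ℝ, E) G)
    (Dprod : TangentConnection (𝓘(ℝ, E).prod 𝓘(ℝ, E)) (G × G)) : Prop :=
  ConnectionsRelated Prod.fst Dprod D ∧ ConnectionsRelated Prod.snd Dprod D

/-- `DN` is the restriction of the product connection `D × D` along `j : N → G × G`: the one which is
`j`-related to `D × D`. -/
def IsRestrictedProduct {V N : Type*} [NormedAddCommGroup V] [NormedSpace ℝ V]
    [TopologicalSpace N] [ChartedSpace V N] [IsManifold 𝓘(ℝ, V) ∞ N]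
    (j : N → G × G) (D : TangentConnection 𝓘(ℝ, E) G) (DN : TangentConnection 𝓘(ℝ, V) N) : Prop :=
  ∃ Dprod : TangentConnection (𝓘(ℝ, E).prod 𝓘(ℝ, E)) (G × G),
    IsProductConnection D Dprod ∧ ConnectionsRelated j DN Dprod

/-- `D` is multiplicative: it is `(s,t)`-projectable, and the restriction of `D × D` to `G⁽²⁾` is
`m`-related to `D`. -/
def IsMultiplicative (D : TangentConnection 𝓘(ℝ, E) G) : Prop :=
  𝒢.IsSTProjectable D ∧
  ∃ D₂ : TangentConnection 𝓘(ℝ, 𝒢.ComposableModel) 𝒢.Composable,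
    IsRestrictedProduct (fun p => (p.coord 0, p.coord 1)) D D₂ ∧
    ConnectionsRelated 𝒢.mulMap D₂ D

/-- `A` is the Atiyah cochain `At_D : T^{0,2} G^[2] → m̄^* TG`, which represents the module homomorphism
`m̄^* ∘ D - D^[2] ∘ m̄^* : Ω¹(G) → Γ(T^{2,0} G^[2])`. Here `m̄ : G^[2] → G` is the division map, and
`D^[2]` is the restriction of `D × D` to `G^[2]`. -/
def IsAtiyah (D : TangentConnection 𝓘(ℝ, E) G) (A : 𝒢.TensorSucc 0) : Prop :=
  ∃ D₂ : TangentConnection 𝓘(ℝ, 𝒢.SrcPowModel 1) (𝒢.SrcPow 1),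
    IsRestrictedProduct (fun p => (p.coord 0, p.coord 1)) D D₂ ∧
    ∀ θ : (Π g : G, TangentSpace 𝓘(ℝ, E) g →L[ℝ] ℝ), IsSmoothForm θ →
      ∀ (p : 𝒢.SrcPow 1) (v w : TangentSpace 𝓘(ℝ, 𝒢.SrcPowModel 1) p),
        θ (𝒢.divMap p) (A p v w) =
          D.onForm θ (𝒢.divMap p) (𝒢.dDivMap p v) (𝒢.dDivMap p w)
            - D₂.onForm (pullbackForm 𝒢.divMap θ) p v w

end Smooth

end

end LieGroupoid

end LieGpd

/-! For a smooth map `F : N → P` between manifolds with connections `D`, `D'`, the difference of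
`D.onForm (F^*θ)` and the pull-back of `D'.onForm θ` is `C^∞`-linear in `θ`. It is therefore given
by a bilinear map `B_F` from `TN` to `F^*TP`, the second derivative of `F` (`hessian`,
`hessian_spec`). The proof rests on three facts about it.

On related fields, `B_F(X₁, X₂) = D'_{Y₁} Y₂ - dF(D_{X₁} X₂)` (`hessian_of_fieldsRelated`). If `B_F
= 0` the connections are therefore related; for a submersion the converse holds, since every tangent
vector extends to a pair of related fields (`connectionsRelated_iff_of_submersion`). The chain rule
is `B_{K ∘ F} = B_K(dF, dF) + dK(B_F)` (`hessian_comp`). For the identity between two connections on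
one manifold, `B` is their difference tensor (`hessian_id_apply`).

The restriction of `D × D` to a fibre product is characterised by `B = 0` for all components
(`isRestrictedProduct_iff`). It exists when the maps being fibred have `B = 0` for one connection on
the base (`FibProd.exists_connection`, from `exists_initial_connection`). The Atiyah cochain is then
minus the second derivative of division (`IsPowerConnection.isAtiyah_iff`), and each claim is the
chain rule for an identity between structure maps. The identity `s(gh⁻¹) = t(h)` gives the cochain
condition. The identity `(gk⁻¹)(hk⁻¹)⁻¹ = gh⁻¹` gives the cocycle condition. Changing the
connections by factoring through the identity gives `δ(D - D') = At_{D'} - At_D`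
(`IsPowerConnection.delta₀_difference`).

The diffeomorphism `(g, h) ↦ (gh⁻¹, h)` from `G^[2]` to `G⁽²⁾` exchanges division with a projection
and a projection with multiplication. So `D` is multiplicative exactly when its Atiyah cochain
vanishes. If `At_D = δW`, the connection `D + W` has zero Atiyah cochain; conversely, a
multiplicative `D'` gives `At_D = δ(D' - D)`. -/

set_option linter.unusedSectionVars false

namespace LieGpd

noncomputable section

open Filter Topology

/-! ### Smoothness of fields and forms along maps. -/

section Along

variable {V : Type*} [NormedAddCommGroup V] [NormedSpace ℝ V]
  {H : Type*} [TopologicalSpace H] {I : ModelWithCorners ℝ V H}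
  {N : Type*} [TopologicalSpace N] [ChartedSpace H N] [IsManifold I ∞ N]
  {V' : Type*} [NormedAddCommGroup V'] [NormedSpace ℝ V']
  {H' : Type*} [TopologicalSpace H'] {I' : ModelWithCorners ℝ V' H'}
  {P : Type*} [TopologicalSpace P] [ChartedSpace H' P] [IsManifold I' ∞ P]

lemma IsSmoothField.mdifferentiableAt {X : Π x : N, TangentSpace I x} (hX : IsSmoothField X) (x : N) :
    MDifferentiableAt I I.tangent (fun y => (⟨y, X y⟩ : TangentBundle I N)) x :=
  (hX x).mdifferentiableAt (by simp)

lemma IsSmoothForm.mdifferentiableAt {θ : Π x : N, TangentSpace I x →L[ℝ] ℝ} (hθ : IsSmoothForm θ)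
    (x : N) : MDifferentiableAt I (I.prod 𝓘(ℝ, V →L[ℝ] ℝ))
      (fun y => TotalSpace.mk' (V →L[ℝ] ℝ) y (θ y)) x :=
  (hθ x).mdifferentiableAt (by simp)

/-- Evaluation of a `1`-form on a vector field, both along a smooth map. -/
lemma contMDiffAt_form_apply {Q : Type*} {W K : Type*} [NormedAddCommGroup W] [NormedSpace ℝ W]
    [TopologicalSpace K] {J : ModelWithCorners ℝ W K} [TopologicalSpace Q] [ChartedSpace K Q]
    {b : Q → N} {θ : Π q, TangentSpace I (b q) →L[ℝ] ℝ} {X : Π q, TangentSpace I (b q)} {q : Q}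
    {n : WithTop ℕ∞}
    (hθ : ContMDiffAt J (I.prod 𝓘(ℝ, V →L[ℝ] ℝ)) n
      (fun q => TotalSpace.mk' (V →L[ℝ] ℝ) (E := fun x => TangentSpace I x →L[ℝ] ℝ) (b q) (θ q)) q)
    (hX : ContMDiffAt J I.tangent n (fun q => (⟨b q, X q⟩ : TangentBundle I N)) q) :
    ContMDiffAt J 𝓘(ℝ, ℝ) n (fun q => θ q (X q)) q := by
  have := ContMDiffAt.clm_bundle_apply (E₂ := Trivial N ℝ) hθ hX
  rw [contMDiffAt_totalSpace] at this
  exact this.2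

lemma mdifferentiableAt_form_apply {Q : Type*} {W K : Type*} [NormedAddCommGroup W] [NormedSpace ℝ W]
    [TopologicalSpace K] {J : ModelWithCorners ℝ W K} [TopologicalSpace Q] [ChartedSpace K Q]
    {b : Q → N} {θ : Π q, TangentSpace I (b q) →L[ℝ] ℝ} {X : Π q, TangentSpace I (b q)} {q : Q}
    (hθ : MDifferentiableAt J (I.prod 𝓘(ℝ, V →L[ℝ] ℝ))
      (fun q => TotalSpace.mk' (V →L[ℝ] ℝ) (E := fun x => TangentSpace I x →L[ℝ] ℝ) (b q) (θ q)) q)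
    (hX : MDifferentiableAt J I.tangent (fun q => (⟨b q, X q⟩ : TangentBundle I N)) q) :
    MDifferentiableAt J 𝓘(ℝ, ℝ) (fun q => θ q (X q)) q := by
  have := MDifferentiableAt.clm_bundle_apply (E₂ := Trivial N ℝ) hθ hX
  rw [mdifferentiableAt_totalSpace] at this
  exact this.2

lemma IsSmoothForm.apply {θ : Π x : N, TangentSpace I x →L[ℝ] ℝ} {X : Π x : N, TangentSpace I x}
    (hθ : IsSmoothForm θ) (hX : IsSmoothField X) : ContMDiff I 𝓘(ℝ, ℝ) ∞ (fun x => θ x (X x)) :=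
  fun x => contMDiffAt_form_apply (hθ x) (hX x)

/-- The differential of a smooth function along a smooth vector field is smooth. -/
lemma contMDiff_mvfderiv_apply {f : N → ℝ} {X : Π x : N, TangentSpace I x}
    (hf : ContMDiff I 𝓘(ℝ, ℝ) ∞ f) (hX : IsSmoothField X) :
    ContMDiff I 𝓘(ℝ, ℝ) ∞ (fun x => mvfderiv I f x (X x)) := by
  have h := (hf.contMDiff_tangentMap (m := ∞) (by simp)).comp hX
  exact contMDiff_snd_tangentBundle_modelSpace ℝ 𝓘(ℝ, ℝ) |>.comp h

lemma contMDiff_mfderiv_field {F : N → P} (hF : ContMDiff I I' ∞ F) {X : Π x : N, TangentSpace I x}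
    (hX : IsSmoothField X) :
    ContMDiff I I'.tangent ∞ (fun x => (⟨F x, mfderiv I I' F x (X x)⟩ : TangentBundle I' P)) :=
  (hF.contMDiff_tangentMap (m := ∞) (by simp)).comp hX

lemma mdifferentiableAt_mfderiv_field {F : N → P} (hF : ContMDiff I I' ∞ F)
    {X : Π x : N, TangentSpace I x} {x : N}
    (hX : MDifferentiableAt I I.tangent (fun y => (⟨y, X y⟩ : TangentBundle I N)) x) :
    MDifferentiableAt I I'.tangent
      (fun x => (⟨F x, mfderiv I I' F x (X x)⟩ : TangentBundle I' P)) x :=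
  ((hF.contMDiff_tangentMap (m := ∞) (by simp)).mdifferentiableAt (by simp)).comp x hX

end Along

/-! ### Extending vectors and covectors to global smooth sections. -/

section Sections

variable {V : Type*} [NormedAddCommGroup V] [NormedSpace ℝ V] [FiniteDimensional ℝ V]
  {H : Type*} [TopologicalSpace H] {I : ModelWithCorners ℝ V H}
  {N : Type*} [TopologicalSpace N] [ChartedSpace H N] [T2Space N] [IsManifold I ∞ N]

variable (I) in
/-- A section of a vector bundle which is smooth near a point agrees near this point with a smooth
global section. -/
lemma exists_contMDiff_section_eventuallyEq {F : Type*} [NormedAddCommGroup F] [NormedSpace ℝ F]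
    {B : N → Type*} [TopologicalSpace (TotalSpace F B)] [∀ x, AddCommGroup (B x)]
    [∀ x, Module ℝ (B x)] [∀ x, TopologicalSpace (B x)] [FiberBundle F B] [VectorBundle ℝ F B]
    {σ : Π x, B x} {x : N} {u : Set N} (hu : u ∈ 𝓝 x)
    (hσ : ContMDiffOn I (I.prod 𝓘(ℝ, F)) ∞ (fun y => TotalSpace.mk' F y (σ y)) u) :
    ∃ τ : Π x, B x, ContMDiff I (I.prod 𝓘(ℝ, F)) ∞ (fun y => TotalSpace.mk' F y (τ y)) ∧
      ∀ᶠ y in 𝓝 x, τ y = σ y := by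
  obtain ⟨v, hvu, hv, hxv⟩ := mem_nhds_iff.1 hu
  obtain ⟨ψ, hψ⟩ := (SmoothBumpFunction.nhds_basis_tsupport (I := I) x).mem_iff.1
    (hv.mem_nhds hxv)
  refine ⟨(ψ : N → ℝ) • σ, ContMDiffOn.smul_section_of_tsupport ψ.contMDiff.contMDiffOn hv hψ.2
    (hσ.mono hvu), ?_⟩
  filter_upwards [ψ.eventuallyEq_one] with y hy
  simp [hy]

/-- The local extension is cut off by a bump function. Agreement with `FiberBundle.extend` near `x`,
and not only at `x`, is what allows smoothness of bundle maps to be tested on global fields. -/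
lemma exists_isSmoothField {x : N} (v : TangentSpace I x) :
    ∃ X : Π x : N, TangentSpace I x, IsSmoothField X ∧
      (∀ᶠ y in 𝓝 x, X y = FiberBundle.extend V v y) ∧ X x = v := by
  obtain ⟨u, hu, h⟩ := FiberBundle.exists_contMDiffOn_extend (k := ∞) I V v
  obtain ⟨X, hX, h⟩ := exists_contMDiff_section_eventuallyEq I hu h
  exact ⟨X, hX, h, by simpa using h.self_of_nhds⟩

lemma exists_isSmoothForm {x : N} (ℓ : TangentSpace I x →L[ℝ] ℝ) :
    ∃ θ : Π x : N, TangentSpace I x →L[ℝ] ℝ, IsSmoothForm θ ∧ θ x = ℓ := by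
  obtain ⟨u, hu, h⟩ := FiberBundle.exists_contMDiffOn_extend (k := ∞) I (V →L[ℝ] ℝ)
    (V := fun x : N => TangentSpace I x →L[ℝ] ℝ) ℓ
  obtain ⟨X, hX, h⟩ := exists_contMDiff_section_eventuallyEq I hu h
  exact ⟨X, hX, by simpa using h.self_of_nhds⟩

/-- Covectors separate points, and each extends to a global form. Most identities between tangent
vectors below are proved in this way. -/
lemma ext_of_forms {x : N} {v w : TangentSpace I x}
    (h : ∀ θ : Π x : N, TangentSpace I x →L[ℝ] ℝ, IsSmoothForm θ → θ x v = θ x w) : v = w := by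
  have : FiniteDimensional ℝ (TangentSpace I x) := inferInstanceAs (FiniteDimensional ℝ V)
  by_contra hvw
  obtain ⟨ℓ, hℓ⟩ : ∃ ℓ : V →L[ℝ] ℝ, ℓ (v - w : V) ≠ 0 :=
    SeparatingDual.exists_ne_zero (sub_ne_zero.2 hvw)
  obtain ⟨θ, hθ, rfl⟩ := exists_isSmoothForm (I := I) (x := x) ℓ
  exact hℓ ((map_sub (θ x) v w).trans (sub_eq_zero.2 (h θ hθ)))

end Sections

/-! ### Smoothness tested on finitely many forms or on global fields. -/

section Criteria

lemma contMDiffAt_ringInverse {R : Type*} [NormedRing R] [NormedAlgebra ℝ R] [HasSummableGeomSeries R]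
    {Q : Type*} {W K : Type*} [NormedAddCommGroup W] [NormedSpace ℝ W]
    [TopologicalSpace K] {J : ModelWithCorners ℝ W K} [TopologicalSpace Q] [ChartedSpace K Q]
    {A : Q → R} {q : Q} (hA : ContMDiffAt J 𝓘(ℝ, R) ∞ A q) (hq : IsUnit (A q)) :
    ContMDiffAt J 𝓘(ℝ, R) ∞ (fun y => Ring.inverse (A y)) q ∧ ∀ᶠ y in 𝓝 q, IsUnit (A y) := by
  refine ⟨?_, hA.continuousAt.eventually (Units.isOpen.mem_nhds hq)⟩
  obtain ⟨a, ha⟩ := hq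
  have := contDiffAt_ringInverse ℝ (n := ∞) a
  rw [ha] at this
  exact this.contMDiffAt.comp q hA

lemma contMDiffAt_clm_of_apply {V₁ V₂ : Type*} [NormedAddCommGroup V₁] [NormedSpace ℝ V₁]
    [FiniteDimensional ℝ V₁] [NormedAddCommGroup V₂] [NormedSpace ℝ V₂]
    {Q : Type*} {W K : Type*} [NormedAddCommGroup W] [NormedSpace ℝ W]
    [TopologicalSpace K] {J : ModelWithCorners ℝ W K} [TopologicalSpace Q] [ChartedSpace K Q]
    {A : Q → V₁ →L[ℝ] V₂} {q : Q} (hA : ∀ v, ContMDiffAt J 𝓘(ℝ, V₂) ∞ (fun y => A y v) q) :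
    ContMDiffAt J 𝓘(ℝ, V₁ →L[ℝ] V₂) ∞ A q := by
  let b := Module.finBasis ℝ V₁
  have h : A = fun y => ∑ i, (LinearMap.toContinuousLinearMap (b.coord i)).smulRight (A y (b i)) := by
    funext y
    ext v
    calc A y v = A y (∑ i, b.repr v i • b i) := by rw [b.sum_repr]
      _ = _ := by rw [map_sum]; simp
  rw [h]
  refine contMDiffAt_finsetSum fun i _ => ?_
  exact (ContinuousLinearMap.smulRightL ℝ V₁ V₂
    (LinearMap.toContinuousLinearMap (b.coord i))).contDiff.contMDiff.contMDiffAt.comp q (hA (b i))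

variable {V : Type*} [NormedAddCommGroup V] [NormedSpace ℝ V] [FiniteDimensional ℝ V]
  {H : Type*} [TopologicalSpace H] {I : ModelWithCorners ℝ V H}
  {N : Type*} [TopologicalSpace N] [ChartedSpace H N] [IsManifold I ∞ N]

/-- A vector field is smooth at a point if its values on finitely many smooth `1`-forms, which span
the cotangent space at this point, are. -/
lemma contMDiffAt_field_of_forms {ι : Type*} [Finite ι] {η : ι → Π x : N, TangentSpace I x →L[ℝ] ℝ}
    (hη : ∀ i, IsSmoothForm (η i)) {x : N} (hx : ∀ v : TangentSpace I x, (∀ i, η i x v = 0) → v = 0)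
    {u : Π x : N, TangentSpace I x} (hu : ∀ i, ContMDiffAt I 𝓘(ℝ, ℝ) ∞ (fun y => η i y (u y)) x) :
    ContMDiffAt I I.tangent ∞ (fun y => (⟨y, u y⟩ : TangentBundle I N)) x := by
  classical
  have := Fintype.ofFinite ι
  let e := trivializationAt V (TangentSpace I : N → Type _) x
  have hxe : x ∈ e.baseSet := FiberBundle.mem_baseSet_trivializationAt' x
  let Ω (i : ι) (y : N) : V →L[ℝ] ℝ := (η i y).comp (e.symmL ℝ y)
  have hΩ (i : ι) : ContMDiffAt I 𝓘(ℝ, V →L[ℝ] ℝ) ∞ (Ω i) x := by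
    have h := (contMDiffAt_hom_bundle (E₁ := (TangentSpace I : N → Type _)) (E₂ := Trivial N ℝ)
      _).1 (hη i x)
    refine h.2.congr_of_eventuallyEq ?_
    filter_upwards [e.open_baseSet.mem_nhds hxe] with y hy
    rw [ContinuousLinearMap.inCoordinates_eq hy (by simp)]
    ext w
    simp only [Ω, ContinuousLinearMap.comp_apply, e.symmL_apply hy]
    simp [e]
  let L : V →ₗ[ℝ] (ι → ℝ) := LinearMap.pi fun i => (Ω i x).toLinearMap
  have hL : LinearMap.ker L = ⊥ := by
    rw [LinearMap.ker_eq_bot']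
    intro w hw
    have h := hx (e.symmL ℝ x w) (fun i => congrFun hw i)
    rw [← e.continuousLinearMapAt_symmL (R := ℝ) hxe w, h, map_zero]
  obtain ⟨R, hR⟩ := L.exists_leftInverse_of_injective hL
  -- `A y` composes the coframe at `y` with a left inverse `R` of the coframe at `x`. Hence `A x =
  -- 1`, `A` is invertible near `x`, and `u` is recovered there as `A⁻¹` applied to a combination of
  -- the smooth functions `η i (u)`.
  let A (y : N) : V →L[ℝ] V := ∑ i, (Ω i y).smulRight (R (Pi.single i 1))
  have hA : ContMDiffAt I 𝓘(ℝ, V →L[ℝ] V) ∞ A x := by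
    refine contMDiffAt_finsetSum fun i _ => ?_
    exact ((ContinuousLinearMap.smulRightL ℝ V V).flip
      (R (Pi.single i 1))).contDiff.contMDiff.contMDiffAt.comp x (hΩ i)
  have hAR (y : N) (w : V) : A y w = R (fun i => Ω i y w) := by
    conv_rhs => rw [← Finset.univ_sum_single (fun i => Ω i y w)]
    simp only [A, _root_.sum_apply, ContinuousLinearMap.smulRight_apply, map_sum]
    refine Finset.sum_congr rfl fun i _ => ?_
    rw [← map_smul, ← Pi.single_smul, smul_eq_mul, mul_one]
  have hAx : A x = 1 := by
    ext w
    rw [hAR]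
    exact LinearMap.congr_fun hR w
  obtain ⟨hinv, hunit⟩ := contMDiffAt_ringInverse hA (by rw [hAx]; exact isUnit_one)
  rw [contMDiffAt_section]
  have hsum : ContMDiffAt I 𝓘(ℝ, V) ∞ (fun y => ∑ i, η i y (u y) • R (Pi.single i 1)) x :=
    contMDiffAt_finsetSum fun i _ => (hu i).smul contMDiffAt_const
  refine (hinv.clm_apply hsum).congr_of_eventuallyEq ?_
  filter_upwards [hunit, e.open_baseSet.mem_nhds hxe] with y hy hye
  have h1 : ∑ i, η i y (u y) • R (Pi.single i 1) = A y (e ⟨y, u y⟩).2 := by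
    simp only [A, _root_.sum_apply, ContinuousLinearMap.smulRight_apply, Ω,
      ContinuousLinearMap.comp_apply]
    refine Finset.sum_congr rfl fun i _ => ?_
    congr 2
    simp [Trivialization.symm_apply_apply_mk, hye]
  rw [h1]
  exact (DFunLike.congr_fun (Ring.inverse_mul_cancel _ hy) _).symm

/-- Near a point, a constant vector in a trivialization is the value of a global smooth field, so
testing on such fields controls every column of the local matrix of `σ`. -/
lemma contMDiff_hom_section [T2Space N] {F : Type*} [NormedAddCommGroup F] [NormedSpace ℝ F]
    {B : N → Type*} [TopologicalSpace (TotalSpace F B)] [∀ x, AddCommGroup (B x)]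
    [∀ x, Module ℝ (B x)] [∀ x, TopologicalSpace (B x)] [FiberBundle F B] [VectorBundle ℝ F B]
    [∀ x, IsTopologicalAddGroup (B x)] [∀ x, ContinuousSMul ℝ (B x)]
    {σ : Π x, TangentSpace I x →L[ℝ] B x}
    (h : ∀ X : Π x : N, TangentSpace I x, IsSmoothField X →
      ContMDiff I (I.prod 𝓘(ℝ, F)) ∞ (fun x => TotalSpace.mk' F x (σ x (X x)))) :
    ContMDiff I (I.prod 𝓘(ℝ, V →L[ℝ] F)) ∞
      (fun x => TotalSpace.mk' (V →L[ℝ] F) (E := fun x => TangentSpace I x →L[ℝ] B x) x (σ x)) := by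
  intro x
  rw [contMDiffAt_hom_bundle]
  refine ⟨contMDiffAt_id, contMDiffAt_clm_of_apply fun w => ?_⟩
  let e := trivializationAt V (TangentSpace I : N → Type _) x
  let e' := trivializationAt F B x
  have hxe : x ∈ e.baseSet := FiberBundle.mem_baseSet_trivializationAt' x
  have hxe' : x ∈ e'.baseSet := FiberBundle.mem_baseSet_trivializationAt' x
  obtain ⟨X, hX, hX', -⟩ := exists_isSmoothField (I := I) (x := x) (e.symm x w)
  have := (contMDiffAt_totalSpace.1 (h X hX x)).2
  refine this.congr_of_eventuallyEq ?_
  filter_upwards [e.open_baseSet.mem_nhds hxe, e'.open_baseSet.mem_nhds hxe', hX'] with y hy hy' hyX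
  rw [ContinuousLinearMap.inCoordinates_eq hy hy', hyX]
  simp [FiberBundle.extend, e, e', Trivialization.apply_mk_symm _ hxe]

end Criteria

/-! ### Lifting vector fields along submersions. -/

section Lift

variable {V : Type*} [NormedAddCommGroup V] [NormedSpace ℝ V] [FiniteDimensional ℝ V]
  {H : Type*} [TopologicalSpace H] {I : ModelWithCorners ℝ V H}
  {N : Type*} [TopologicalSpace N] [ChartedSpace H N] [T2Space N] [IsManifold I ∞ N]
  {V' : Type*} [NormedAddCommGroup V'] [NormedSpace ℝ V'] [FiniteDimensional ℝ V']
  {H' : Type*} [TopologicalSpace H'] {I' : ModelWithCorners ℝ V' H'}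
  {P : Type*} [TopologicalSpace P] [ChartedSpace H' P] [T2Space P] [IsManifold I' ∞ P]

/-- A vector field along `F` can be lifted near a point where `dF` is surjective. -/
lemma exists_local_lift {F : N → P} (hF : ContMDiff I I' ∞ F) {x : N}
    (hx : Function.Surjective (mfderiv I I' F x)) {Z : Π y, TangentSpace I' (F y)}
    (hZ : ∀ θ : Π y : P, TangentSpace I' y →L[ℝ] ℝ, IsSmoothForm θ →
      ContMDiff I 𝓘(ℝ, ℝ) ∞ (fun y => θ (F y) (Z y))) :
    ∃ u ∈ 𝓝 x, ∃ X : Π y : N, TangentSpace I y,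
      ContMDiffOn I I.tangent ∞ (fun y => (⟨y, X y⟩ : TangentBundle I N)) u ∧
      (∀ y ∈ u, mfderiv I I' F y (X y) = Z y) ∧ ∀ y, Z y = 0 → X y = 0 := by
  classical
  let b := Module.finBasis ℝ V'
  choose c hc using fun k => hx (b k)
  choose X hX _ hXc using fun k => exists_isSmoothField (I := I) (x := x) (c k)
  choose θ hθ hθb using fun l => exists_isSmoothForm (I := I') (x := F x)
    (LinearMap.toContinuousLinearMap (b.coord l) : V' →L[ℝ] ℝ)
  -- `Θ` reads off coordinates with forms extending the dual basis at `F x`, and `D` sends basis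
  -- vectors to the images of fields whose values at `x` lift the basis. Their composite `A` is the
  -- identity at `x`, and `D (A⁻¹ (Θ Z)) = Z` wherever `A` is invertible.
  let Θ (y : N) : TangentSpace I' (F y) →ₗ[ℝ] V' :=
    ∑ l, (θ l (F y)).toLinearMap.smulRight (b l)
  let D (y : N) : V' →ₗ[ℝ] TangentSpace I' (F y) :=
    ∑ k, (b.coord k).smulRight (mfderiv I I' F y (X k y))
  let A (y : N) : V' →L[ℝ] V' := LinearMap.toContinuousLinearMap ((Θ y).comp (D y))
  have hΘ {W : Π y, TangentSpace I' (F y)}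
      (hW : ∀ θ : Π y : P, TangentSpace I' y →L[ℝ] ℝ, IsSmoothForm θ →
        ContMDiff I 𝓘(ℝ, ℝ) ∞ (fun y => θ (F y) (W y))) :
      ContMDiff I 𝓘(ℝ, V') ∞ (fun y => Θ y (W y)) := by
    intro y
    simp only [Θ, LinearMap.sum_apply, LinearMap.smulRight_apply]
    exact contMDiffAt_finsetSum fun l _ => (hW _ (hθ l) y).smul contMDiffAt_const
  have hDb (y : N) (k) : D y (b k) = mfderiv I I' F y (X k y) := by
    simp only [D, LinearMap.sum_apply, LinearMap.smulRight_apply, Module.Basis.coord_apply,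
      Module.Basis.repr_self, Finsupp.single_apply, ite_smul, one_smul, zero_smul,
      Finset.sum_ite_eq, Finset.mem_univ, if_true]
  have hA : ContMDiff I 𝓘(ℝ, V' →L[ℝ] V') ∞ A := by
    refine fun y => contMDiffAt_clm_of_apply fun w => ?_
    have (y : N) : A y w = ∑ k, b.coord k w • Θ y (mfderiv I I' F y (X k y)) := by
      change Θ y (D y w) = _
      simp [D]
    simp only [this]
    refine contMDiffAt_finsetSum fun k _ => ?_
    exact (contDiff_const_smul (b.coord k w)).contMDiff.contMDiffAt.comp y (hΘ (fun θ hθ y => contMDiffAt_form_apply ((hθ.comp hF) y)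
        (contMDiff_mfderiv_field hF (hX k) y)) y)
  have hAx : A x = 1 := by
    ext w
    have : D x = LinearMap.id := b.ext fun k => by
      rw [hDb, hXc, hc]; rfl
    change Θ x (D x w) = w
    rw [this]
    simp only [Θ, LinearMap.sum_apply, LinearMap.smulRight_apply]
    conv_rhs => rw [← b.sum_repr w]
    refine Finset.sum_congr rfl fun l _ => ?_
    rw [hθb]
    rfl
  let a (y : N) : V' := Ring.inverse (A y) (Θ y (Z y))
  have hu := (contMDiffAt_ringInverse (hA x) (by rw [hAx]; exact isUnit_one)).2
  refine ⟨{y | IsUnit (A y)}, hu, fun y => ∑ k, b.coord k (a y) • X k y, ?_, ?_, ?_⟩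
  · intro y hy
    have ha : ContMDiffAt I 𝓘(ℝ, V') ∞ a y :=
      (contMDiffAt_ringInverse (hA y) hy).1.clm_apply (hΘ hZ y)
    refine (ContMDiffAt.sum_section fun k _ => ContMDiffAt.smul_section (f := fun y => b.coord k (a y)) ?_
      (hX k y)).contMDiffWithinAt
    exact (LinearMap.toContinuousLinearMap (b.coord k)).contDiff.contMDiff.contMDiffAt.comp y ha
  · intro y hy
    have h1 : mfderiv I I' F y (∑ k, b.coord k (a y) • X k y) = D y (a y) := by
      simp [D]
    rw [h1]
    -- Invertibility of `Θ ∘ D` makes `Θ` surjective, hence injective by equality of dimensions. It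
    -- then suffices to compare both sides after applying `Θ`.
    have hsurj : Function.Surjective (Θ y) := fun w => by
      refine ⟨D y (Ring.inverse (A y) w), ?_⟩
      exact DFunLike.congr_fun (Ring.mul_inverse_cancel _ hy) w
    have hinj : Function.Injective (Θ y) := by
      have h (T : V' →ₗ[ℝ] V') (hT : Function.Surjective T) : Function.Injective T :=
        LinearMap.injective_iff_surjective.2 hT
      exact h (Θ y) hsurj
    refine hinj ?_
    exact DFunLike.congr_fun (Ring.mul_inverse_cancel _ hy) (Θ y (Z y))
  · intro y hy
    simp [a, hy]

/-- Vector fields can be lifted along submersions, with a prescribed value at one point. -/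
lemma exists_lift [SigmaCompactSpace N] {F : N → P} (hF : ContMDiff I I' ∞ F)
    (hF' : ∀ x, Function.Surjective (mfderiv I I' F x)) {Y : Π y : P, TangentSpace I' y}
    (hY : IsSmoothField Y) {x : N} {v : TangentSpace I x} (hv : mfderiv I I' F x v = Y (F x)) :
    ∃ X : Π x : N, TangentSpace I x, IsSmoothField X ∧ FieldsRelated F X Y ∧ X x = v := by
  obtain ⟨C, hC, -, hCv⟩ := exists_isSmoothField (I := I) v
  -- `t` consists of the admissible corrections to the extension `C` of `v`. The conditions are
  -- affine, so local solutions can be glued with a partition of unity; a zero correction is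
  -- admissible at `x` because `C x = v` already lifts `Y (F x)`.
  let t (y : N) : Set (TangentSpace I y) :=
    {w | mfderiv I I' F y (C y + w) = Y (F y) ∧ (y = x → w = 0)}
  have hZ (θ : Π y : P, TangentSpace I' y →L[ℝ] ℝ) (hθ : IsSmoothForm θ) :
      ContMDiff I 𝓘(ℝ, ℝ) ∞ (fun y => θ (F y) (Y (F y) - mfderiv I I' F y (C y))) := by
    simp only [map_sub]
    exact ((hθ.apply hY).comp hF).sub fun y => contMDiffAt_form_apply ((hθ.comp hF) y)
      (contMDiff_mfderiv_field hF hC y)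
  obtain ⟨X, hX⟩ := exists_contMDiffSection_forall_mem_convex_of_local (n := ⊤) I
    (TangentSpace I : N → Type _) (F_fiber := V) t (by
      rintro y w₁ ⟨h₁, h₁'⟩ w₂ ⟨h₂, h₂'⟩ a b ha hb hab
      refine ⟨?_, fun h => by rw [h₁' h, h₂' h]; simp⟩
      rw [map_add] at h₁ h₂ ⊢
      rw [map_add, map_smul, map_smul, eq_sub_of_add_eq' h₁, eq_sub_of_add_eq' h₂, ← add_smul, hab, one_smul,
        add_sub_cancel])
    (by
      intro y
      obtain ⟨u, hu, X, hX, hXu, hX0⟩ := exists_local_lift hF (hF' y) hZ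
      refine ⟨u, hu, X, hX, fun z hz => ⟨?_, ?_⟩⟩
      · rw [map_add, hXu z hz, add_sub_cancel]
      · rintro rfl
        refine hX0 _ ?_
        rw [hCv, hv, sub_self])
  refine ⟨C + X, ?_, fun y => (hX y).1, ?_⟩
  · exact ContMDiff.add_section hC X.contMDiff
  · change C x + X x = v
    rw [hCv, (hX x).2 rfl, add_zero]

end Lift

/-- A bilinear map on a tangent space of a finite-dimensional manifold is continuous. -/
def tangentBilin {V : Type*} [NormedAddCommGroup V] [NormedSpace ℝ V] [FiniteDimensional ℝ V]
    {H : Type*} [TopologicalSpace H] {I : ModelWithCorners ℝ V H}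
    {N : Type*} [TopologicalSpace N] [ChartedSpace H N] {W : Type*} [AddCommGroup W] [Module ℝ W]
    [TopologicalSpace W] [IsTopologicalAddGroup W] [ContinuousSMul ℝ W] {x : N}
    {f : TangentSpace I x → TangentSpace I x → W} (hf : IsBilinearMap ℝ f) :
    TangentSpace I x →L[ℝ] TangentSpace I x →L[ℝ] W :=
  have : FiniteDimensional ℝ (TangentSpace I x) := inferInstanceAs (FiniteDimensional ℝ V)
  have : T2Space (TangentSpace I x) := inferInstanceAs (T2Space V)
  hf.toLinearMap.toContinuousBilinearMap

/-! ### Tensoriality and smoothness of the covariant derivative of a form. -/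

section OnForm

variable {V : Type*} [NormedAddCommGroup V] [NormedSpace ℝ V] [FiniteDimensional ℝ V]
  {H : Type*} [TopologicalSpace H] {I : ModelWithCorners ℝ V H}
  {N : Type*} [TopologicalSpace N] [ChartedSpace H N] [IsManifold I ∞ N]

variable (I) in
/-- The values of `θ` on vector fields which are differentiable at `x` are differentiable at `x`. -/
def FormDifferentiableAt (θ : Π x : N, TangentSpace I x →L[ℝ] ℝ) (x : N) : Prop :=
  ∀ W : Π x : N, TangentSpace I x,
    MDifferentiableAt I I.tangent (fun y => (⟨y, W y⟩ : TangentBundle I N)) x →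
    MDifferentiableAt I 𝓘(ℝ, ℝ) (fun y => θ y (W y)) x

omit [FiniteDimensional ℝ V] in
lemma formDifferentiableAt_of_mdifferentiableAt {θ : Π x : N, TangentSpace I x →L[ℝ] ℝ} {x : N}
    (hθ : MDifferentiableAt I (I.prod 𝓘(ℝ, V →L[ℝ] ℝ))
      (fun y => TotalSpace.mk' (V →L[ℝ] ℝ) y (θ y)) x) : FormDifferentiableAt I θ x :=
  fun _ hW => mdifferentiableAt_form_apply hθ hW

omit [FiniteDimensional ℝ V] in
lemma IsSmoothForm.formDifferentiableAt {θ : Π x : N, TangentSpace I x →L[ℝ] ℝ}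
    (hθ : IsSmoothForm θ) (x : N) : FormDifferentiableAt I θ x :=
  formDifferentiableAt_of_mdifferentiableAt (hθ.mdifferentiableAt x)

variable (D : TangentConnection I N) {θ : Π x : N, TangentSpace I x →L[ℝ] ℝ} {x : N}

-- The term `df(v) θ(W)` occurs in both summands for `fW` and cancels. Differentiability of `θ` is
-- assumed only at the point and only through its values on fields, since this is what pull-backs of
-- locally extended forms provide directly.
omit [FiniteDimensional ℝ V] in
lemma tensorialAt_onForm (hθ : FormDifferentiableAt I θ x) (v : TangentSpace I x) :
    TensorialAt I V (V := (TangentSpace I : N → Type _))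
      (fun W => mvfderiv I (fun y => θ y (W y)) x v - θ x (D.cov W x v)) x where
  smul {f σ} hf hσ := by
    have h1 : (fun y => θ y ((f • σ) y)) = fun y => f y * θ y (σ y) := by
      funext y
      simp
    rw [h1, D.cov.isCovariantDerivativeOnUniv.leibniz hσ hf]
    have h2 := mvfderiv_mul hf (hθ σ hσ)
    change mvfderiv I (f * fun y => θ y (σ y)) x v - _ = _
    rw [h2]
    simp only [_root_.add_apply, _root_.smul_apply, ContinuousLinearMap.smulRight_apply,
      map_add, map_smul, smul_eq_mul]
    ring
  add {σ σ'} hσ hσ' := by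
    have h1 : (fun y => θ y ((σ + σ') y)) = (fun y => θ y (σ y)) + fun y => θ y (σ' y) := by
      funext y
      simp
    rw [h1, D.cov.isCovariantDerivativeOnUniv.add hσ hσ', mvfderiv_add (hθ σ hσ) (hθ σ' hσ')]
    simp only [_root_.add_apply, map_add]
    ring

/-- `(∇θ)(v, W) = v(θ(W)) - θ(∇_v W)` for all vector fields `W` which are differentiable at `x`. -/
lemma TangentConnection.onForm_apply (hθ : FormDifferentiableAt I θ x) (v : TangentSpace I x)
    {W : Π x : N, TangentSpace I x}
    (hW : MDifferentiableAt I I.tangent (fun y => (⟨y, W y⟩ : TangentBundle I N)) x) :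
    D.onForm θ x v (W x) = mvfderiv I (fun y => θ y (W y)) x v - θ x (D.cov W x v) :=
  (tensorialAt_onForm D hθ v).pointwise (FiberBundle.mdifferentiableAt_extend ..) hW (by simp)

lemma isBilinearMap_onForm (hθ : FormDifferentiableAt I θ x) :
    IsBilinearMap ℝ (D.onForm θ x) where
  add_left v v' w := by
    simp only [TangentConnection.onForm, map_add]
    ring
  smul_left c v w := by
    simp only [TangentConnection.onForm, map_smul, smul_eq_mul]
    ring
  add_right v w w' := by
    exact map_add (TensorialAt.mkHom _ x (tensorialAt_onForm D hθ v)) w w'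
  smul_right c v w := by
    exact map_smul (TensorialAt.mkHom _ x (tensorialAt_onForm D hθ v)) c w

/-- The covariant derivative of a smooth `1`-form as a family of bilinear forms. -/
def TangentConnection.onFormHom (hθ : IsSmoothForm θ) (x : N) :
    TangentSpace I x →L[ℝ] TangentSpace I x →L[ℝ] ℝ :=
  tangentBilin (isBilinearMap_onForm D (hθ.formDifferentiableAt x))

omit [FiniteDimensional ℝ V] in
lemma TangentConnection.contMDiff_cov {Y : Π x : N, TangentSpace I x} (hY : IsSmoothField Y) :
    ContMDiff I (I.prod 𝓘(ℝ, V →L[ℝ] V)) ∞ (fun x => TotalSpace.mk' (V →L[ℝ] V)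
      (E := fun x => TangentSpace I x →L[ℝ] TangentSpace I x) x (D.cov Y x)) :=
  contMDiffOn_univ.1 (D.smooth.contMDiff.contMDiff hY.contMDiffOn)

omit [FiniteDimensional ℝ V] in
lemma TangentConnection.isSmoothField_cov {X Y : Π x : N, TangentSpace I x} (hX : IsSmoothField X)
    (hY : IsSmoothField Y) : IsSmoothField (fun x => D.cov Y x (X x)) :=
  (D.contMDiff_cov hY).clm_bundle_apply hX

lemma TangentConnection.contMDiff_onForm_apply (hθ : IsSmoothForm θ) {X Y : Π x : N, TangentSpace I x}
    (hX : IsSmoothField X) (hY : IsSmoothField Y) :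
    ContMDiff I 𝓘(ℝ, ℝ) ∞ (fun x => D.onForm θ x (X x) (Y x)) := by
  have h (x) := D.onForm_apply (hθ.formDifferentiableAt x) (X x) (hY.mdifferentiableAt x)
  simp only [h]
  exact (contMDiff_mvfderiv_apply (hθ.apply hY) hX).sub (hθ.apply (D.isSmoothField_cov hX hY))

/-- As a section of a bundle, `∇θ` can be composed with a smooth map. It can then be evaluated on
fields along that map, which need not be restrictions of fields on `N`. -/
lemma TangentConnection.contMDiff_onFormHom [T2Space N] (hθ : IsSmoothForm θ) :
    ContMDiff I (I.prod 𝓘(ℝ, V →L[ℝ] V →L[ℝ] ℝ)) ∞ (fun x => TotalSpace.mk' (V →L[ℝ] V →L[ℝ] ℝ)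
      (E := fun x => TangentSpace I x →L[ℝ] TangentSpace I x →L[ℝ] Trivial N ℝ x) x (D.onFormHom hθ x)) := by
  refine contMDiff_hom_section fun X hX => contMDiff_hom_section (B := Trivial N ℝ) fun Y hY => ?_
  intro x
  rw [contMDiffAt_totalSpace]
  exact ⟨contMDiffAt_id, D.contMDiff_onForm_apply hθ hX hY x⟩

/-- The covariant derivative of a smooth `1`-form along a smooth map is smooth. -/
lemma TangentConnection.contMDiff_onForm_along [T2Space N] (hθ : IsSmoothForm θ)
    {Q : Type*} {W K : Type*} [NormedAddCommGroup W] [NormedSpace ℝ W]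
    [TopologicalSpace K] {J : ModelWithCorners ℝ W K} [TopologicalSpace Q] [ChartedSpace K Q]
    {b : Q → N} (hb : ContMDiff J I ∞ b) {X Y : Π q, TangentSpace I (b q)}
    (hX : ContMDiff J I.tangent ∞ (fun q => (⟨b q, X q⟩ : TangentBundle I N)))
    (hY : ContMDiff J I.tangent ∞ (fun q => (⟨b q, Y q⟩ : TangentBundle I N))) :
    ContMDiff J 𝓘(ℝ, ℝ) ∞ (fun q => D.onForm θ (b q) (X q) (Y q)) := by
  have := ContMDiff.clm_bundle_apply₂ (E₃ := Trivial N ℝ) ((D.contMDiff_onFormHom hθ).comp hb) hX hY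
  intro q
  exact ((contMDiffAt_totalSpace.1 (this q)).2)

end OnForm

/-! ### The second derivative of a map between manifolds with connections. -/

section Hessian

variable {V : Type*} [NormedAddCommGroup V] [NormedSpace ℝ V] [FiniteDimensional ℝ V]
  {H : Type*} [TopologicalSpace H] {I : ModelWithCorners ℝ V H}
  {N : Type*} [TopologicalSpace N] [ChartedSpace H N] [IsManifold I ∞ N]
  {V' : Type*} [NormedAddCommGroup V'] [NormedSpace ℝ V'] [FiniteDimensional ℝ V']
  {H' : Type*} [TopologicalSpace H'] {I' : ModelWithCorners ℝ V' H'}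
  {P : Type*} [TopologicalSpace P] [ChartedSpace H' P] [IsManifold I' ∞ P]

omit [FiniteDimensional ℝ V] [FiniteDimensional ℝ V'] in
lemma formDifferentiableAt_pullbackForm {F : N → P} (hF : ContMDiff I I' ∞ F)
    {θ : Π y : P, TangentSpace I' y →L[ℝ] ℝ} {x : N}
    (hθ : MDifferentiableAt I' (I'.prod 𝓘(ℝ, V' →L[ℝ] ℝ))
      (fun y => TotalSpace.mk' (V' →L[ℝ] ℝ) y (θ y)) (F x)) :
    FormDifferentiableAt I (pullbackForm (I := I) F θ) x :=
  fun W hW => mdifferentiableAt_form_apply (b := F)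
    (θ := fun y => θ (F y)) (X := fun y => mfderiv I I' F y (W y)) (hθ.comp x (hF.mdifferentiableAt (by simp)))
    (mdifferentiableAt_mfderiv_field hF hW)

omit [FiniteDimensional ℝ V'] in
lemma IsSmoothForm.pullback [T2Space N] {F : N → P} (hF : ContMDiff I I' ∞ F)
    {θ : Π y : P, TangentSpace I' y →L[ℝ] ℝ} (hθ : IsSmoothForm θ) :
    IsSmoothForm (pullbackForm (I := I) F θ) := by
  refine contMDiff_hom_section (B := Trivial N ℝ) fun X hX x => ?_
  rw [contMDiffAt_totalSpace]
  exact ⟨contMDiffAt_id,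
    contMDiffAt_form_apply (b := F) (θ := fun y => θ (F y)) (X := fun y => mfderiv I I' F y (X y))
      ((hθ.comp hF) x) (contMDiff_mfderiv_field hF hX x)⟩

variable (D : TangentConnection I N) (D' : TangentConnection I' P)

-- Replacing `θ` by `fθ` produces the extra term `df(dF v) θ(dF w)` in both covariant derivatives,
-- so the difference is linear over functions.
omit [FiniteDimensional ℝ V] [FiniteDimensional ℝ V'] in
lemma tensorialAt_hessian {F : N → P} (hF : ContMDiff I I' ∞ F) (x : N) (v w : TangentSpace I x) :
    TensorialAt I' (V' →L[ℝ] ℝ) (V := fun y : P => TangentSpace I' y →L[ℝ] ℝ)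
      (fun θ => D.onForm (pullbackForm F θ) x v w
        - D'.onForm θ (F x) (mfderiv I I' F x v) (mfderiv I I' F x w)) (F x) where
  smul {f θ} hf hθ := by
    have hFx : MDifferentiableAt I I' F x := hF.mdifferentiableAt (by simp)
    have h1 := formDifferentiableAt_pullbackForm hF hθ _
      (FiberBundle.mdifferentiableAt_extend I V w)
    have h2 := formDifferentiableAt_of_mdifferentiableAt hθ _
      (FiberBundle.mdifferentiableAt_extend I' V' (mfderiv I I' F x w))
    have e1 : (fun y => pullbackForm (I := I) F (f • θ) y (FiberBundle.extend V w y)) =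
        (f ∘ F) * fun y => pullbackForm F θ y (FiberBundle.extend V w y) := rfl
    have e2 : (fun y => (f • θ) y (FiberBundle.extend V' (mfderiv I I' F x w) y)) =
        f * fun y => θ y (FiberBundle.extend V' (mfderiv I I' F x w) y) := rfl
    simp only [TangentConnection.onForm]
    rw [e1, e2, mvfderiv_mul hf h2, mvfderiv_mul (hf.comp x hFx) h1]
    simp only [_root_.add_apply, _root_.smul_apply, mvfderiv_comp_apply x hf hFx]
    simp [pullbackForm]
    ring
  add {θ θ'} hθ hθ' := by
    have h1 := formDifferentiableAt_pullbackForm hF hθ _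
      (FiberBundle.mdifferentiableAt_extend I V w)
    have h1' := formDifferentiableAt_pullbackForm hF hθ' _
      (FiberBundle.mdifferentiableAt_extend I V w)
    have h2 := formDifferentiableAt_of_mdifferentiableAt hθ _
      (FiberBundle.mdifferentiableAt_extend I' V' (mfderiv I I' F x w))
    have h2' := formDifferentiableAt_of_mdifferentiableAt hθ' _
      (FiberBundle.mdifferentiableAt_extend I' V' (mfderiv I I' F x w))
    have e1 : (fun y => pullbackForm (I := I) F (θ + θ') y (FiberBundle.extend V w y)) =
        (fun y => pullbackForm F θ y (FiberBundle.extend V w y)) +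
          fun y => pullbackForm F θ' y (FiberBundle.extend V w y) := rfl
    have e2 : (fun y => (θ + θ') y (FiberBundle.extend V' (mfderiv I I' F x w) y)) =
        (fun y => θ y (FiberBundle.extend V' (mfderiv I I' F x w) y)) +
        fun y => θ' y (FiberBundle.extend V' (mfderiv I I' F x w) y) := rfl
    simp only [TangentConnection.onForm]
    rw [e1, e2, mvfderiv_add h2 h2', mvfderiv_add h1 h1']
    simp [pullbackForm]
    ring

/-- By tensoriality the right-hand side depends only on the covector `θ (F x)`. It is therefore
evaluation at a vector of the finite-dimensional space `T_{F x} P`, which is written down in a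
basis. -/
lemma exists_hessian {F : N → P} (hF : ContMDiff I I' ∞ F) (x : N) :
    ∃ B : TangentSpace I x →L[ℝ] TangentSpace I x →L[ℝ] TangentSpace I' (F x),
      ∀ (θ : Π y : P, TangentSpace I' y →L[ℝ] ℝ) (_ : IsSmoothForm θ) (v w : TangentSpace I x),
        θ (F x) (B v w) = D.onForm (pullbackForm F θ) x v w
          - D'.onForm θ (F x) (mfderiv I I' F x v) (mfderiv I I' F x w) := by
  have : FiniteDimensional ℝ (TangentSpace I' (F x)) := inferInstanceAs (FiniteDimensional ℝ V')
  have : T2Space (TangentSpace I' (F x)) := inferInstanceAs (T2Space V')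
  let b : Module.Basis (Fin (Module.finrank ℝ V')) ℝ (TangentSpace I' (F x)) :=
    (Module.finBasis ℝ V' :)
  let ℓ (k) : TangentSpace I' (F x) →L[ℝ] ℝ := LinearMap.toContinuousLinearMap (b.coord k)
  have hℓ (k) : ∃ θ : Π y : P, TangentSpace I' y →L[ℝ] ℝ,
      MDifferentiableAt I' (I'.prod 𝓘(ℝ, V' →L[ℝ] ℝ))
        (fun y => TotalSpace.mk' (V' →L[ℝ] ℝ) y (θ y)) (F x) ∧ θ (F x) = ℓ k :=
    ⟨_, FiberBundle.mdifferentiableAt_extend I' (V' →L[ℝ] ℝ)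
      (V := fun y : P => TangentSpace I' y →L[ℝ] ℝ) (ℓ k), by simp⟩
  choose θ hθ hθℓ using hℓ
  have hbil (k) : IsBilinearMap ℝ (fun v w => D.onForm (pullbackForm F (θ k)) x v w
        - D'.onForm (θ k) (F x) (mfderiv I I' F x v) (mfderiv I I' F x w)) := by
    have h1 := isBilinearMap_onForm D (formDifferentiableAt_pullbackForm hF (hθ k))
    have h2 := isBilinearMap_onForm D' (formDifferentiableAt_of_mdifferentiableAt (hθ k))
    refine ⟨fun v v' w => ?_, fun c v w => ?_, fun v w w' => ?_, fun c v w => ?_⟩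
    · simp only [map_add, h1.add_left, h2.add_left]; abel
    · simp only [map_smul, h1.smul_left, h2.smul_left, smul_sub]
    · simp only [map_add, h1.add_right, h2.add_right]; abel
    · simp only [map_smul, h1.smul_right, h2.smul_right, smul_sub]
  refine ⟨tangentBilin (f := fun v w => ∑ k, (D.onForm (pullbackForm F (θ k)) x v w
        - D'.onForm (θ k) (F x) (mfderiv I I' F x v) (mfderiv I I' F x w)) • b k) ?_, ?_⟩
  · refine ⟨fun v v' w => ?_, fun c v w => ?_, fun v w w' => ?_, fun c v w => ?_⟩
    · simp only [(hbil _).add_left, add_smul, Finset.sum_add_distrib]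
    · simp only [(hbil _).smul_left, smul_assoc, Finset.smul_sum]
    · simp only [(hbil _).add_right, add_smul, Finset.sum_add_distrib]
    · simp only [(hbil _).smul_right, smul_assoc, Finset.smul_sum]
  · intro η hη v w
    have hΦ := tensorialAt_hessian D D' hF x v w
    -- Expanding the covector in the dual basis, `mkHom` replaces `η` by the chosen local extensions
    -- `θ k`, for which the identity is the definition of the bilinear map.
    have hη' : η (F x) = ∑ k, η (F x) (b k) • ℓ k := by
      ext u
      conv_lhs => rw [← b.sum_repr u]
      simp only [map_sum, map_smul, _root_.sum_apply, _root_.smul_apply, smul_eq_mul]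
      exact Finset.sum_congr rfl fun k _ => mul_comm _ _
    rw [← hΦ.mkHom_apply (hη.mdifferentiableAt _), hη', map_sum]
    change (∑ k, η (F x) (b k) • ℓ k) (∑ k, _ • b k) = _
    rw [← hη', map_sum]
    refine Finset.sum_congr rfl fun k _ => ?_
    rw [map_smul, map_smul, ← hθℓ, hΦ.mkHom_apply (hθ k), smul_eq_mul, smul_eq_mul, mul_comm]

/-- The second fundamental form `∇(dF)` of a map `F` between manifolds with connections. -/
def hessian {F : N → P} (hF : ContMDiff I I' ∞ F) : TensorAlong I N I' F :=
  fun x => (exists_hessian D D' hF x).choose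

lemma hessian_spec {F : N → P} (hF : ContMDiff I I' ∞ F) {θ : Π y : P, TangentSpace I' y →L[ℝ] ℝ}
    (hθ : IsSmoothForm θ) (x : N) (v w : TangentSpace I x) :
    θ (F x) (hessian D D' hF x v w) = D.onForm (pullbackForm F θ) x v w
      - D'.onForm θ (F x) (mfderiv I I' F x v) (mfderiv I I' F x w) :=
  (exists_hessian D D' hF x).choose_spec θ hθ v w

end Hessian

/-! ### Calculus of second derivatives: related fields, chain rule, change of connection. -/

section HessianCalculus

variable {V : Type*} [NormedAddCommGroup V] [NormedSpace ℝ V] [FiniteDimensional ℝ V]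
  {H : Type*} [TopologicalSpace H] {I : ModelWithCorners ℝ V H}
  {N : Type*} [TopologicalSpace N] [ChartedSpace H N] [IsManifold I ∞ N] [T2Space N]
  {V' : Type*} [NormedAddCommGroup V'] [NormedSpace ℝ V'] [FiniteDimensional ℝ V']
  {H' : Type*} [TopologicalSpace H'] {I' : ModelWithCorners ℝ V' H'}
  {P : Type*} [TopologicalSpace P] [ChartedSpace H' P] [IsManifold I' ∞ P] [T2Space P]
  {V'' : Type*} [NormedAddCommGroup V''] [NormedSpace ℝ V''] [FiniteDimensional ℝ V'']
  {H'' : Type*} [TopologicalSpace H''] {I'' : ModelWithCorners ℝ V'' H''}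
  {Q : Type*} [TopologicalSpace Q] [ChartedSpace H'' Q] [IsManifold I'' ∞ Q] [T2Space Q]
  (D D₁ : TangentConnection I N) (D' : TangentConnection I' P) (D'' : TangentConnection I'' Q)
  {F : N → P} (hF : ContMDiff I I' ∞ F) {K : P → Q} (hK : ContMDiff I' I'' ∞ K)

/-- Since `(F^*θ)(X₂) = θ(Y₂) ∘ F`, the derivatives of functions in the two covariant derivatives
agree, and only the connection terms remain. -/
lemma hessian_of_fieldsRelated {X₁ X₂ : Π x : N, TangentSpace I x} {Y₁ Y₂ : Π y : P, TangentSpace I' y}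
    (hX₂ : IsSmoothField X₂) (hY₂ : IsSmoothField Y₂)
    (h₁ : FieldsRelated F X₁ Y₁) (h₂ : FieldsRelated F X₂ Y₂) (x : N) :
    hessian D D' hF x (X₁ x) (X₂ x) =
      D'.cov Y₂ (F x) (Y₁ (F x)) - mfderiv I I' F x (D.cov X₂ x (X₁ x)) := by
  refine ext_of_forms fun θ hθ => ?_
  have e : (fun y => pullbackForm (I := I) F θ y (X₂ y)) = (fun y => θ y (Y₂ y)) ∘ F := by
    funext y
    simp only [pullbackForm, ContinuousLinearMap.comp_apply, Function.comp, h₂ y]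
  rw [hessian_spec D D' hF hθ, D.onForm_apply ((hθ.pullback hF).formDifferentiableAt x) _
    (hX₂.mdifferentiableAt x), h₁ x, h₂ x, D'.onForm_apply (hθ.formDifferentiableAt _) _
    (hY₂.mdifferentiableAt _), e, mvfderiv_comp_apply x ((hθ.apply hY₂).mdifferentiableAt (by simp))
    (hF.mdifferentiableAt (by simp)), h₁ x, map_sub]
  simp only [pullbackForm, ContinuousLinearMap.comp_apply]
  ring

lemma connectionsRelated_of_hessian_eq_zero (h : ∀ x v w, hessian D D' hF x v w = 0) :
    ConnectionsRelated F D D' := fun X₁ X₂ Y₁ Y₂ _ hX₂ _ hY₂ h₁ h₂ x => by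
  have := hessian_of_fieldsRelated D D' hF hX₂ hY₂ h₁ h₂ x
  rw [h] at this
  exact (sub_eq_zero.1 this.symm).symm

/-- Relatedness of connections says nothing where there are too few related fields, so a supply of
them through every tangent vector has to be assumed. -/
lemma hessian_eq_zero_of_connectionsRelated (hrel : ConnectionsRelated F D D')
    (hfields : ∀ (x : N) (v : TangentSpace I x), ∃ (X : Π x : N, TangentSpace I x)
      (Y : Π y : P, TangentSpace I' y), IsSmoothField X ∧ IsSmoothField Y ∧ FieldsRelated F X Y ∧
      X x = v) (x : N) (v w : TangentSpace I x) : hessian D D' hF x v w = 0 := by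
  obtain ⟨X₁, Y₁, hX₁, hY₁, h₁, rfl⟩ := hfields x v
  obtain ⟨X₂, Y₂, hX₂, hY₂, h₂, rfl⟩ := hfields x w
  rw [hessian_of_fieldsRelated D D' hF hX₂ hY₂ h₁ h₂ x, sub_eq_zero]
  exact (hrel X₁ X₂ Y₁ Y₂ hX₁ hX₂ hY₁ hY₂ h₁ h₂ x).symm

/-- For submersions, relatedness of connections is a pointwise condition. -/
lemma connectionsRelated_iff_of_submersion [SigmaCompactSpace N]
    (hF' : ∀ x, Function.Surjective (mfderiv I I' F x)) :
    ConnectionsRelated F D D' ↔ ∀ x v w, hessian D D' hF x v w = 0 := by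
  refine ⟨fun h => hessian_eq_zero_of_connectionsRelated D D' hF h fun x v => ?_,
    connectionsRelated_of_hessian_eq_zero D D' hF⟩
  obtain ⟨Y, hY, -, hYv⟩ := exists_isSmoothField (I := I') (mfderiv I I' F x v)
  obtain ⟨X, hX, hXY, hXv⟩ := exists_lift hF hF' hY hYv.symm
  exact ⟨X, Y, hX, hY, hXY, hXv⟩

lemma pullbackForm_comp {F : N → P} (hF : ContMDiff I I' ∞ F) {K : P → Q} (hK : ContMDiff I' I'' ∞ K)
    (θ : Π y : Q, TangentSpace I'' y →L[ℝ] ℝ) :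
    pullbackForm (I := I) (K ∘ F) θ = pullbackForm F (pullbackForm (I := I') K θ) := by
  funext x
  simp only [pullbackForm]
  rw [mfderiv_comp x (hK.mdifferentiableAt (by simp)) (hF.mdifferentiableAt (by simp))]
  rfl

/-- Tested on a form `θ`, this inserts and subtracts the covariant derivative of `K^*θ` on `P`,
evaluated on the images under `dF`. -/
lemma hessian_comp (x : N) (v w : TangentSpace I x) :
    hessian D D'' (hK.comp hF) x v w =
      hessian D' D'' hK (F x) (mfderiv I I' F x v) (mfderiv I I' F x w) +
        mfderiv I' I'' K (F x) (hessian D D' hF x v w) := by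
  refine ext_of_forms (I := I'') (x := K (F x)) fun θ hθ => ?_
  have h1 := hessian_spec D D'' (hK.comp hF) hθ x v w
  have h2 := hessian_spec D' D'' hK hθ (F x) (mfderiv I I' F x v) (mfderiv I I' F x w)
  have h3 := hessian_spec D D' hF (hθ.pullback hK) x v w
  rw [pullbackForm_comp hF hK, mfderiv_comp x (hK.mdifferentiableAt (by simp))
    (hF.mdifferentiableAt (by simp))] at h1
  refine h1.trans ?_
  rw [map_add, h2]
  change _ = _ + pullbackForm (I := I') K θ (F x) (hessian D D' hF x v w)
  rw [h3]
  simp only [ContinuousLinearMap.comp_apply]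
  change _ - D''.onForm θ (K (F x)) _ _ = _
  ring

lemma hessian_congr {F' : N → P} (hF' : ContMDiff I I' ∞ F') (h : F = F') (x : N)
    (v w : TangentSpace I x) :
    tangentCast (congrFun h x) (hessian D D' hF x v w) = hessian D D' hF' x v w := by
  subst h
  rfl

lemma isSmoothTensorAlong_hessian : IsSmoothTensorAlong (hessian D D' hF) := by
  intro X Y θ hX hY hθ
  have h (x) := hessian_spec D D' hF hθ x (X x) (Y x)
  simp only [h]
  exact (D.contMDiff_onForm_apply (hθ.pullback hF) hX hY).sub
    (D'.contMDiff_onForm_along hθ hF (contMDiff_mfderiv_field hF hX) (contMDiff_mfderiv_field hF hY))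

lemma form_hessian_id {θ : Π x : N, TangentSpace I x →L[ℝ] ℝ} (hθ : IsSmoothForm θ) (x : N)
    (v w : TangentSpace I x) :
    θ x (hessian D D₁ (contMDiff_id (I := I) (M := N)) x v w) =
      D.onForm θ x v w - D₁.onForm θ x v w := by
  have h := hessian_spec D D₁ (contMDiff_id (I := I) (M := N)) hθ x v w
  have e : pullbackForm (I := I) (id : N → N) θ = θ := by
    funext y
    simp only [pullbackForm, mfderiv_id]
    rfl
  rw [e, mfderiv_id] at h
  exact h

/-- This identifies the second derivative of the identity with the difference of the connections, so
that changes of connection become instances of the chain rule. -/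
lemma hessian_id_apply {Y : Π x : N, TangentSpace I x} (hY : IsSmoothField Y) (x : N)
    (v : TangentSpace I x) :
    hessian D D₁ (contMDiff_id (I := I) (M := N)) x v (Y x) = D₁.cov Y x v - D.cov Y x v := by
  obtain ⟨X, hX, -, rfl⟩ := exists_isSmoothField v
  have hrel (X : Π x : N, TangentSpace I x) : FieldsRelated (id : N → N) X X := fun x => by
    rw [mfderiv_id]; rfl
  have h := hessian_of_fieldsRelated D D₁ (contMDiff_id (I := I) (M := N)) hY hY (hrel X) (hrel Y) x
  rw [mfderiv_id] at h
  exact h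

end HessianCalculus

/-! ### Connections induced by a jointly immersive family of maps. -/

section InitialConnection

variable {V : Type*} [NormedAddCommGroup V] [NormedSpace ℝ V] [FiniteDimensional ℝ V]
  {H : Type*} [TopologicalSpace H] {I : ModelWithCorners ℝ V H}
  {N : Type*} [TopologicalSpace N] [ChartedSpace H N] [IsManifold I ∞ N] [T2Space N]
  {V' : Type*} [NormedAddCommGroup V'] [NormedSpace ℝ V'] [FiniteDimensional ℝ V']
  {H' : Type*} [TopologicalSpace H'] {I' : ModelWithCorners ℝ V' H'}
  {P : Type*} [TopologicalSpace P] [ChartedSpace H' P] [IsManifold I' ∞ P] [T2Space P]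

/-- `u` is the derivative along `v ∈ T_p N` of the vector field `dF ∘ X` along `F : N → P`. -/
def IsDerivAlong (D : TangentConnection I' P) (F : N → P) (X : Π x : N, TangentSpace I x) (p : N)
    (v : TangentSpace I p) (u : TangentSpace I' (F p)) : Prop :=
  ∀ θ : Π y : P, TangentSpace I' y →L[ℝ] ℝ, IsSmoothForm θ →
    θ (F p) u = mvfderiv I (fun y => θ (F y) (mfderiv I I' F y (X y))) p v
      - D.onForm θ (F p) (mfderiv I I' F p v) (mfderiv I I' F p (X p))

variable {D : TangentConnection I' P} {F : N → P} {X X' : Π x : N, TangentSpace I x} {p : N}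
  {v v' : TangentSpace I p} {u u' : TangentSpace I' (F p)}

lemma IsDerivAlong.unique (h : IsDerivAlong D F X p v u) (h' : IsDerivAlong D F X p v u') : u = u' :=
  ext_of_forms fun θ hθ => (h θ hθ).trans (h' θ hθ).symm

lemma IsDerivAlong.add_vector (h : IsDerivAlong D F X p v u) (h' : IsDerivAlong D F X p v' u') :
    IsDerivAlong D F X p (v + v') (u + u') := fun θ hθ => by
  rw [map_add, map_add, map_add, (isBilinearMap_onForm D (hθ.formDifferentiableAt _)).add_left,
    h θ hθ, h' θ hθ]
  ring

lemma IsDerivAlong.smul_vector (a : ℝ) (h : IsDerivAlong D F X p v u) :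
    IsDerivAlong D F X p (a • v) (a • u) := fun θ hθ => by
  rw [map_smul, map_smul, map_smul, (isBilinearMap_onForm D (hθ.formDifferentiableAt _)).smul_left,
    h θ hθ, smul_sub]

lemma mdifferentiableAt_form_mfderiv_apply (hF : ContMDiff I I' ∞ F)
    {θ : Π y : P, TangentSpace I' y →L[ℝ] ℝ}
    (hθ : MDifferentiableAt I' (I'.prod 𝓘(ℝ, V' →L[ℝ] ℝ))
      (fun y => TotalSpace.mk' (V' →L[ℝ] ℝ) y (θ y)) (F p))
    (hX : MDifferentiableAt I I.tangent (fun y => (⟨y, X y⟩ : TangentBundle I N)) p) :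
    MDifferentiableAt I 𝓘(ℝ, ℝ) (fun y => θ (F y) (mfderiv I I' F y (X y))) p :=
  formDifferentiableAt_pullbackForm hF hθ X hX

lemma IsDerivAlong.add_field (hF : ContMDiff I I' ∞ F)
    (hX : MDifferentiableAt I I.tangent (fun y => (⟨y, X y⟩ : TangentBundle I N)) p)
    (hX' : MDifferentiableAt I I.tangent (fun y => (⟨y, X' y⟩ : TangentBundle I N)) p)
    (h : IsDerivAlong D F X p v u) (h' : IsDerivAlong D F X' p v u') :
    IsDerivAlong D F (X + X') p v (u + u') := fun θ hθ => by
  have e : (fun y => θ (F y) (mfderiv I I' F y ((X + X') y))) =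
      (fun y => θ (F y) (mfderiv I I' F y (X y))) +
        fun y => θ (F y) (mfderiv I I' F y (X' y)) := by
    funext y
    simp
  rw [e, mvfderiv_add (mdifferentiableAt_form_mfderiv_apply hF (hθ.mdifferentiableAt _) hX)
    (mdifferentiableAt_form_mfderiv_apply hF (hθ.mdifferentiableAt _) hX'), Pi.add_apply, map_add,
    map_add, (isBilinearMap_onForm D (hθ.formDifferentiableAt _)).add_right, h θ hθ, h' θ hθ,
    _root_.add_apply]
  ring

lemma IsDerivAlong.smul_field (hF : ContMDiff I I' ∞ F) {f : N → ℝ}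
    (hf : MDifferentiableAt I 𝓘(ℝ, ℝ) f p)
    (hX : MDifferentiableAt I I.tangent (fun y => (⟨y, X y⟩ : TangentBundle I N)) p)
    (h : IsDerivAlong D F X p v u) :
    IsDerivAlong D F (f • X) p v (f p • u + mvfderiv I f p v • mfderiv I I' F p (X p)) :=
  fun θ hθ => by
  have e : (fun y => θ (F y) (mfderiv I I' F y ((f • X) y))) =
      f * (fun y => θ (F y) (mfderiv I I' F y (X y))) := by
    funext y
    simp
  rw [e, mvfderiv_mul hf (mdifferentiableAt_form_mfderiv_apply hF (hθ.mdifferentiableAt _) hX),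
    Pi.smul_apply', map_add, map_smul, map_smul, map_smul,
    (isBilinearMap_onForm D (hθ.formDifferentiableAt _)).smul_right, h θ hθ]
  simp only [_root_.add_apply, _root_.smul_apply, smul_eq_mul]
  ring

-- The defining expression is tensorial in `θ`, so it comes from a vector by the same duality
-- argument as in `exists_hessian`.
variable (D v) in
lemma exists_isDerivAlong (hF : ContMDiff I I' ∞ F)
    (hX : MDifferentiableAt I I.tangent (fun y => (⟨y, X y⟩ : TangentBundle I N)) p) :
    ∃ u, IsDerivAlong D F X p v u := by
  have : FiniteDimensional ℝ (TangentSpace I' (F p)) := inferInstanceAs (FiniteDimensional ℝ V')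
  have : T2Space (TangentSpace I' (F p)) := inferInstanceAs (T2Space V')
  have hΦ : TensorialAt I' (V' →L[ℝ] ℝ) (V := fun y : P => TangentSpace I' y →L[ℝ] ℝ)
      (fun θ => mvfderiv I (fun y => θ (F y) (mfderiv I I' F y (X y))) p v
      - D.onForm θ (F p) (mfderiv I I' F p v) (mfderiv I I' F p (X p))) (F p) := by
    have hFp : MDifferentiableAt I I' F p := hF.mdifferentiableAt (by simp)
    have hW := FiberBundle.mdifferentiableAt_extend I' V' (mfderiv I I' F p (X p))
    refine ⟨fun {f θ} hf hθ => ?_, fun {θ θ'} hθ hθ' => ?_⟩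
    · have e1 : (fun y => (f • θ) (F y) (mfderiv I I' F y (X y))) =
        (f ∘ F) * fun y => θ (F y) (mfderiv I I' F y (X y)) := rfl
      have e2 : (fun y => (f • θ) y (FiberBundle.extend V' (mfderiv I I' F p (X p)) y)) =
        f * fun y => θ y (FiberBundle.extend V' (mfderiv I I' F p (X p)) y) := rfl
      simp only [TangentConnection.onForm]
      rw [e1, e2, mvfderiv_mul hf (formDifferentiableAt_of_mdifferentiableAt hθ _ hW),
        mvfderiv_mul (hf.comp p hFp) (mdifferentiableAt_form_mfderiv_apply hF hθ hX)]
      simp only [_root_.add_apply, _root_.smul_apply, mvfderiv_comp_apply p hf hFp]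
      simp
      ring
    · have e1 : (fun y => (θ + θ') (F y) (mfderiv I I' F y (X y))) =
        (fun y => θ (F y) (mfderiv I I' F y (X y))) +
          fun y => θ' (F y) (mfderiv I I' F y (X y)) := rfl
      have e2 : (fun y => (θ + θ') y (FiberBundle.extend V' (mfderiv I I' F p (X p)) y)) =
        (fun y => θ y (FiberBundle.extend V' (mfderiv I I' F p (X p)) y)) +
          fun y => θ' y (FiberBundle.extend V' (mfderiv I I' F p (X p)) y) := rfl
      simp only [TangentConnection.onForm]
      rw [e1, e2, mvfderiv_add (formDifferentiableAt_of_mdifferentiableAt hθ _ hW)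
        (formDifferentiableAt_of_mdifferentiableAt hθ' _ hW),
        mvfderiv_add (mdifferentiableAt_form_mfderiv_apply hF hθ hX)
          (mdifferentiableAt_form_mfderiv_apply hF hθ' hX)]
      simp
      ring
  let b : Module.Basis (Fin (Module.finrank ℝ V')) ℝ (TangentSpace I' (F p)) :=
    (Module.finBasis ℝ V' :)
  let ℓ (k) : TangentSpace I' (F p) →L[ℝ] ℝ := LinearMap.toContinuousLinearMap (b.coord k)
  refine ⟨∑ k, hΦ.mkHom _ _ (ℓ k) • b k, fun θ hθ => ?_⟩
  have hθ' : θ (F p) = ∑ k, θ (F p) (b k) • ℓ k := by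
    ext u
    conv_lhs => rw [← b.sum_repr u]
    simp only [map_sum, map_smul, _root_.sum_apply, _root_.smul_apply, smul_eq_mul]
    exact Finset.sum_congr rfl fun k _ => mul_comm (b.coord k u) _
  rw [← hΦ.mkHom_apply (hθ.mdifferentiableAt _), map_sum]
  conv_rhs => rw [hθ', map_sum]
  exact Finset.sum_congr rfl fun k _ => by
    rw [map_smul, map_smul, smul_eq_mul, smul_eq_mul, mul_comm]

/-- A connection in `TP` lifts to `TN` along a jointly immersive family of maps `N → P` if the
derivatives of vector fields along these maps come from tangent vectors to `N`. -/
theorem exists_initial_connection {ι : Type*} [Finite ι] (D : TangentConnection I' P)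
    {c : ι → N → P} (hc : ∀ i, ContMDiff I I' ∞ (c i))
    (hinj : ∀ p (v : TangentSpace I p), (∀ i, mfderiv I I' (c i) p v = 0) → v = 0)
    (hrange : ∀ (X : Π x : N, TangentSpace I x) (p : N) (v : TangentSpace I p)
      (u : Π i, TangentSpace I' (c i p)),
      MDifferentiableAt I I.tangent (fun y => (⟨y, X y⟩ : TangentBundle I N)) p →
      (∀ i, IsDerivAlong D (c i) X p v (u i)) → ∃ w, ∀ i, mfderiv I I' (c i) p w = u i) :
    ∃ D₂ : TangentConnection I N, ∀ i p v w, hessian D₂ D (hc i) p v w = 0 := by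
  classical
  have huniq {p} {w w' : TangentSpace I p} (h : ∀ i, mfderiv I I' (c i) p w = mfderiv I I' (c i) p w') :
      w = w' := sub_eq_zero.1 (hinj p _ fun i => by rw [map_sub, h i, sub_self])
  have hex (X : Π x : N, TangentSpace I x) (p : N)
      (hX : MDifferentiableAt I I.tangent (fun y => (⟨y, X y⟩ : TangentBundle I N)) p) :
      ∃ L : TangentSpace I p →L[ℝ] TangentSpace I p,
        ∀ v i, IsDerivAlong D (c i) X p v (mfderiv I I' (c i) p (L v)) := by
    have h (v : TangentSpace I p) : ∃ w, ∀ i, IsDerivAlong D (c i) X p v (mfderiv I I' (c i) p w) := by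
      choose u hu using fun i => exists_isDerivAlong D v (hc i) hX
      obtain ⟨w, hw⟩ := hrange X p v u hX hu
      exact ⟨w, fun i => by rw [hw i]; exact hu i⟩
    choose L hL using h
    have : FiniteDimensional ℝ (TangentSpace I p) := inferInstanceAs (FiniteDimensional ℝ V)
    have : T2Space (TangentSpace I p) := inferInstanceAs (T2Space V)
    let L' : TangentSpace I p →ₗ[ℝ] TangentSpace I p :=
      { toFun := L
        map_add' := fun v v' => huniq fun i => by
          rw [map_add]
          exact (hL (v + v') i).unique ((hL v i).add_vector (hL v' i))
        map_smul' := fun a v => huniq fun i => by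
          rw [map_smul]
          exact (hL (a • v) i).unique ((hL v i).smul_vector a) }
    exact ⟨LinearMap.toContinuousLinearMap L', hL⟩
  -- The value `0` at points where the field is not differentiable is harmless: the axioms of a
  -- covariant derivative concern differentiable fields only.
  let cov (X : Π x : N, TangentSpace I x) (p : N) : TangentSpace I p →L[ℝ] TangentSpace I p :=
    if hX : MDifferentiableAt I I.tangent (fun y => (⟨y, X y⟩ : TangentBundle I N)) p
      then (hex X p hX).choose else 0
  have hcov {X : Π x : N, TangentSpace I x} {p : N}
      (hX : MDifferentiableAt I I.tangent (fun y => (⟨y, X y⟩ : TangentBundle I N)) p)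
      (v : TangentSpace I p) (i : ι) :
      IsDerivAlong D (c i) X p v (mfderiv I I' (c i) p (cov X p v)) := by
    simp only [cov, dif_pos hX]
    exact (hex X p hX).choose_spec v i
  have hcovD : IsCovariantDerivativeOn V cov Set.univ := by
    refine ⟨fun {X X' p} hX hX' _ => ?_, fun {X f p} hX hf _ => ?_⟩
    · ext v
      refine huniq fun i => ?_
      rw [_root_.add_apply, map_add]
      exact (hcov (mdifferentiableAt_add_section hX hX') v i).unique
        ((hcov hX v i).add_field (hc i) hX hX' (hcov hX' v i))
    · ext v
      refine huniq fun i => ?_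
      have h := (hcov hX v i).smul_field (hc i) hf hX
      rw [_root_.add_apply, map_add, _root_.smul_apply, map_smul, ContinuousLinearMap.smulRight_apply,
        map_smul]
      exact (hcov (hf.smul_section hX) v i).unique h
  have hsmooth {X Y : Π x : N, TangentSpace I x} (hX : IsSmoothField X) (hY : IsSmoothField Y) :
      IsSmoothField (fun p => cov Y p (X p)) := by
    intro p
    let b : Module.Basis (Fin (Module.finrank ℝ V')) ℝ V' := Module.finBasis ℝ V'
    choose θ hθ hθb using fun (i : ι) (k : Fin (Module.finrank ℝ V')) =>
      exists_isSmoothForm (I := I') (x := c i p) (LinearMap.toContinuousLinearMap (b.coord k) : V' →L[ℝ] ℝ)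
    -- Pull-backs along all `c i` of forms spanning the cotangent spaces of `P` separate `T_p N`,
    -- because the family is jointly immersive. On the new field their values are given by the
    -- defining formula of `IsDerivAlong`.
    refine contMDiffAt_field_of_forms (ι := ι × Fin (Module.finrank ℝ V'))
      (η := fun j => pullbackForm (c j.1) (θ j.1 j.2)) (fun j => (hθ _ _).pullback (hc _))
      (fun v hv => hinj p v fun i => ?_) (fun j => ?_)
    · refine b.ext_elem_iff.2 fun k => ?_
      have := hv (i, k)
      simp only [pullbackForm, hθb] at this
      exact this.trans (map_zero (b.coord k)).symm
    · have h (q) := hcov (hY.mdifferentiableAt q) (X q) j.1 _ (hθ j.1 j.2)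
      simp only [pullbackForm, ContinuousLinearMap.comp_apply, h]
      refine ((contMDiff_mvfderiv_apply (((hθ j.1 j.2).pullback (hc j.1)).apply hY) hX).sub
        (D.contMDiff_onForm_along (hθ j.1 j.2) (hc j.1) (contMDiff_mfderiv_field (hc j.1) hX)
          (contMDiff_mfderiv_field (hc j.1) hY))) p
  refine ⟨⟨⟨cov, hcovD⟩, ⟨⟨fun {Y} hY => ?_⟩⟩⟩, fun i p v w => ?_⟩
  · refine contMDiffOn_univ.2 (contMDiff_hom_section fun X hX => hsmooth hX ?_)
    exact (contMDiffOn_univ.1 hY).of_le (by simp)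
  · refine ext_of_forms fun θ hθ => ?_
    obtain ⟨Y, hY, -, rfl⟩ := exists_isSmoothField w
    rw [hessian_spec _ _ _ hθ, TangentConnection.onForm_apply _
      ((hθ.pullback (hc i)).formDifferentiableAt p) _ (hY.mdifferentiableAt p), map_zero]
    have h := hcov (hY.mdifferentiableAt p) v i θ hθ
    simp only [pullbackForm, ContinuousLinearMap.comp_apply, h]
    ring

end InitialConnection

lemma mfderiv_bijective_of_mem_maximalAtlas {E : Type*} [NormedAddCommGroup E] [NormedSpace ℝ E]
    {G : Type*} [TopologicalSpace G] [ChartedSpace E G] [IsManifold 𝓘(ℝ, E) ∞ G]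
    {e : OpenPartialHomeomorph G E} (he : e ∈ IsManifold.maximalAtlas 𝓘(ℝ, E) ∞ G) {x : G}
    (hx : x ∈ e.source) :
    MDifferentiableAt 𝓘(ℝ, E) 𝓘(ℝ, E) e x ∧ Function.Bijective (mfderiv 𝓘(ℝ, E) 𝓘(ℝ, E) e x) := by
  have h : e.MDifferentiable 𝓘(ℝ, E) 𝓘(ℝ, E) :=
    ⟨(contMDiffOn_of_mem_maximalAtlas he).mdifferentiableOn (by simp),
      (contMDiffOn_symm_of_mem_maximalAtlas he).mdifferentiableOn (by simp)⟩
  exact ⟨h.mdifferentiableAt hx, h.mfderiv_bijective hx⟩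

/-! ### Transport between tangent spaces at equal points. -/

section Transport

variable {V : Type*} [NormedAddCommGroup V] [NormedSpace ℝ V]
  {H : Type*} [TopologicalSpace H] {I : ModelWithCorners ℝ V H}
  {N : Type*} [TopologicalSpace N] [ChartedSpace H N]
  {V' : Type*} [NormedAddCommGroup V'] [NormedSpace ℝ V']
  {H' : Type*} [TopologicalSpace H'] {I' : ModelWithCorners ℝ V' H'}
  {P : Type*} [TopologicalSpace P] [ChartedSpace H' P]

lemma tangentCast_eq {x y : N} (h : x = y) (v : TangentSpace I x) :
    (tangentCast h v : V) = (v : V) := by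
  subst h
  rfl

lemma tangentCast_mfderiv {F F' : N → P} (h : F = F') (x : N) (v : TangentSpace I x) :
    tangentCast (congrFun h x) (mfderiv I I' F x v) = mfderiv I I' F' x v := by
  subst h
  rfl

end Transport

/-! ### Smooth maps into fibre products and their tangent spaces. -/

section FibreProduct

variable {E : Type*} [NormedAddCommGroup E] [NormedSpace ℝ E] [FiniteDimensional ℝ E]
  {E' : Type*} [NormedAddCommGroup E'] [NormedSpace ℝ E'] [FiniteDimensional ℝ E']
  {G : Type*} [TopologicalSpace G] [ChartedSpace E G] [IsManifold 𝓘(ℝ, E) ∞ G]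
  {M : Type*} [TopologicalSpace M] [ChartedSpace E' M] [IsManifold 𝓘(ℝ, E') ∞ M]

/-- In the charts of the normal form `f` is a surjective linear map, and charts have bijective
differentials. -/
lemma surjective_mfderiv_of_isSubmersion {f : G → M} (hf : IsSubmersion 𝓘(ℝ, E) 𝓘(ℝ, E') ∞ f) (x : G) :
    Function.Surjective (mfderiv 𝓘(ℝ, E) 𝓘(ℝ, E') f x) := by
  have h := hf.isSubmersionOfComplement_complement x
  obtain ⟨hd, hd'⟩ := mfderiv_bijective_of_mem_maximalAtlas h.domChart_mem_maximalAtlas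
    h.mem_domChart_source
  obtain ⟨hc, hc'⟩ := mfderiv_bijective_of_mem_maximalAtlas h.codChart_mem_maximalAtlas
    h.mem_codChart_source
  have hfx : MDifferentiableAt 𝓘(ℝ, E) 𝓘(ℝ, E') f x := hf.contMDiff.mdifferentiableAt (by simp)
  let L : E →L[ℝ] E' := (ContinuousLinearMap.fst ℝ E' hf.complement).comp h.equiv.toContinuousLinearMap
  have heq : (h.codChart ∘ f) =ᶠ[𝓝 x] L ∘ h.domChart := by
    filter_upwards [h.domChart.open_source.mem_nhds h.mem_domChart_source] with y hy
    have hy' : h.domChart y ∈ (h.domChart.extend 𝓘(ℝ, E)).target := by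
      simpa using! h.domChart.map_source hy
    have := h.writtenInCharts hy'
    simpa [h.domChart.left_inv hy, L] using this
  have h1 (v : TangentSpace 𝓘(ℝ, E) x) : mfderiv 𝓘(ℝ, E') 𝓘(ℝ, E') h.codChart (f x)
      (mfderiv 𝓘(ℝ, E) 𝓘(ℝ, E') f x v) = L (mfderiv 𝓘(ℝ, E) 𝓘(ℝ, E) h.domChart x v) := by
    have h2 := (L.hasMFDerivAt (x := h.domChart x)).comp x hd.hasMFDerivAt
    have h3 := (hc.hasMFDerivAt.comp x hfx.hasMFDerivAt).congr_of_eventuallyEq heq.symm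
    exact DFunLike.congr_fun (hasMFDerivAt_unique h3 h2) v
  intro w
  obtain ⟨v, hv⟩ := hd'.2 (h.equiv.symm (mfderiv 𝓘(ℝ, E') 𝓘(ℝ, E') h.codChart (f x) w, 0))
  refine ⟨v, hc'.1 ((h1 v).trans ?_)⟩
  refine (congrArg L hv).trans ?_
  exact congrArg Prod.fst (h.equiv.apply_symm_apply _)

/-- The linear splitting in the normal form is attached to a point of `G`. Without a point nothing
ties the complement to `E`, which is why the empty groupoid is treated separately in the theorem. -/
lemma finrank_complement [Nonempty G] {f : G → M} (hf : IsSubmersion 𝓘(ℝ, E) 𝓘(ℝ, E') ∞ f) :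
    FiniteDimensional ℝ hf.complement ∧
      Module.finrank ℝ hf.complement + Module.finrank ℝ E' = Module.finrank ℝ E := by
  let e := (hf.isSubmersionOfComplement_complement (Classical.arbitrary G)).equiv
  have : FiniteDimensional ℝ hf.complement :=
    Module.Finite.of_surjective ((LinearMap.snd ℝ E' hf.complement).comp e.toLinearMap)
      (Prod.snd_surjective.comp e.surjective)
  refine ⟨this, ?_⟩
  rw [e.toLinearEquiv.finrank_eq, Module.finrank_prod, add_comm]

instance [Nonempty G] {f : G → M} (hf : IsSubmersion 𝓘(ℝ, E) 𝓘(ℝ, E') ∞ f) :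
    FiniteDimensional ℝ hf.complement :=
  (finrank_complement hf).1

variable {n : ℕ} {f : Fin (n + 1) → G → M} (hf : ∀ i, IsSubmersion 𝓘(ℝ, E) 𝓘(ℝ, E') ∞ (f i))

namespace FibProd

lemma isEmbedding_coord : Topology.IsEmbedding (FibProd.coord (hf := hf)) :=
  ⟨⟨rfl⟩, fun _ _ => FibProd.ext⟩

instance [T2Space G] : T2Space (FibProd f hf) := (isEmbedding_coord hf).t2Space

instance [SecondCountableTopology G] : SecondCountableTopology (FibProd f hf) :=
  (isEmbedding_coord hf).secondCountableTopology

lemma chart_mem_maximalAtlas (p : FibProd f hf) :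
    chart hf p ∈ IsManifold.maximalAtlas 𝓘(ℝ, FibModel hf) ∞ (FibProd f hf) :=
  IsManifold.subset_maximalAtlas ⟨p, rfl⟩

lemma contMDiff_coord (i : Fin (n + 1)) :
    ContMDiff 𝓘(ℝ, FibModel hf) 𝓘(ℝ, E) ∞ (fun q : FibProd f hf => q.coord i) := by
  intro p
  have hp : p ∈ (chart hf p).source := mem_domChart hf p
  have h := ((contMDiffOn_chartInv hf p i).comp
    (contMDiffOn_of_mem_maximalAtlas (chart_mem_maximalAtlas hf p))
    (fun q hq => (chart hf p).map_source hq)).contMDiffAt ((chart hf p).open_source.mem_nhds hp)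
  refine h.congr_of_eventuallyEq ?_
  filter_upwards [(chart hf p).open_source.mem_nhds hp] with q hq
  exact (congrFun (chartInv_chartFun hf p hq) i).symm

/-- A map into a fibre product is smooth if its components are. -/
lemma contMDiff_of_coord {W K Q : Type*} [NormedAddCommGroup W] [NormedSpace ℝ W]
    [TopologicalSpace K] {J : ModelWithCorners ℝ W K} [TopologicalSpace Q] [ChartedSpace K Q]
    {g : Q → FibProd f hf} (hg : ∀ i, ContMDiff J 𝓘(ℝ, E) ∞ (fun q => (g q).coord i)) :
    ContMDiff J 𝓘(ℝ, FibModel hf) ∞ g := by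
  have hgc : Continuous g := (isEmbedding_coord hf).isInducing.continuous_iff.2
    (continuous_pi fun i => (hg i).continuous)
  intro q
  set p := g q with hp
  have hps : p ∈ (chart hf p).source := mem_domChart hf p
  have hd (i) : ContMDiffAt J 𝓘(ℝ, E) ∞ (fun r => domChart hf p i ((g r).coord i)) q :=
    ((contMDiffOn_of_mem_maximalAtlas (normalForm hf p i).domChart_mem_maximalAtlas).contMDiffAt
      ((domChart hf p i).open_source.mem_nhds (mem_domChart hf p i))).comp q (hg i q)
  have h1 : ContMDiffAt J 𝓘(ℝ, FibModel hf) ∞ (fun r => chart hf p (g r)) q :=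
    (hd 0).prodMk_space (contMDiffAt_pi_space.2 fun i =>
      (contDiff_snd.comp (splitting hf p i.succ).contDiff).contMDiff.contMDiffAt.comp q (hd i.succ))
  have h2 := ((contMDiffOn_symm_of_mem_maximalAtlas (chart_mem_maximalAtlas hf p)).contMDiffAt
    ((chart hf p).open_target.mem_nhds ((chart hf p).map_source hps))).comp q h1
  refine h2.congr_of_eventuallyEq ?_
  filter_upwards [hgc.continuousAt.eventually ((chart hf p).open_source.mem_nhds hps)] with r hr
  exact ((chart hf p).left_inv hr).symm

/-- Each component of the chart around `p` is a linear map of the chart coordinates of a single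
arrow. If all component differentials kill `v`, so does the differential of the chart, which is
injective. -/
lemma eq_zero_of_mfderiv_coord {p : FibProd f hf} {v : TangentSpace 𝓘(ℝ, FibModel hf) p}
    (hv : ∀ i, mfderiv 𝓘(ℝ, FibModel hf) 𝓘(ℝ, E) (fun q : FibProd f hf => q.coord i) p v = 0) :
    v = 0 := by
  obtain ⟨hc, hc'⟩ := mfderiv_bijective_of_mem_maximalAtlas (chart_mem_maximalAtlas hf p)
    (mem_domChart hf p)
  have hd (i) := (mfderiv_bijective_of_mem_maximalAtlas
    (normalForm hf p i).domChart_mem_maximalAtlas (mem_domChart hf p i)).1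
  have hcoord (i) : MDifferentiableAt 𝓘(ℝ, FibModel hf) 𝓘(ℝ, E) (fun q : FibProd f hf => q.coord i) p :=
    (contMDiff_coord hf i).mdifferentiableAt (by simp)
  have hL {F : Type _} [NormedAddCommGroup F] [NormedSpace ℝ F] (L : FibModel hf →L[ℝ] F)
      (i : Fin (n + 1)) (T : E →L[ℝ] F)
      (hT : ∀ q : FibProd f hf, L (chart hf p q) = T (domChart hf p i (q.coord i))) :
      L (mfderiv 𝓘(ℝ, FibModel hf) 𝓘(ℝ, FibModel hf) (chart hf p) p v) = 0 := by
    have h1 := (L.hasMFDerivAt (x := chart hf p p)).comp p hc.hasMFDerivAt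
    have h2 := (T.hasMFDerivAt (x := domChart hf p i (p.coord i))).comp p
      ((hd i).hasMFDerivAt.comp p (hcoord i).hasMFDerivAt)
    have h3 := DFunLike.congr_fun (hasMFDerivAt_unique
      (h1.congr_of_eventuallyEq (.of_forall fun q => (hT q).symm)) h2) v
    refine h3.trans ?_
    change T (mfderiv 𝓘(ℝ, E) 𝓘(ℝ, E) (domChart hf p i) (p.coord i) (mfderiv 𝓘(ℝ, FibModel hf) 𝓘(ℝ, E)
      (fun q : FibProd f hf => q.coord i) p v)) = 0
    rw [hv i, map_zero]
    exact map_zero T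
  refine hc'.1 ((?_ : _ = (0 : FibModel hf)).trans (map_zero _).symm)
  refine Prod.ext ?_ (funext fun i => ?_)
  · exact hL (ContinuousLinearMap.fst ℝ _ _) 0 (.id ℝ _) fun q => rfl
  · exact hL ((ContinuousLinearMap.proj i).comp (ContinuousLinearMap.snd ℝ _ _)) i.succ
      ((ContinuousLinearMap.snd ℝ _ _).comp (splitting hf p i.succ).toContinuousLinearMap) fun q => rfl

lemma mfderiv_compat (p : FibProd f hf) (v : TangentSpace 𝓘(ℝ, FibModel hf) p) (i : Fin (n + 1)) :
    tangentCast (p.compat i) (mfderiv 𝓘(ℝ, E) 𝓘(ℝ, E') (f i) (p.coord i)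
      (mfderiv 𝓘(ℝ, FibModel hf) 𝓘(ℝ, E) (fun q : FibProd f hf => q.coord i) p v)) =
    mfderiv 𝓘(ℝ, E) 𝓘(ℝ, E') (f 0) (p.coord 0)
      (mfderiv 𝓘(ℝ, FibModel hf) 𝓘(ℝ, E) (fun q : FibProd f hf => q.coord 0) p v) := by
  have h (j : Fin (n + 1)) := mfderiv_comp_apply (I := 𝓘(ℝ, FibModel hf)) p
    ((contMDiff_map hf j).mdifferentiableAt (x := p.coord j) (by simp))
    ((contMDiff_coord hf j).mdifferentiableAt (x := p) (by simp)) v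
  rw [← h, ← h]
  exact tangentCast_mfderiv (funext fun q : FibProd f hf => q.compat i) p v

/-- Tangent vectors to a fibre product are the tuples of tangent vectors with the same projection. -/
lemma exists_tangent_of_tuple (p : FibProd f hf) (u : Π i, TangentSpace 𝓘(ℝ, E) (p.coord i))
    (hu : ∀ i, tangentCast (p.compat i) (mfderiv 𝓘(ℝ, E) 𝓘(ℝ, E') (f i) (p.coord i) (u i)) =
      mfderiv 𝓘(ℝ, E) 𝓘(ℝ, E') (f 0) (p.coord 0) (u 0)) :
    ∃ v : TangentSpace 𝓘(ℝ, FibModel hf) p,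
      ∀ i, mfderiv 𝓘(ℝ, FibModel hf) 𝓘(ℝ, E) (fun q : FibProd f hf => q.coord i) p v = u i := by
  have : Nonempty G := ⟨p.coord 0⟩
  let a (i : Fin (n + 1)) : E →ₗ[ℝ] E' :=
    (mfderiv 𝓘(ℝ, E) 𝓘(ℝ, E') (f i) (p.coord i) : E →L[ℝ] E').toLinearMap
  let Φ : (Fin (n + 1) → E) →ₗ[ℝ] (Fin n → E') := LinearMap.pi fun i =>
    a i.succ ∘ₗ LinearMap.proj i.succ - a 0 ∘ₗ LinearMap.proj 0
  let T : FibModel hf →ₗ[ℝ] (Fin (n + 1) → E) := LinearMap.pi fun i =>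
    (mfderiv 𝓘(ℝ, FibModel hf) 𝓘(ℝ, E) (fun q : FibProd f hf => q.coord i) p :
      FibModel hf →L[ℝ] E).toLinearMap
  have hΦ : Function.Surjective Φ := fun w => by
    choose u' hu' using fun i : Fin n => surjective_mfderiv_of_isSubmersion (hf i.succ) (p.coord i.succ) (w i)
    refine ⟨Fin.cons 0 u', funext fun i => ?_⟩
    change a i.succ (u' i) - a 0 0 = w i
    rw [map_zero, sub_zero]
    exact hu' i
  have hT : Function.Injective T := (injective_iff_map_eq_zero T).2 fun v hv =>
    eq_zero_of_mfderiv_coord hf fun i => congrFun hv i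
  have hle : LinearMap.range T ≤ LinearMap.ker Φ := by
    rintro _ ⟨v, rfl⟩
    refine LinearMap.mem_ker.2 (funext fun i => sub_eq_zero.2 ?_)
    exact (tangentCast_eq (p.compat i.succ) _).symm.trans (mfderiv_compat hf p v i.succ)
  -- Both dimensions are `(n + 1) dim E - n dim E'`: the kernel because `Φ` is surjective, the range
  -- because `T` is injective and each complement has dimension `dim E - dim E'`.
  have hrank : Module.finrank ℝ (LinearMap.range T) = Module.finrank ℝ (LinearMap.ker Φ) := by
    have h1 := LinearMap.finrank_range_add_finrank_ker Φ
    rw [LinearMap.range_eq_top.2 hΦ, finrank_top, Module.finrank_pi_fintype,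
      Module.finrank_pi_fintype] at h1
    have h2 : ∑ i : Fin n, (Module.finrank ℝ (hf i.succ).complement + Module.finrank ℝ E') =
        ∑ _i : Fin n, Module.finrank ℝ E := Finset.sum_congr rfl fun i _ =>
      (finrank_complement (hf i.succ)).2
    rw [LinearMap.finrank_range_of_inj hT, Module.finrank_prod, Module.finrank_pi_fintype]
    simp only [Finset.sum_add_distrib, Finset.sum_const, Finset.card_univ, Fintype.card_fin,
      smul_eq_mul, add_mul, one_mul] at h1 h2
    omega
  let u' : Fin (n + 1) → E := u
  have hu' : u' ∈ LinearMap.range T := by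
    rw [Submodule.eq_of_le_of_finrank_eq hle hrank]
    refine LinearMap.mem_ker.2 (funext fun i => sub_eq_zero.2 ?_)
    exact (tangentCast_eq (p.compat i.succ) _).symm.trans (hu i.succ)
  obtain ⟨v, hv⟩ := hu'
  exact ⟨v, fun i => congrFun hv i⟩

end FibProd

end FibreProduct

section Transport

variable {V : Type*} [NormedAddCommGroup V] [NormedSpace ℝ V]
  {H : Type*} [TopologicalSpace H] {I : ModelWithCorners ℝ V H}
  {N : Type*} [TopologicalSpace N] [ChartedSpace H N] {x y : N} (h : x = y)

lemma tangentCast_field (X : Π x : N, TangentSpace I x) : tangentCast h (X x) = X y := by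
  subst h
  rfl

lemma eq_field_of_tangentCast {X : Π x : N, TangentSpace I x} {v : TangentSpace I x}
    (hv : tangentCast h v = X y) : v = X x := by
  subst h
  exact hv

lemma form_tangentCast (θ : Π x : N, TangentSpace I x →L[ℝ] ℝ) (v : TangentSpace I x) :
    θ y (tangentCast h v) = θ x v := by
  subst h
  rfl

lemma onForm_tangentCast [IsManifold I ∞ N] (D : TangentConnection I N)
    (θ : Π x : N, TangentSpace I x →L[ℝ] ℝ) (v w : TangentSpace I x) :
    D.onForm θ y (tangentCast h v) (tangentCast h w) = D.onForm θ x v w := by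
  subst h
  rfl

end Transport

/-! ### Product connections and their restrictions to fibre products. -/

section FibreProduct

variable {E : Type*} [NormedAddCommGroup E] [NormedSpace ℝ E] [FiniteDimensional ℝ E]
  {E' : Type*} [NormedAddCommGroup E'] [NormedSpace ℝ E'] [FiniteDimensional ℝ E']
  {G : Type*} [TopologicalSpace G] [ChartedSpace E G] [IsManifold 𝓘(ℝ, E) ∞ G] [T2Space G] [Nonempty G]
  {M : Type*} [TopologicalSpace M] [ChartedSpace E' M] [IsManifold 𝓘(ℝ, E') ∞ M] [T2Space M]
  (D : TangentConnection 𝓘(ℝ, E) G) (DM : TangentConnection 𝓘(ℝ, E') M)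

namespace FibProd

variable {n : ℕ} {f : Fin (n + 1) → G → M} (hf : ∀ i, IsSubmersion 𝓘(ℝ, E) 𝓘(ℝ, E') ∞ (f i))

/-- The product of connections which are projectable to one connection restricts to fibre products. -/
lemma exists_connection (hD : ∀ i x v w, hessian D DM (contMDiff_map hf i) x v w = 0) :
    ∃ D₂ : TangentConnection 𝓘(ℝ, FibModel hf) (FibProd f hf),
      ∀ i p v w, hessian D₂ D (contMDiff_coord hf i) p v w = 0 := by
  refine exists_initial_connection D (contMDiff_coord hf)
    (fun p v hv => eq_zero_of_mfderiv_coord hf hv) fun X p v u hX hu => ?_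
  refine exists_tangent_of_tuple hf p u fun i => ext_of_forms (I := 𝓘(ℝ, E')) fun α hα => ?_
  -- The right-hand side does not involve `j`. As `f j` has zero second derivative, the covariant
  -- derivative of `(f j)^*α` is pulled back from `M`, and all components of `X` have the same
  -- projection to `M`.
  have key (j : Fin (n + 1)) : α (f j (p.coord j)) (mfderiv 𝓘(ℝ, E) 𝓘(ℝ, E') (f j) (p.coord j) (u j)) =
      mvfderiv 𝓘(ℝ, FibModel hf) (fun q : FibProd f hf => α (f 0 (q.coord 0))
        (mfderiv 𝓘(ℝ, E) 𝓘(ℝ, E') (f 0) (q.coord 0) (mfderiv 𝓘(ℝ, FibModel hf) 𝓘(ℝ, E)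
          (fun q : FibProd f hf => q.coord 0) q (X q)))) p v -
      DM.onForm α (f 0 (p.coord 0))
        (mfderiv 𝓘(ℝ, E) 𝓘(ℝ, E') (f 0) (p.coord 0) (mfderiv 𝓘(ℝ, FibModel hf) 𝓘(ℝ, E)
          (fun q : FibProd f hf => q.coord 0) p v))
        (mfderiv 𝓘(ℝ, E) 𝓘(ℝ, E') (f 0) (p.coord 0) (mfderiv 𝓘(ℝ, FibModel hf) 𝓘(ℝ, E)
          (fun q : FibProd f hf => q.coord 0) p (X p))) := by
    have h1 := hu j _ (hα.pullback (contMDiff_map hf j))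
    have h2 := hessian_spec D DM (contMDiff_map hf j) hα (p.coord j)
      (mfderiv 𝓘(ℝ, FibModel hf) 𝓘(ℝ, E) (fun q : FibProd f hf => q.coord j) p v)
      (mfderiv 𝓘(ℝ, FibModel hf) 𝓘(ℝ, E) (fun q : FibProd f hf => q.coord j) p (X p))
    rw [hD, map_zero] at h2
    rw [show D.onForm (pullbackForm (f j) α) (p.coord j) _ _ = _ from sub_eq_zero.1 h2.symm] at h1
    simp only [← mfderiv_compat hf _ _ j, onForm_tangentCast, form_tangentCast]
    exact h1
  rw [form_tangentCast, key, key]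

/-- Tuples of vector fields with the same projection define a vector field on the fibre product. -/
lemma exists_field {Y : Π _ : Fin (n + 1), Π g : G, TangentSpace 𝓘(ℝ, E) g}
    {W : Π x : M, TangentSpace 𝓘(ℝ, E') x} (hY : ∀ i, IsSmoothField (Y i))
    (hW : ∀ i, FieldsRelated (f i) (Y i) W) :
    ∃ X : Π p : FibProd f hf, TangentSpace 𝓘(ℝ, FibModel hf) p, IsSmoothField X ∧
      ∀ i, FieldsRelated (fun q : FibProd f hf => q.coord i) X (Y i) := by
  have h (p : FibProd f hf) := exists_tangent_of_tuple hf p (fun i => Y i (p.coord i)) fun i => by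
    rw [hW, hW, tangentCast_field]
  choose X hX using h
  refine ⟨X, fun p => ?_, fun i p => hX p i⟩
  let b : Module.Basis (Fin (Module.finrank ℝ E)) ℝ E := Module.finBasis ℝ E
  choose θ hθ hθb using fun (i : Fin (n + 1)) (k : Fin (Module.finrank ℝ E)) =>
    exists_isSmoothForm (I := 𝓘(ℝ, E)) (x := p.coord i)
      (LinearMap.toContinuousLinearMap (b.coord k) : E →L[ℝ] ℝ)
  refine contMDiffAt_field_of_forms (ι := Fin (n + 1) × Fin (Module.finrank ℝ E))
    (η := fun j => pullbackForm (fun q : FibProd f hf => q.coord j.1) (θ j.1 j.2))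
    (fun j => (hθ _ _).pullback (contMDiff_coord hf _))
    (fun v hv => eq_zero_of_mfderiv_coord hf fun i => ?_) (fun j => ?_)
  · refine b.ext_elem_iff.2 fun k => ?_
    have := hv (i, k)
    simp only [pullbackForm, hθb] at this
    exact this.trans (map_zero (b.coord k)).symm
  · simp only [pullbackForm, ContinuousLinearMap.comp_apply, hX]
    exact (((hθ j.1 j.2).apply (hY j.1)).comp (contMDiff_coord hf j.1)) p

variable {hf} in
/-- Maps into a fibre product have the second derivative given by the ones of the components. -/
lemma mfderiv_coord_hessian {W K Q : Type*} [NormedAddCommGroup W] [NormedSpace ℝ W]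
    [FiniteDimensional ℝ W] [TopologicalSpace K] {J : ModelWithCorners ℝ W K} [TopologicalSpace Q]
    [ChartedSpace K Q] [IsManifold J ∞ Q] [T2Space Q] (DQ : TangentConnection J Q)
    {D₂ : TangentConnection 𝓘(ℝ, FibModel hf) (FibProd f hf)}
    (hD₂ : ∀ i p v w, hessian D₂ D (contMDiff_coord hf i) p v w = 0) {F : Q → FibProd f hf}
    (hF : ContMDiff J 𝓘(ℝ, FibModel hf) ∞ F) (i : Fin (n + 1)) (q : Q) (v w : TangentSpace J q) :
    mfderiv 𝓘(ℝ, FibModel hf) 𝓘(ℝ, E) (fun r : FibProd f hf => r.coord i) (F q)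
      (hessian DQ D₂ hF q v w) = hessian DQ D ((contMDiff_coord hf i).comp hF) q v w := by
  rw [hessian_comp DQ D₂ D hF (contMDiff_coord hf i), hD₂]
  exact (zero_add _).symm

/-- A restricted product connection is unique. -/
lemma onForm_unique {D₂ D₂' : TangentConnection 𝓘(ℝ, FibModel hf) (FibProd f hf)}
    (hD₂ : ∀ i p v w, hessian D₂ D (contMDiff_coord hf i) p v w = 0)
    (hD₂' : ∀ i p v w, hessian D₂' D (contMDiff_coord hf i) p v w = 0)
    {θ : Π p : FibProd f hf, TangentSpace 𝓘(ℝ, FibModel hf) p →L[ℝ] ℝ} (hθ : IsSmoothForm θ)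
    (p : FibProd f hf) (v w : TangentSpace 𝓘(ℝ, FibModel hf) p) :
    D₂.onForm θ p v w = D₂'.onForm θ p v w := by
  have h : hessian D₂ D₂' (contMDiff_id (I := 𝓘(ℝ, FibModel hf)) (M := FibProd f hf)) p v w = 0 :=
    eq_zero_of_mfderiv_coord hf fun i =>
      (mfderiv_coord_hessian D D₂ hD₂' contMDiff_id i p v w).trans (hD₂ i p v w)
  have h1 := form_hessian_id D₂ D₂' hθ p v w
  rw [h, map_zero] at h1
  exact (sub_eq_zero.1 h1.symm)

end FibProd

/-- The two projections of `G × G` are jointly immersive, and every pair of vectors comes from a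
tangent vector to `G × G`, so `exists_initial_connection` applies without further conditions. -/
lemma exists_product_connection : ∃ Dprod : TangentConnection (𝓘(ℝ, E).prod 𝓘(ℝ, E)) (G × G),
    (∀ p v w, hessian Dprod D (contMDiff_fst (I := 𝓘(ℝ, E)) (J := 𝓘(ℝ, E))) p v w = 0) ∧
    ∀ p v w, hessian Dprod D (contMDiff_snd (I := 𝓘(ℝ, E)) (J := 𝓘(ℝ, E))) p v w = 0 := by
  let c (i : Bool) (p : G × G) : G := if i then p.1 else p.2
  have hc : ∀ i, ContMDiff (𝓘(ℝ, E).prod 𝓘(ℝ, E)) 𝓘(ℝ, E) ∞ (c i) :=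
    Bool.forall_bool.2 ⟨contMDiff_snd, contMDiff_fst⟩
  have hd₁ (p) : mfderiv (𝓘(ℝ, E).prod 𝓘(ℝ, E)) 𝓘(ℝ, E) (c true) p = ContinuousLinearMap.fst ℝ E E :=
    mfderiv_fst
  have hd₂ (p) : mfderiv (𝓘(ℝ, E).prod 𝓘(ℝ, E)) 𝓘(ℝ, E) (c false) p = ContinuousLinearMap.snd ℝ E E :=
    mfderiv_snd
  suffices ∃ Dprod : TangentConnection (𝓘(ℝ, E).prod 𝓘(ℝ, E)) (G × G),
      ∀ i p v w, hessian Dprod D (hc i) p v w = 0 from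
    this.imp fun _ h => ⟨h true, h false⟩
  refine exists_initial_connection D hc (fun p v hv => ?_) fun X p v u hX hu => ?_
  · exact Prod.ext ((DFunLike.congr_fun (hd₁ p) v).symm.trans (hv true))
      ((DFunLike.congr_fun (hd₂ p) v).symm.trans (hv false))
  · exact ⟨(u true, u false), Bool.forall_bool.2
      ⟨DFunLike.congr_fun (hd₂ p) (u true, u false), DFunLike.congr_fun (hd₁ p) (u true, u false)⟩⟩

variable [SecondCountableTopology G] {f : Fin 2 → G → M}
  (hf : ∀ i, IsSubmersion 𝓘(ℝ, E) 𝓘(ℝ, E') ∞ (f i))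

/-- This turns the definition by related fields into a pointwise condition. The chain rule along
`FibProd → G × G → G` passes between the two, once there are enough fields related by the inclusion.
-/
lemma isRestrictedProduct_iff (D₂ : TangentConnection 𝓘(ℝ, FibModel hf) (FibProd f hf)) :
    LieGroupoid.IsRestrictedProduct (fun p : FibProd f hf => (p.coord 0, p.coord 1)) D D₂ ↔
      ∀ i p v w, hessian D₂ D (FibProd.contMDiff_coord hf i) p v w = 0 := by
  have : LocallyCompactSpace G := Manifold.locallyCompact_of_finiteDimensional 𝓘(ℝ, E)
  let J := 𝓘(ℝ, E).prod 𝓘(ℝ, E)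
  have hj : ContMDiff 𝓘(ℝ, FibModel hf) J ∞ (fun p : FibProd f hf => (p.coord 0, p.coord 1)) :=
    (FibProd.contMDiff_coord hf 0).prodMk (FibProd.contMDiff_coord hf 1)
  have hfst : ContMDiff J 𝓘(ℝ, E) ∞ (Prod.fst : G × G → G) := contMDiff_fst
  have hsnd : ContMDiff J 𝓘(ℝ, E) ∞ (Prod.snd : G × G → G) := contMDiff_snd
  constructor
  · rintro ⟨Dprod, ⟨h1, h2⟩, h⟩
    have h1' := (connectionsRelated_iff_of_submersion Dprod D hfst
      fun x => by rw [mfderiv_fst]; exact Prod.fst_surjective).1 h1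
    have h2' := (connectionsRelated_iff_of_submersion Dprod D hsnd
      fun x => by rw [mfderiv_snd]; exact Prod.snd_surjective).1 h2
    have h' := hessian_eq_zero_of_connectionsRelated D₂ Dprod hj h fun p v => ?_
    · refine Fin.forall_fin_two.2 ⟨fun p v w => ?_, fun p v w => ?_⟩
      · refine (hessian_comp D₂ Dprod D hj hfst p v w).trans ?_
        rw [h', h1', map_zero, add_zero]
      · refine (hessian_comp D₂ Dprod D hj hsnd p v w).trans ?_
        rw [h', h2', map_zero, add_zero]
    -- Fields through `v` related by the inclusion: extend the common projection of `v` to a field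
    -- `W` on `M`, lift it along `f 0` and `f 1` with the components of `v` as prescribed values,
    -- and combine the lifts.
    · obtain ⟨W, hW, -, hWp⟩ := exists_isSmoothField (I := 𝓘(ℝ, E'))
        (mfderiv 𝓘(ℝ, E) 𝓘(ℝ, E') (f 0) (p.coord 0)
          (mfderiv 𝓘(ℝ, FibModel hf) 𝓘(ℝ, E) (fun q : FibProd f hf => q.coord 0) p v))
      have hlift (i : Fin 2) := exists_lift (FibProd.contMDiff_map hf i)
        (surjective_mfderiv_of_isSubmersion (hf i)) hW (x := p.coord i)
        (v := mfderiv 𝓘(ℝ, FibModel hf) 𝓘(ℝ, E) (fun q : FibProd f hf => q.coord i) p v)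
        (eq_field_of_tangentCast (p.compat i) ((FibProd.mfderiv_compat hf p v i).trans hWp.symm))
      choose Y hY hYW hYp using hlift
      obtain ⟨X, hX, hXY⟩ := FibProd.exists_field hf hY hYW
      refine ⟨X, fun q => (Y 0 q.1, Y 1 q.2), hX, ?_, fun q => ?_, ?_⟩
      · exact (contMDiff_equivTangentBundleProd_symm (I := 𝓘(ℝ, E)) (I' := 𝓘(ℝ, E))).comp
          (((hY 0).comp contMDiff_fst).prodMk ((hY 1).comp contMDiff_snd))
      · rw [mfderiv_prodMk ((FibProd.contMDiff_coord hf 0).mdifferentiableAt (by simp))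
          ((FibProd.contMDiff_coord hf 1).mdifferentiableAt (by simp))]
        exact Prod.ext (hXY 0 q) (hXY 1 q)
      · refine sub_eq_zero.1 (FibProd.eq_zero_of_mfderiv_coord hf fun i => ?_)
        rw [map_sub, hXY, hYp, sub_self]
  · intro h
    obtain ⟨Dprod, h1, h2⟩ := exists_product_connection D
    refine ⟨Dprod, ⟨connectionsRelated_of_hessian_eq_zero _ _ _ h1,
      connectionsRelated_of_hessian_eq_zero _ _ _ h2⟩,
      connectionsRelated_of_hessian_eq_zero _ _ hj fun p v w => ?_⟩
    have e1 := hessian_comp D₂ Dprod D hj hfst p v w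
    have e2 := hessian_comp D₂ Dprod D hj hsnd p v w
    rw [h1, zero_add] at e1
    rw [h2, zero_add] at e2
    rw [mfderiv_fst] at e1
    rw [mfderiv_snd] at e2
    exact Prod.ext (e1.symm.trans (h 0 p v w)) (e2.symm.trans (h 1 p v w))

end FibreProduct

/-! ### Surjectivity and vanishing second derivatives under composition. -/

section Transport

variable {V : Type*} [NormedAddCommGroup V] [NormedSpace ℝ V]
  {H : Type*} [TopologicalSpace H] {I : ModelWithCorners ℝ V H}
  {N : Type*} [TopologicalSpace N] [ChartedSpace H N]
  {V' : Type*} [NormedAddCommGroup V'] [NormedSpace ℝ V']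
  {H' : Type*} [TopologicalSpace H'] {I' : ModelWithCorners ℝ V' H'}
  {P : Type*} [TopologicalSpace P] [ChartedSpace H' P]

lemma surjective_mfderiv_congr {F F' : N → P} (h : F = F') {x : N}
    (hF : Function.Surjective (mfderiv I I' F x)) : Function.Surjective (mfderiv I I' F' x) := by
  subst h
  exact hF

lemma surjective_mfderiv_of_comp_eq_id {F : N → P} {F' : P → N} (hF : ContMDiff I I' ∞ F)
    (hF' : ContMDiff I' I ∞ F') (h : F ∘ F' = id) (y : P) :
    Function.Surjective (mfderiv I I' F (F' y)) := by
  have h1 := mfderiv_comp y (hF.mdifferentiableAt (by simp)) (hF'.mdifferentiableAt (by simp))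
  have h2 : Function.Surjective (mfderiv I' I' (F ∘ F') y) := surjective_mfderiv_congr h.symm (by
    rw [mfderiv_id]
    exact Function.surjective_id)
  rw [h1] at h2
  exact Function.Surjective.of_comp h2

variable [FiniteDimensional ℝ V] [IsManifold I ∞ N] [T2Space N]
  [FiniteDimensional ℝ V'] [IsManifold I' ∞ P] [T2Space P]
  {V'' : Type*} [NormedAddCommGroup V''] [NormedSpace ℝ V''] [FiniteDimensional ℝ V'']
  {H'' : Type*} [TopologicalSpace H''] {I'' : ModelWithCorners ℝ V'' H''}
  {Q : Type*} [TopologicalSpace Q] [ChartedSpace H'' Q] [IsManifold I'' ∞ Q] [T2Space Q]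
  {D : TangentConnection I N} {D' : TangentConnection I' P} {D'' : TangentConnection I'' Q}
  {F : N → P} {hF : ContMDiff I I' ∞ F} {K : P → Q} {hK : ContMDiff I' I'' ∞ K} {L : N → Q}
  {hL : ContMDiff I I'' ∞ L}

lemma hessian_congr_eq_zero_iff {F' : N → P} {hF' : ContMDiff I I' ∞ F'} (h : F = F') {x : N}
    {v w : TangentSpace I x} : hessian D D' hF x v w = 0 ↔ hessian D D' hF' x v w = 0 := by
  subst h
  rfl

/-- If `F` is a submersion with vanishing second derivative, then the one of `K` vanishes over the image
of `F` as soon as the one of `K ∘ F` does. -/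
lemma hessian_eq_zero_of_comp {x : N} (hF' : Function.Surjective (mfderiv I I' F x))
    (hF0 : ∀ v w, hessian D D' hF x v w = 0) (h : K ∘ F = L)
    (hL0 : ∀ v w, hessian D D'' hL x v w = 0) (v w : TangentSpace I' (F x)) :
    hessian D' D'' hK (F x) v w = 0 := by
  obtain ⟨v, rfl⟩ := hF' v
  obtain ⟨w, rfl⟩ := hF' w
  have h1 := hessian_comp D D' D'' hF hK x v w
  rw [(hessian_congr_eq_zero_iff h).2 (hL0 v w), hF0, map_zero, add_zero] at h1
  exact h1.symm

end Transport

section FibreProduct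

variable {E : Type*} [NormedAddCommGroup E] [NormedSpace ℝ E] [FiniteDimensional ℝ E]
  {E' : Type*} [NormedAddCommGroup E'] [NormedSpace ℝ E'] [FiniteDimensional ℝ E']
  {G : Type*} [TopologicalSpace G] [ChartedSpace E G] [IsManifold 𝓘(ℝ, E) ∞ G]
  {M : Type*} [TopologicalSpace M] [ChartedSpace E' M] [IsManifold 𝓘(ℝ, E') ∞ M]

lemma FibProd.surjective_mfderiv_coord {n : ℕ} {f : Fin (n + 1) → G → M}
    (hf : ∀ i, IsSubmersion 𝓘(ℝ, E) 𝓘(ℝ, E') ∞ (f i)) (i : Fin (n + 1)) (p : FibProd f hf) :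
    Function.Surjective
      (mfderiv 𝓘(ℝ, FibModel hf) 𝓘(ℝ, E) (fun q : FibProd f hf => q.coord i) p) := by
  intro u
  choose u' hu' using fun j : Fin (n + 1) => surjective_mfderiv_of_isSubmersion (hf j) (p.coord j)
    (mfderiv 𝓘(ℝ, E) 𝓘(ℝ, E') (f i) (p.coord i) u : E')
  have h (j : Fin (n + 1)) : (mfderiv 𝓘(ℝ, E) 𝓘(ℝ, E') (f j) (p.coord j)
      (Function.update u' i u j) : E') = mfderiv 𝓘(ℝ, E) 𝓘(ℝ, E') (f i) (p.coord i) u := by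
    rcases eq_or_ne j i with rfl | hj
    · rw [Function.update_self]
    · rw [Function.update_of_ne hj]
      exact hu' j
  obtain ⟨v, hv⟩ := exists_tangent_of_tuple hf p (Function.update u' i u) fun j =>
    (tangentCast_eq (p.compat j) _).trans ((h j).trans (h 0).symm)
  exact ⟨v, (hv i).trans (Function.update_self ..)⟩

end FibreProduct

/-! ### Division versus multiplication: the diffeomorphism between `G^[2]` and `G⁽²⁾`. -/

namespace LieGroupoid

section Algebra

variable {E E' G M : Type*}
  [NormedAddCommGroup E] [NormedSpace ℝ E] [NormedAddCommGroup E'] [NormedSpace ℝ E']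
  [TopologicalSpace G] [ChartedSpace E G] [TopologicalSpace M] [ChartedSpace E' M]
  (𝒢 : LieGroupoid E E' G M)

lemma div_mul_cancel (g h : G) (a : 𝒢.src g = 𝒢.src h) :
    𝒢.mul (𝒢.div g h a) h (𝒢.src_div g h a) = g := by
  change 𝒢.mul (𝒢.mul g (𝒢.inv h) _) h _ = g
  rw [𝒢.mul_assoc _ _ _ _ (𝒢.src_inv h), 𝒢.mul_congr _ rfl (𝒢.inv_mul h),
    𝒢.mul_congr _ rfl (congrArg 𝒢.one a.symm), 𝒢.mul_one]

lemma mul_div_cancel (g h : G) (a : 𝒢.src g = 𝒢.tgt h) :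
    𝒢.div (𝒢.mul g h a) h (𝒢.src_mul g h a) = g := by
  change 𝒢.mul (𝒢.mul g h _) (𝒢.inv h) _ = g
  rw [𝒢.mul_assoc _ _ _ a (𝒢.tgt_inv h).symm, 𝒢.mul_congr _ rfl (𝒢.mul_inv h),
    𝒢.mul_congr _ rfl (congrArg 𝒢.one a.symm), 𝒢.mul_one]

/-- The composable pair with components `g`, `h`. -/
def pair (g h : G) (a : 𝒢.src g = 𝒢.tgt h) : 𝒢.Composable where
  coord := ![g, h]
  compat := Fin.forall_fin_two.2 ⟨rfl, a.symm⟩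

/-- The map `(g, h) ↦ (g h⁻¹, h)`. -/
def toComposable (p : 𝒢.SrcPow 1) : 𝒢.Composable :=
  𝒢.pair (𝒢.divMap p) (p.coord 1) (𝒢.src_divMap p)

/-- The map `(g, h) ↦ (g h, h)`. -/
def ofComposable (q : 𝒢.Composable) : 𝒢.SrcPow 1 where
  coord := ![𝒢.mulMap q, q.coord 1]
  compat := Fin.forall_fin_two.2 ⟨rfl, (𝒢.src_mul _ _ _).symm⟩

lemma mulMap_comp_toComposable : 𝒢.mulMap ∘ 𝒢.toComposable = fun p => p.coord 0 :=
  funext fun p => 𝒢.div_mul_cancel _ _ (p.src_eq 0 1)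

lemma divMap_comp_ofComposable : 𝒢.divMap ∘ 𝒢.ofComposable = fun q => q.coord 0 :=
  funext fun _ => 𝒢.mul_div_cancel _ _ _

lemma toComposable_comp_ofComposable : 𝒢.toComposable ∘ 𝒢.ofComposable = id :=
  funext fun _ => FibProd.ext (funext (Fin.forall_fin_two.2 ⟨𝒢.mul_div_cancel _ _ _, rfl⟩))

lemma ofComposable_comp_toComposable : 𝒢.ofComposable ∘ 𝒢.toComposable = id :=
  funext fun p => FibProd.ext (funext (Fin.forall_fin_two.2
    ⟨𝒢.div_mul_cancel _ _ (p.src_eq 0 1), rfl⟩))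

/-- In the differential of a `1`-cochain, the base point of the head and the argument of the last
term thus come from the same map `G^[3] → G^[2]`. -/
lemma divPair_eq_divLast : 𝒢.divPair (n := 0) = 𝒢.divLast :=
  funext fun _ => FibProd.ext (funext (Fin.forall_fin_two.2 ⟨rfl, rfl⟩))

end Algebra

variable {E : Type*} [NormedAddCommGroup E] [NormedSpace ℝ E] [FiniteDimensional ℝ E]
  {E' : Type*} [NormedAddCommGroup E'] [NormedSpace ℝ E'] [FiniteDimensional ℝ E']
  {G : Type*} [TopologicalSpace G] [ChartedSpace E G] [IsManifold 𝓘(ℝ, E) ∞ G]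
  {M : Type*} [TopologicalSpace M] [ChartedSpace E' M] [IsManifold 𝓘(ℝ, E') ∞ M]
  (𝒢 : LieGroupoid E E' G M)

lemma contMDiff_coord {n : ℕ} (i : Fin (n + 1)) :
    ContMDiff 𝓘(ℝ, 𝒢.SrcPowModel n) 𝓘(ℝ, E) ∞ (fun p : 𝒢.SrcPow n => p.coord i) :=
  FibProd.contMDiff_coord (fun _ : Fin (n + 1) => 𝒢.src_submersion) i

lemma contMDiff_composable_coord (i : Fin 2) :
    ContMDiff 𝓘(ℝ, 𝒢.ComposableModel) 𝓘(ℝ, E) ∞ (fun p : 𝒢.Composable => p.coord i) :=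
  FibProd.contMDiff_coord (isSubmersion_pair 𝒢.src_submersion 𝒢.tgt_submersion) i

lemma contMDiff_src : ContMDiff 𝓘(ℝ, E) 𝓘(ℝ, E') ∞ 𝒢.src := 𝒢.src_submersion.contMDiff

lemma contMDiff_tgt : ContMDiff 𝓘(ℝ, E) 𝓘(ℝ, E') ∞ 𝒢.tgt := 𝒢.tgt_submersion.contMDiff

lemma contMDiff_mulMap : ContMDiff 𝓘(ℝ, 𝒢.ComposableModel) 𝓘(ℝ, E) ∞ 𝒢.mulMap := 𝒢.smooth_mul

lemma contMDiff_divMap {n : ℕ} :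
    ContMDiff 𝓘(ℝ, 𝒢.SrcPowModel (n + 1)) 𝓘(ℝ, E) ∞ (𝒢.divMap (n := n)) := by
  have h : ContMDiff 𝓘(ℝ, 𝒢.SrcPowModel (n + 1)) 𝓘(ℝ, 𝒢.ComposableModel) ∞
      (fun p : 𝒢.SrcPow (n + 1) => 𝒢.pair (p.coord 0) (𝒢.inv (p.coord 1))
        ((p.src_eq 0 1).trans (𝒢.tgt_inv _).symm)) :=
    FibProd.contMDiff_of_coord (isSubmersion_pair 𝒢.src_submersion 𝒢.tgt_submersion)
      (Fin.forall_fin_two.2 ⟨𝒢.contMDiff_coord 0, 𝒢.smooth_inv.comp (𝒢.contMDiff_coord 1)⟩)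
  exact 𝒢.contMDiff_mulMap.comp h

lemma contMDiff_face {n : ℕ} (i : Fin (n + 2)) :
    ContMDiff 𝓘(ℝ, 𝒢.SrcPowModel (n + 1)) 𝓘(ℝ, 𝒢.SrcPowModel n) ∞ (𝒢.face i) :=
  FibProd.contMDiff_of_coord _ fun _ => 𝒢.contMDiff_coord _

lemma contMDiff_divPair {n : ℕ} :
    ContMDiff 𝓘(ℝ, 𝒢.SrcPowModel (n + 2)) 𝓘(ℝ, 𝒢.SrcPowModel 1) ∞ (𝒢.divPair (n := n)) :=
  FibProd.contMDiff_of_coord _ fun _ => 𝒢.contMDiff_divMap.comp (𝒢.contMDiff_face _)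

lemma contMDiff_toComposable :
    ContMDiff 𝓘(ℝ, 𝒢.SrcPowModel 1) 𝓘(ℝ, 𝒢.ComposableModel) ∞ 𝒢.toComposable :=
  FibProd.contMDiff_of_coord (isSubmersion_pair 𝒢.src_submersion 𝒢.tgt_submersion)
    (Fin.forall_fin_two.2 ⟨𝒢.contMDiff_divMap, 𝒢.contMDiff_coord 1⟩)

lemma contMDiff_ofComposable :
    ContMDiff 𝓘(ℝ, 𝒢.ComposableModel) 𝓘(ℝ, 𝒢.SrcPowModel 1) ∞ 𝒢.ofComposable :=
  FibProd.contMDiff_of_coord _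
    (Fin.forall_fin_two.2 ⟨𝒢.contMDiff_mulMap, 𝒢.contMDiff_composable_coord 1⟩)

/-- Multiplication after `(g, h) ↦ (gh⁻¹, h)` is the first projection of `G^[2]`, which is a
submersion. -/
lemma surjective_mfderiv_mulMap (q : 𝒢.Composable) :
    Function.Surjective (mfderiv 𝓘(ℝ, 𝒢.ComposableModel) 𝓘(ℝ, E) 𝒢.mulMap q) := by
  have hq : 𝒢.toComposable (𝒢.ofComposable q) = q := congrFun 𝒢.toComposable_comp_ofComposable q
  have h := surjective_mfderiv_congr 𝒢.mulMap_comp_toComposable.symm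
    (FibProd.surjective_mfderiv_coord (fun _ => 𝒢.src_submersion) 0 (𝒢.ofComposable q))
  rw [mfderiv_comp _ (𝒢.contMDiff_mulMap.mdifferentiableAt (by simp))
    (𝒢.contMDiff_toComposable.mdifferentiableAt (by simp))] at h
  have h' : Function.Surjective (mfderiv 𝓘(ℝ, 𝒢.ComposableModel) 𝓘(ℝ, E) 𝒢.mulMap
    (𝒢.toComposable (𝒢.ofComposable q))) := Function.Surjective.of_comp h
  rwa [hq] at h'

/-- Since `tupleOfTangent` is injective, the chosen left inverse returns the actual tangent vector
on every tuple in its range. -/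
lemma tangentOfTuple_eq {n : ℕ} {p : 𝒢.SrcPow n} {u : Π i, TangentSpace 𝓘(ℝ, E) (p.coord i)}
    {v : TangentSpace 𝓘(ℝ, 𝒢.SrcPowModel n) p}
    (h : ∀ i, mfderiv 𝓘(ℝ, 𝒢.SrcPowModel n) 𝓘(ℝ, E) (fun q : 𝒢.SrcPow n => q.coord i) p v = u i) :
    𝒢.tangentOfTuple p u = v := by
  have hker : LinearMap.ker (𝒢.tupleOfTangent p) = ⊥ := LinearMap.ker_eq_bot'.2 fun v hv =>
    FibProd.eq_zero_of_mfderiv_coord _ fun i => congrFun hv i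
  have hu : u = 𝒢.tupleOfTangent p v := funext fun i => (h i).symm
  rw [hu]
  exact LinearMap.leftInverse_apply_of_inj hker v

end LieGroupoid

/-! ### The Atiyah cochain as minus the second derivative of division. -/

namespace LieGroupoid

variable {E : Type*} [NormedAddCommGroup E] [NormedSpace ℝ E] [FiniteDimensional ℝ E]
  {E' : Type*} [NormedAddCommGroup E'] [NormedSpace ℝ E'] [FiniteDimensional ℝ E']
  {G : Type*} [TopologicalSpace G] [ChartedSpace E G] [IsManifold 𝓘(ℝ, E) ∞ G] [T2Space G] [Nonempty G]
  {M : Type*} [TopologicalSpace M] [ChartedSpace E' M] [IsManifold 𝓘(ℝ, E') ∞ M] [T2Space M]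
  (𝒢 : LieGroupoid E E' G M)

/-- `D₂` is the restriction of the product connection `D × ⋯ × D` to `G^[n+1]`. -/
def IsPowerConnection (D : TangentConnection 𝓘(ℝ, E) G) {n : ℕ}
    (D₂ : TangentConnection 𝓘(ℝ, 𝒢.SrcPowModel n) (𝒢.SrcPow n)) : Prop :=
  ∀ i p v w, hessian D₂ D (𝒢.contMDiff_coord i) p v w = 0

/-- The Atiyah cochain in terms of second derivatives. -/
def atiyah (D : TangentConnection 𝓘(ℝ, E) G)
    (D₂ : TangentConnection 𝓘(ℝ, 𝒢.SrcPowModel 1) (𝒢.SrcPow 1)) : 𝒢.TensorSucc 0 :=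
  -hessian D₂ D 𝒢.contMDiff_divMap

variable {𝒢} {D D' : TangentConnection 𝓘(ℝ, E) G} {DM DM' : TangentConnection 𝓘(ℝ, E') M}

lemma atiyah_apply (D₂ : TangentConnection 𝓘(ℝ, 𝒢.SrcPowModel 1) (𝒢.SrcPow 1)) (p : 𝒢.SrcPow 1)
    (v w : TangentSpace 𝓘(ℝ, 𝒢.SrcPowModel 1) p) :
    𝒢.atiyah D D₂ p v w = -hessian D₂ D 𝒢.contMDiff_divMap p v w := rfl

lemma exists_isPowerConnection (hD : ∀ x v w, hessian D DM 𝒢.contMDiff_src x v w = 0) (n : ℕ) :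
    ∃ D₂ : TangentConnection 𝓘(ℝ, 𝒢.SrcPowModel n) (𝒢.SrcPow n), 𝒢.IsPowerConnection D D₂ :=
  FibProd.exists_connection D DM (fun _ : Fin (n + 1) => 𝒢.src_submersion) fun _ => hD

lemma IsPowerConnection.hessian_face {n : ℕ}
    {D₂ : TangentConnection 𝓘(ℝ, 𝒢.SrcPowModel n) (𝒢.SrcPow n)}
    {D₃ : TangentConnection 𝓘(ℝ, 𝒢.SrcPowModel (n + 1)) (𝒢.SrcPow (n + 1))}
    (h₂ : 𝒢.IsPowerConnection D D₂) (h₃ : 𝒢.IsPowerConnection D D₃) (i : Fin (n + 2))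
    (p : 𝒢.SrcPow (n + 1)) (v w : TangentSpace 𝓘(ℝ, 𝒢.SrcPowModel (n + 1)) p) :
    hessian D₃ D₂ (𝒢.contMDiff_face i) p v w = 0 :=
  FibProd.eq_zero_of_mfderiv_coord _ fun j =>
    (FibProd.mfderiv_coord_hessian D D₃ h₂ (𝒢.contMDiff_face i) j p v w).trans
      (h₃ (i.succAbove j) p v w)

/-- The restricted product connection is unique on smooth forms (`FibProd.onForm_unique`), so the
one hidden in `IsAtiyah` may be replaced by `D₂`; then forms separate vectors. -/
lemma IsPowerConnection.isAtiyah_iff [SecondCountableTopology G]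
    {D₂ : TangentConnection 𝓘(ℝ, 𝒢.SrcPowModel 1) (𝒢.SrcPow 1)}
    (h₂ : 𝒢.IsPowerConnection D D₂) (A : 𝒢.TensorSucc 0) :
    𝒢.IsAtiyah D A ↔ A = 𝒢.atiyah D D₂ := by
  have hA {θ : Π g : G, TangentSpace 𝓘(ℝ, E) g →L[ℝ] ℝ} (hθ : IsSmoothForm θ) (p : 𝒢.SrcPow 1)
      (v w : TangentSpace 𝓘(ℝ, 𝒢.SrcPowModel 1) p) : θ (𝒢.divMap p) (𝒢.atiyah D D₂ p v w) =
        D.onForm θ (𝒢.divMap p) (𝒢.dDivMap p v) (𝒢.dDivMap p w)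
          - D₂.onForm (pullbackForm 𝒢.divMap θ) p v w := by
    rw [atiyah_apply, map_neg, hessian_spec D₂ D 𝒢.contMDiff_divMap hθ, neg_sub]
    rfl
  constructor
  · rintro ⟨D₂', h, h'⟩
    have h₂' := (isRestrictedProduct_iff D _ D₂').1 h
    funext p
    ext v w
    refine ext_of_forms (I := 𝓘(ℝ, E)) fun θ hθ => ?_
    rw [hA hθ, h' θ hθ,
      FibProd.onForm_unique D _ h₂ h₂' (hθ.pullback 𝒢.contMDiff_divMap) p v w]
  · rintro rfl
    exact ⟨D₂, (isRestrictedProduct_iff D _ D₂).2 h₂, fun θ hθ => hA hθ⟩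

/-- The chain rule is applied to both sides of `s ∘ m̄ = t ∘ coord 0 ∘ face 0`, where `s` and `face
0` have zero second derivative. The `M`-projection is minus the second derivative of `t` on `G^[1]`.
-/
lemma IsPowerConnection.atiyah_mem_cochains (hD : ∀ x v w, hessian D DM 𝒢.contMDiff_src x v w = 0)
    {D₂ : TangentConnection 𝓘(ℝ, 𝒢.SrcPowModel 1) (𝒢.SrcPow 1)} (h₂ : 𝒢.IsPowerConnection D D₂) :
    𝒢.atiyah D D₂ ∈ 𝒢.cochains 0 := by
  obtain ⟨D₁, h₁⟩ := exists_isPowerConnection hD 0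
  have ht : ContMDiff 𝓘(ℝ, 𝒢.SrcPowModel 0) 𝓘(ℝ, E') ∞ (fun q : 𝒢.SrcPow 0 => 𝒢.tgt (q.coord 0)) :=
    𝒢.contMDiff_tgt.comp (𝒢.contMDiff_coord 0)
  have e1 : 𝒢.atiyah D D₂ = (-1 : ℝ) • hessian D₂ D 𝒢.contMDiff_divMap := (neg_one_smul ..).symm
  refine ⟨?_, (-1 : ℝ) • hessian D₁ DM ht, (isSmoothTensorAlong_hessian D₁ DM ht).smul _,
    fun p v w => ?_⟩
  · rw [e1]
    exact (isSmoothTensorAlong_hessian D₂ D 𝒢.contMDiff_divMap).smul _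
  · have h1 := hessian_comp D₂ D DM 𝒢.contMDiff_divMap 𝒢.contMDiff_src p v w
    rw [hD, zero_add] at h1
    have h2 := hessian_comp D₂ D₁ DM (𝒢.contMDiff_face 0) ht p v w
    rw [h₁.hessian_face h₂, map_zero, add_zero] at h2
    have h3 := hessian_congr D₂ DM (𝒢.contMDiff_src.comp 𝒢.contMDiff_divMap)
      (ht.comp (𝒢.contMDiff_face 0)) (funext fun p => 𝒢.src_divMap p) p v w
    rw [h1, h2] at h3
    rw [atiyah_apply, TensorAlong.smul_apply, map_neg, map_neg, neg_one_smul]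
    exact congrArg Neg.neg h3

/-- On `G^[3]`, the chain rule for `m̄ ∘ divPair = divMap` gives the last term, `m̄ ∘ face 2 =
divMap` gives the middle one, and the components `m̄ ∘ face 1`, `m̄ ∘ face 0` of `divPair` give the
head. The three contributions cancel. -/
lemma IsPowerConnection.delta_atiyah (hD : ∀ x v w, hessian D DM 𝒢.contMDiff_src x v w = 0)
    {D₂ : TangentConnection 𝓘(ℝ, 𝒢.SrcPowModel 1) (𝒢.SrcPow 1)} (h₂ : 𝒢.IsPowerConnection D D₂) :
    𝒢.delta 0 (𝒢.atiyah D D₂) = 0 := by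
  obtain ⟨D₃, h₃⟩ := exists_isPowerConnection hD 2
  funext p v w
  have hface (i : Fin 3) : hessian D₃ D (𝒢.contMDiff_divMap.comp (𝒢.contMDiff_face i)) p v w =
      - 𝒢.atiyah D D₂ (𝒢.face i p) (𝒢.dFace i p v) (𝒢.dFace i p w) := by
    rw [hessian_comp D₃ D₂ D (𝒢.contMDiff_face i) 𝒢.contMDiff_divMap, h₂.hessian_face h₃, map_zero,
      add_zero, atiyah_apply, neg_neg]
    rfl
  -- The pair in the head is tangent to `G^[2]` because it consists of the components of minus the
  -- second derivative of `divPair`.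
  have hhead : 𝒢.tangentOfTuple (𝒢.divPair p) (𝒢.deltaHead 0 (𝒢.atiyah D D₂) p v w) =
      - hessian D₃ D₂ 𝒢.contMDiff_divPair p v w := by
    refine 𝒢.tangentOfTuple_eq fun i => ?_
    rw [map_neg, FibProd.mfderiv_coord_hessian D D₃ h₂ 𝒢.contMDiff_divPair i p v w]
    exact neg_eq_iff_eq_neg.2 (hface (![1, 0] i))
  -- The map `F` is kept variable so that `divLast` can be replaced by `divPair` inside the
  -- dependent types by substitution.
  have hlast {F : 𝒢.SrcPow 2 → 𝒢.SrcPow 1} (hF : 𝒢.divPair = F) (h : 𝒢.divMap (F p) = 𝒢.divMap p) :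
      tangentCast h (𝒢.atiyah D D₂ (F p)
        (mfderiv 𝓘(ℝ, 𝒢.SrcPowModel 2) 𝓘(ℝ, 𝒢.SrcPowModel 1) F p v)
        (mfderiv 𝓘(ℝ, 𝒢.SrcPowModel 2) 𝓘(ℝ, 𝒢.SrcPowModel 1) F p w)) =
      - hessian D₃ D 𝒢.contMDiff_divMap p v w + tangentCast (𝒢.divMap_divPair p)
        (𝒢.dDivMap (𝒢.divPair p) (hessian D₃ D₂ 𝒢.contMDiff_divPair p v w)) := by
    subst hF
    have h1 := hessian_congr D₃ D (𝒢.contMDiff_divMap.comp 𝒢.contMDiff_divPair) 𝒢.contMDiff_divMap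
      (funext fun p => 𝒢.divMap_divPair p) p v w
    rw [hessian_comp D₃ D₂ D 𝒢.contMDiff_divPair 𝒢.contMDiff_divMap, map_add] at h1
    rw [← h1, atiyah_apply, map_neg]
    simp only [dDivMap]
    abel
  have e1 : tangentCast (𝒢.divMap_divPair p) (𝒢.dDivMap (𝒢.divPair p)
      (𝒢.tangentOfTuple (𝒢.divPair p) (𝒢.deltaHead 0 (𝒢.atiyah D D₂) p v w))) =
      - tangentCast (𝒢.divMap_divPair p)
        (𝒢.dDivMap (𝒢.divPair p) (hessian D₃ D₂ 𝒢.contMDiff_divPair p v w)) := by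
    rw [hhead, map_neg, map_neg]
  have e2 : tangentCast (𝒢.divMap_face (0 : Fin 1) p)
      (𝒢.atiyah D D₂ (𝒢.face (Fin.succ (Fin.succ (0 : Fin 1))) p)
        (𝒢.dFace (Fin.succ (Fin.succ (0 : Fin 1))) p v) (𝒢.dFace (Fin.succ (Fin.succ (0 : Fin 1))) p w)) =
      - hessian D₃ D 𝒢.contMDiff_divMap p v w := (neg_eq_iff_eq_neg.2 (hface 2)).symm
  have e3 := hlast 𝒢.divPair_eq_divLast (𝒢.divMap_divLast p)
  have key (a b c d h : E) (ha : a = -d) (hb : b = -h) (hc : c = -h + d) :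
      -a + (-1 : ℝ) ^ ((0 : Fin 1) : ℕ) • b + (-1 : ℝ) ^ (0 + 1) • c = 0 := by
    subst ha hb hc
    simp
  rw [delta, Fin.sum_univ_one]
  exact key _ _ _ _ _ e1 e2 e3

/-- The difference `D - D'` as a tensor. -/
def difference (D D' : TangentConnection 𝓘(ℝ, E) G) : 𝒢.Tensor₀ :=
  hessian D' D (contMDiff_id (I := 𝓘(ℝ, E)) (M := G))

/-- The source map is computed both as `s ∘ id` and as `id ∘ s`, between the connections `D'` and
`DM`; this shows that `D - D'` projects to `DM - DM'`. -/
lemma difference_mem_cochains₀ (hD : ∀ x v w, hessian D DM 𝒢.contMDiff_src x v w = 0)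
    (hD' : ∀ x v w, hessian D' DM' 𝒢.contMDiff_src x v w = 0) :
    (difference D D' : 𝒢.Tensor₀) ∈ 𝒢.cochains₀ := by
  refine ⟨isSmoothTensorAlong_hessian D' D contMDiff_id,
    hessian DM' DM (contMDiff_id (I := 𝓘(ℝ, E')) (M := M)), isSmoothTensorAlong_hessian _ _ _,
    fun g v w => ?_⟩
  have h1 := hessian_comp D' D DM (contMDiff_id (I := 𝓘(ℝ, E)) (M := G)) 𝒢.contMDiff_src g v w
  have h2 := hessian_comp D' DM' DM 𝒢.contMDiff_src (contMDiff_id (I := 𝓘(ℝ, E')) (M := M)) g v w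
  rw [hD', map_zero, add_zero] at h2
  rw [hD, zero_add] at h1
  exact h1.symm.trans h2

/-- Division, seen as a map from `D₂'` to `D`, factors as `id ∘ m̄` through `D'` and as `m̄ ∘ id`
through `D₂`. Equating the two chain rules gives the formula. -/
lemma IsPowerConnection.delta₀_difference
    {D₂ D₂' : TangentConnection 𝓘(ℝ, 𝒢.SrcPowModel 1) (𝒢.SrcPow 1)}
    (h₂ : 𝒢.IsPowerConnection D D₂) (h₂' : 𝒢.IsPowerConnection D' D₂') (p : 𝒢.SrcPow 1)
    (v w : TangentSpace 𝓘(ℝ, 𝒢.SrcPowModel 1) p) :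
    𝒢.delta₀ (difference D D') p v w = 𝒢.atiyah D' D₂' p v w - 𝒢.atiyah D D₂ p v w := by
  have hhead : 𝒢.tangentOfTuple p (𝒢.deltaHead₀ (difference D D') p v w) =
      hessian D₂' D₂ (contMDiff_id (I := 𝓘(ℝ, 𝒢.SrcPowModel 1)) (M := 𝒢.SrcPow 1)) p v w := by
    refine 𝒢.tangentOfTuple_eq fun i => ?_
    refine (FibProd.mfderiv_coord_hessian D D₂' h₂ contMDiff_id i p v w).trans ?_
    have h := hessian_comp D₂' D' D (𝒢.contMDiff_coord i) (contMDiff_id (I := 𝓘(ℝ, E)) (M := G)) p v w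
    rw [h₂' i, map_zero, add_zero] at h
    exact h
  have h1 := hessian_comp D₂' D' D 𝒢.contMDiff_divMap (contMDiff_id (I := 𝓘(ℝ, E)) (M := G)) p v w
  have h2 := hessian_comp D₂' D₂ D (contMDiff_id (I := 𝓘(ℝ, 𝒢.SrcPowModel 1)) (M := 𝒢.SrcPow 1))
    𝒢.contMDiff_divMap p v w
  rw [mfderiv_id] at h1 h2
  have h3 := h1.symm.trans h2
  rw [delta₀, hhead, atiyah_apply, atiyah_apply]
  have h4 (a b c d : E) (h : a + b = c + d) : -d + a = -b - -c := by
    rw [← sub_eq_zero] at h ⊢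
    rw [← h]
    abel
  exact h4 _ _ _ _ h3

/-- A connection is multiplicative if its Atiyah cochain vanishes. -/
lemma IsPowerConnection.isMultiplicative [SecondCountableTopology G]
    (hD : ∀ x v w, hessian D DM 𝒢.contMDiff_src x v w = 0)
    {D₂ : TangentConnection 𝓘(ℝ, 𝒢.SrcPowModel 1) (𝒢.SrcPow 1)} (h₂ : 𝒢.IsPowerConnection D D₂)
    (hA : 𝒢.atiyah D D₂ = 0) : 𝒢.IsMultiplicative D := by
  have hdiv (p v w) : hessian D₂ D 𝒢.contMDiff_divMap p v w = 0 := by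
    rw [← neg_eq_zero, ← atiyah_apply, hA]
    rfl
  have ht (g : G) (v w : TangentSpace 𝓘(ℝ, E) g) : hessian D DM 𝒢.contMDiff_tgt g v w = 0 := by
    -- Any point of `G^[2]` with second entry `g` serves here. The identity `t(h) = s(gh⁻¹)`
    -- expresses `t` after the second projection by maps with zero second derivative.
    let p : 𝒢.SrcPow 1 := ⟨fun _ => g, fun _ => rfl⟩
    refine hessian_eq_zero_of_comp (x := p) (hF := 𝒢.contMDiff_coord 1)
      (hL := 𝒢.contMDiff_src.comp 𝒢.contMDiff_divMap)
      (FibProd.surjective_mfderiv_coord (fun _ => 𝒢.src_submersion) 1 p) (h₂ 1 p)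
      (funext fun q => (𝒢.src_divMap q).symm) (fun v w => ?_) v w
    rw [hessian_comp D₂ D DM 𝒢.contMDiff_divMap 𝒢.contMDiff_src, hD, hdiv, map_zero, add_zero]
  refine ⟨⟨DM, connectionsRelated_of_hessian_eq_zero _ _ _ hD,
    connectionsRelated_of_hessian_eq_zero _ _ _ ht⟩, ?_⟩
  obtain ⟨D₂', h₂'⟩ := FibProd.exists_connection D DM
    (isSubmersion_pair 𝒢.src_submersion 𝒢.tgt_submersion) (Fin.forall_fin_two.2 ⟨hD, ht⟩)
  refine ⟨D₂', (isRestrictedProduct_iff D _ D₂').2 h₂',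
    connectionsRelated_of_hessian_eq_zero _ _ 𝒢.contMDiff_mulMap fun q => ?_⟩
  -- Both components of `toComposable`, division and the second projection, have zero second
  -- derivative, and so does `m ∘ toComposable`, the first projection. Since `toComposable` is a
  -- surjective submersion, this descends to `m`.
  have hq : 𝒢.toComposable (𝒢.ofComposable q) = q := congrFun 𝒢.toComposable_comp_ofComposable q
  rw [← hq]
  refine hessian_eq_zero_of_comp (hF := 𝒢.contMDiff_toComposable) (D := D₂)
    (hL := 𝒢.contMDiff_coord 0)
    (surjective_mfderiv_of_comp_eq_id 𝒢.contMDiff_toComposable 𝒢.contMDiff_ofComposable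
      𝒢.toComposable_comp_ofComposable q) (fun v w => ?_) 𝒢.mulMap_comp_toComposable (h₂ 0 _)
  refine FibProd.eq_zero_of_mfderiv_coord _ fun i => ?_
  rw [FibProd.mfderiv_coord_hessian D D₂ h₂' 𝒢.contMDiff_toComposable]
  revert i
  exact Fin.forall_fin_two.2 ⟨hdiv _ _ _, h₂ 1 _ _ _⟩

/-- The Atiyah cochain of a multiplicative connection vanishes. -/
lemma IsPowerConnection.atiyah_eq_zero [SecondCountableTopology G]
    {D₂ : TangentConnection 𝓘(ℝ, 𝒢.SrcPowModel 1) (𝒢.SrcPow 1)} (h₂ : 𝒢.IsPowerConnection D D₂)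
    (hD : 𝒢.IsMultiplicative D) : 𝒢.atiyah D D₂ = 0 := by
  have : LocallyCompactSpace 𝒢.Composable :=
    Manifold.locallyCompact_of_finiteDimensional 𝓘(ℝ, 𝒢.ComposableModel)
  obtain ⟨-, D₂', h, hm⟩ := hD
  have h₂' := (isRestrictedProduct_iff D _ D₂').1 h
  have hm' := (connectionsRelated_iff_of_submersion D₂' D 𝒢.contMDiff_mulMap
    𝒢.surjective_mfderiv_mulMap).1 hm
  have hdiv (p) : ∀ v w, hessian D₂ D 𝒢.contMDiff_divMap p v w = 0 := by
    -- The mirror image of the argument in `IsPowerConnection.isMultiplicative`: `ofComposable` has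
    -- components `m` and the second projection, and division after it is the first projection.
    have hp : 𝒢.ofComposable (𝒢.toComposable p) = p := congrFun 𝒢.ofComposable_comp_toComposable p
    rw [← hp]
    refine hessian_eq_zero_of_comp (hF := 𝒢.contMDiff_ofComposable) (D := D₂')
      (hL := 𝒢.contMDiff_composable_coord 0)
      (surjective_mfderiv_of_comp_eq_id 𝒢.contMDiff_ofComposable 𝒢.contMDiff_toComposable
        𝒢.ofComposable_comp_toComposable p) (fun v w => ?_) 𝒢.divMap_comp_ofComposable (h₂' 0 _)
    refine FibProd.eq_zero_of_mfderiv_coord _ fun i => ?_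
    rw [FibProd.mfderiv_coord_hessian D D₂' h₂ 𝒢.contMDiff_ofComposable]
    revert i
    exact Fin.forall_fin_two.2 ⟨hm' _ _ _, h₂' 1 _ _ _⟩
  funext p
  ext v w
  rw [atiyah_apply, hdiv, neg_zero]
  rfl

end LieGroupoid

/-! ### The affine space of connections. -/

section Connections

variable {V : Type*} [NormedAddCommGroup V] [NormedSpace ℝ V]
  {H : Type*} [TopologicalSpace H] {I : ModelWithCorners ℝ V H}
  {N : Type*} [TopologicalSpace N] [ChartedSpace H N] [IsManifold I ∞ N]

lemma nonempty_tangentConnection_of_isEmpty [IsEmpty N] : Nonempty (TangentConnection I N) :=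
  ⟨⟨⟨fun _ => isEmptyElim, ⟨fun {_ _ x} => isEmptyElim x, fun {_ _ x} => isEmptyElim x⟩⟩,
    ⟨⟨fun _ x => isEmptyElim x⟩⟩⟩⟩

variable [FiniteDimensional ℝ V] [T2Space N]

lemma isSmoothField_of_forms {u : Π x : N, TangentSpace I x}
    (hu : ∀ θ : Π x : N, TangentSpace I x →L[ℝ] ℝ, IsSmoothForm θ →
      ContMDiff I 𝓘(ℝ, ℝ) ∞ (fun x => θ x (u x))) : IsSmoothField u := by
  intro x
  let b : Module.Basis (Fin (Module.finrank ℝ V)) ℝ V := Module.finBasis ℝ V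
  choose θ hθ hθb using fun k : Fin (Module.finrank ℝ V) =>
    exists_isSmoothForm (I := I) (x := x) (LinearMap.toContinuousLinearMap (b.coord k) : V →L[ℝ] ℝ)
  refine contMDiffAt_field_of_forms hθ (fun v hv => b.ext_elem_iff.2 fun k => ?_)
    (fun k => hu _ (hθ k) x)
  have := hv k
  rw [hθb] at this
  exact this.trans (map_zero (b.coord k)).symm

/-- Connections form an affine space over the `(2,1)`-tensors. -/
lemma exists_connection_add (D : TangentConnection I N) {W : TensorAlong I N I (fun x : N => x)}
    (hW : IsSmoothTensorAlong W) : ∃ D' : TangentConnection I N,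
      (∀ x v w, hessian D' D (contMDiff_id (I := I) (M := N)) x v w = -W x v w) ∧
      ∀ x v w, hessian D D' (contMDiff_id (I := I) (M := N)) x v w = W x v w := by
  let W₀ (x : N) : V →L[ℝ] V →L[ℝ] V := W x
  -- The flip matches the argument order of `cov`, where the differentiated field comes before the
  -- direction, while `W` takes the direction first.
  let W' (x : N) : TangentSpace I x →L[ℝ] TangentSpace I x →L[ℝ] TangentSpace I x :=
    ((W₀ x).flip :)
  let cov (X : Π x : N, TangentSpace I x) (x : N) : TangentSpace I x →L[ℝ] TangentSpace I x :=
    D.cov X x + W' x (X x)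
  have hcov (X x) (v : TangentSpace I x) : cov X x v = D.cov X x v + W x v (X x) := rfl
  have hcovD : IsCovariantDerivativeOn V cov Set.univ := by
    refine ⟨fun {X X' p} hX hX' _ => ?_, fun {X f p} hX hf _ => ?_⟩
    · simp only [cov, D.cov.isCovariantDerivativeOnUniv.add hX hX', Pi.add_apply, map_add]
      abel
    · simp only [cov, D.cov.isCovariantDerivativeOnUniv.leibniz hX hf, Pi.smul_apply', map_smul, smul_add]
      abel
  have hsmooth {X Y : Π x : N, TangentSpace I x} (hX : IsSmoothField X) (hY : IsSmoothField Y) :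
      IsSmoothField (fun p => cov Y p (X p)) := isSmoothField_of_forms fun θ hθ => by
    simp only [hcov, map_add]
    exact (hθ.apply (D.isSmoothField_cov hX hY)).add (hW X Y θ hX hY hθ)
  refine ⟨⟨⟨cov, hcovD⟩, ⟨⟨fun {Y} hY => ?_⟩⟩⟩, fun x v w => ?_, fun x v w => ?_⟩
  · refine contMDiffOn_univ.2 (contMDiff_hom_section fun X hX => hsmooth hX ?_)
    exact (contMDiffOn_univ.1 hY).of_le (by simp)
  · obtain ⟨Y, hY, -, rfl⟩ := exists_isSmoothField w
    rw [hessian_id_apply _ _ hY]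
    change _ - cov Y x v = _
    rw [hcov]
    abel
  · obtain ⟨Y, hY, -, rfl⟩ := exists_isSmoothField w
    rw [hessian_id_apply _ _ hY]
    change cov Y x v - _ = _
    rw [hcov]
    abel

end Connections

/-! ### Cohomology classes and the correction to a multiplicative connection. -/

namespace LieGroupoid

variable {E : Type*} [NormedAddCommGroup E] [NormedSpace ℝ E] [FiniteDimensional ℝ E]
  {E' : Type*} [NormedAddCommGroup E'] [NormedSpace ℝ E'] [FiniteDimensional ℝ E']
  {G : Type*} [TopologicalSpace G] [ChartedSpace E G] [IsManifold 𝓘(ℝ, E) ∞ G] [T2Space G]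
  {M : Type*} [TopologicalSpace M] [ChartedSpace E' M] [IsManifold 𝓘(ℝ, E') ∞ M] [T2Space M]
  (𝒢 : LieGroupoid E E' G M) {D D' : TangentConnection 𝓘(ℝ, E) G}

lemma cohomologyClass_eq_iff (A A' : 𝒢.cocycles 0) :
    𝒢.cohomologyClass A = 𝒢.cohomologyClass A' ↔
      ∃ W ∈ 𝒢.cochains₀, ∀ p v w, 𝒢.delta₀ W p v w = (A : 𝒢.TensorSucc 0) p v w -
        (A' : 𝒢.TensorSucc 0) p v w :=
  Submodule.Quotient.eq _

lemma cohomologyClass_eq_zero_iff (A : 𝒢.cocycles 0) : 𝒢.cohomologyClass A = 0 ↔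
    ∃ W ∈ 𝒢.cochains₀, ∀ p v w, 𝒢.delta₀ W p v w = (A : 𝒢.TensorSucc 0) p v w :=
  Submodule.Quotient.mk_eq_zero _

variable {𝒢} in
lemma IsSProjectable.exists_hessian_eq_zero [SecondCountableTopology G] (hD : 𝒢.IsSProjectable D) :
    ∃ DM : TangentConnection 𝓘(ℝ, E') M, ∀ x v w, hessian D DM 𝒢.contMDiff_src x v w = 0 := by
  have : LocallyCompactSpace G := Manifold.locallyCompact_of_finiteDimensional 𝓘(ℝ, E)
  obtain ⟨DM, h⟩ := hD
  exact ⟨DM, (connectionsRelated_iff_of_submersion D DM _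
    (surjective_mfderiv_of_isSubmersion 𝒢.src_submersion)).1 h⟩

variable {𝒢} in
/-- An `s`-projectable connection whose Atiyah cochain is a coboundary can be corrected to a
multiplicative one. -/
lemma exists_isMultiplicative [SecondCountableTopology G] [Nonempty G]
    {DM : TangentConnection 𝓘(ℝ, E') M} (hD : ∀ x v w, hessian D DM 𝒢.contMDiff_src x v w = 0)
    {D₂ : TangentConnection 𝓘(ℝ, 𝒢.SrcPowModel 1) (𝒢.SrcPow 1)} (h₂ : 𝒢.IsPowerConnection D D₂)
    {W : 𝒢.Tensor₀} (hW : W ∈ 𝒢.cochains₀)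
    (h : ∀ p v w, 𝒢.delta₀ W p v w = 𝒢.atiyah D D₂ p v w) :
    ∃ D' : TangentConnection 𝓘(ℝ, E) G, 𝒢.IsMultiplicative D' := by
  obtain ⟨hW, WM, hWM, hproj⟩ := hW
  -- The corrected connection is `D + W`. It projects to `DM + WM` because `W` projects to `WM`, and
  -- its Atiyah cochain is `At_D - δW = 0`.
  obtain ⟨D', hD', -⟩ := exists_connection_add D hW
  obtain ⟨DM', -, hDM'⟩ := exists_connection_add DM hWM
  have hsrc (g v w) : hessian D' DM' 𝒢.contMDiff_src g v w = 0 := by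
    have h1 := hessian_comp D' D DM (contMDiff_id (I := 𝓘(ℝ, E)) (M := G)) 𝒢.contMDiff_src g v w
    have h2 := hessian_comp D' DM DM' 𝒢.contMDiff_src (contMDiff_id (I := 𝓘(ℝ, E')) (M := M)) g v w
    rw [hD, hD', zero_add, map_neg] at h1
    rw [mfderiv_id, hDM'] at h2
    have h3 := hproj g v w
    have key (a b c d : E') (h1 : a = -b) (h2 : c = d + a) (h3 : b = d) : c = 0 := by
      rw [h2, h1, h3, add_neg_cancel]
    exact key _ _ _ _ h1 h2 h3
  obtain ⟨D₂', h₂'⟩ := exists_isPowerConnection hsrc 1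
  refine ⟨D', h₂'.isMultiplicative hsrc ?_⟩
  have hdiff : (difference D D' : 𝒢.Tensor₀) = (-1 : ℝ) • W := by
    funext g
    ext v w
    exact (hD' g v w).trans (neg_one_smul ..).symm
  funext p
  ext v w
  have h1 := h₂.delta₀_difference h₂' p v w
  rw [hdiff, delta₀_smul, Pi.smul_apply, Pi.smul_apply, Pi.smul_apply, h, neg_one_smul] at h1
  have key (a b : E) (h : -a = b - a) : b = 0 := by
    rwa [eq_comm, sub_eq_neg_self] at h
  exact key _ _ h1

end LieGroupoid

end

end LieGpd

theorem theorem3p6 {E E' G M : Type*}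
    [NormedAddCommGroup E] [NormedSpace ℝ E] [FiniteDimensional ℝ E]
    [NormedAddCommGroup E'] [NormedSpace ℝ E'] [FiniteDimensional ℝ E']
    [TopologicalSpace G] [ChartedSpace E G] [IsManifold 𝓘(ℝ, E) ∞ G]
    [T2Space G] [SecondCountableTopology G]
    [TopologicalSpace M] [ChartedSpace E' M] [IsManifold 𝓘(ℝ, E') ∞ M]
    [T2Space M] [SecondCountableTopology M]
    (𝒢 : LieGpd.LieGroupoid E E' G M) :
    -- every `s`-projectable connection has a well defined Atiyah cochain
    (∀ D : LieGpd.TangentConnection 𝓘(ℝ, E) G, 𝒢.IsSProjectable D →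
      ∃! A : 𝒢.TensorSucc 0, 𝒢.IsAtiyah D A) ∧
    -- it is a `1`-cochain, and a `1`-cocycle
    (∀ (D : LieGpd.TangentConnection 𝓘(ℝ, E) G) (A : 𝒢.TensorSucc 0), 𝒢.IsSProjectable D →
      𝒢.IsAtiyah D A → A ∈ 𝒢.cochains 0 ∧ 𝒢.delta 0 A = 0) ∧
    -- its cohomology class does not depend on the connection
    (∀ (D D' : LieGpd.TangentConnection 𝓘(ℝ, E) G) (A A' : 𝒢.cocycles 0),
      𝒢.IsSProjectable D → 𝒢.IsSProjectable D' → 𝒢.IsAtiyah D A → 𝒢.IsAtiyah D' A' →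
      𝒢.cohomologyClass A = 𝒢.cohomologyClass A') ∧
    -- the class vanishes iff there is a multiplicative connection
    (∀ (D : LieGpd.TangentConnection 𝓘(ℝ, E) G) (A : 𝒢.cocycles 0),
      𝒢.IsSProjectable D → 𝒢.IsAtiyah D A →
      (𝒢.cohomologyClass A = 0 ↔
        ∃ D' : LieGpd.TangentConnection 𝓘(ℝ, E) G, 𝒢.IsMultiplicative D')) := by
  open LieGpd LieGpd.LieGroupoid in
  -- If `G` is empty then so are `M` and all fibre products, and everything holds vacuously; the
  -- arguments above use a point of `G`.
  rcases isEmpty_or_nonempty G with hG | hG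
  · have hM : IsEmpty M := ⟨fun x => hG.elim (𝒢.one x)⟩
    have hS (n : ℕ) : IsEmpty (𝒢.SrcPow n) := ⟨fun p => hG.elim (p.coord 0)⟩
    have hC : IsEmpty 𝒢.Composable := ⟨fun p => hG.elim (p.coord 0)⟩
    obtain ⟨DM⟩ := nonempty_tangentConnection_of_isEmpty (I := 𝓘(ℝ, E')) (N := M)
    obtain ⟨D₂⟩ := nonempty_tangentConnection_of_isEmpty (I := 𝓘(ℝ, 𝒢.SrcPowModel 1)) (N := 𝒢.SrcPow 1)
    obtain ⟨DC⟩ := nonempty_tangentConnection_of_isEmpty (I := 𝓘(ℝ, 𝒢.ComposableModel))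
      (N := 𝒢.Composable)
    obtain ⟨Dprod⟩ := nonempty_tangentConnection_of_isEmpty (I := 𝓘(ℝ, E).prod 𝓘(ℝ, E)) (N := G × G)
    have hsub (A A' : 𝒢.TensorSucc 0) : A = A' := funext fun p => isEmptyElim p
    have hmul (D : TangentConnection 𝓘(ℝ, E) G) : 𝒢.IsMultiplicative D :=
      ⟨⟨DM, fun _ _ _ _ _ _ _ _ _ _ x => isEmptyElim x, fun _ _ _ _ _ _ _ _ _ _ x => isEmptyElim x⟩,
        DC, ⟨Dprod, ⟨fun _ _ _ _ _ _ _ _ _ _ x => isEmptyElim x,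
          fun _ _ _ _ _ _ _ _ _ _ x => isEmptyElim x⟩, fun _ _ _ _ _ _ _ _ _ _ x => isEmptyElim x⟩,
        fun _ _ _ _ _ _ _ _ _ _ x => isEmptyElim x⟩
    refine ⟨fun D _ => ⟨0, ⟨D₂, ⟨Dprod, ⟨fun _ _ _ _ _ _ _ _ _ _ x => isEmptyElim x,
      fun _ _ _ _ _ _ _ _ _ _ x => isEmptyElim x⟩, fun _ _ _ _ _ _ _ _ _ _ x => isEmptyElim x⟩,
      fun _ _ p => isEmptyElim p⟩, fun _ _ => hsub _ _⟩,
      fun D A _ _ => ⟨?_, funext fun p => isEmptyElim p⟩,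
      fun D D' A A' _ _ _ _ => congrArg _ (Subtype.ext (hsub _ _)), fun D A _ _ =>
        ⟨fun _ => ⟨D, hmul D⟩, fun _ => ?_⟩⟩
    · rw [hsub A 0]
      exact zero_mem _
    · rw [Subtype.ext (hsub A (0 : 𝒢.cocycles 0))]
      exact Submodule.Quotient.mk_zero _
  · refine ⟨fun D hD => ?_, fun D A hD hA => ?_, fun D D' A A' hD hD' hA hA' => ?_,
      fun D A hD hA => ⟨fun h => ?_, fun ⟨D', h⟩ => ?_⟩⟩
    · obtain ⟨DM, hDM⟩ := hD.exists_hessian_eq_zero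
      obtain ⟨D₂, h₂⟩ := exists_isPowerConnection hDM 1
      exact ⟨𝒢.atiyah D D₂, (h₂.isAtiyah_iff _).2 rfl, fun A hA => (h₂.isAtiyah_iff A).1 hA⟩
    · obtain ⟨DM, hDM⟩ := hD.exists_hessian_eq_zero
      obtain ⟨D₂, h₂⟩ := exists_isPowerConnection hDM 1
      rw [(h₂.isAtiyah_iff A).1 hA]
      exact ⟨h₂.atiyah_mem_cochains hDM, h₂.delta_atiyah hDM⟩
    · obtain ⟨DM, hDM⟩ := hD.exists_hessian_eq_zero
      obtain ⟨D₂, h₂⟩ := exists_isPowerConnection hDM 1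
      obtain ⟨DM', hDM'⟩ := hD'.exists_hessian_eq_zero
      obtain ⟨D₂', h₂'⟩ := exists_isPowerConnection hDM' 1
      refine (𝒢.cohomologyClass_eq_iff A A').2
        -- The order matters: `δ(D' - D) = At_D - At_{D'}`.
        ⟨difference D' D, difference_mem_cochains₀ hDM' hDM, fun p v w => ?_⟩
      rw [(h₂.isAtiyah_iff A).1 hA, (h₂'.isAtiyah_iff A').1 hA']
      exact h₂'.delta₀_difference h₂ p v w
    · obtain ⟨DM, hDM⟩ := hD.exists_hessian_eq_zero
      obtain ⟨D₂, h₂⟩ := exists_isPowerConnection hDM 1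
      obtain ⟨W, hW, hWA⟩ := (𝒢.cohomologyClass_eq_zero_iff A).1 h
      rw [(h₂.isAtiyah_iff A).1 hA] at hWA
      exact exists_isMultiplicative hDM h₂ hW hWA
    · obtain ⟨DM, hDM⟩ := hD.exists_hessian_eq_zero
      obtain ⟨D₂, h₂⟩ := exists_isPowerConnection hDM 1
      -- A multiplicative connection is in particular `s`-projectable, so it can be compared with
      -- `D`; its Atiyah cochain is zero, and `At_D` is the coboundary of `D' - D`.
      have hD' : 𝒢.IsSProjectable D' := h.1.imp fun _ h => h.1
      obtain ⟨DM', hDM'⟩ := hD'.exists_hessian_eq_zero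
      obtain ⟨D₂', h₂'⟩ := exists_isPowerConnection hDM' 1
      refine (𝒢.cohomologyClass_eq_zero_iff A).2
        ⟨difference D' D, difference_mem_cochains₀ hDM' hDM, fun p v w => ?_⟩
      rw [(h₂.isAtiyah_iff A).1 hA, h₂'.delta₀_difference h₂, h₂'.atiyah_eq_zero h]
      exact sub_zero _
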